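/- **Conventions.** Algorithms are deterministic programs of a random access machine (finitely many named registers, an indirectly addressed memory, addition, truncated subtraction, multiplication and integer division of natural numbers, branching and loops), and running time is logarithmic cost: each instruction is charged the bit lengths of the numbers and addresses it handles. The Strong Exponential Time Hypothesis (SETH) is the assertion that for every $\varepsilon>0$ there is a $k\ge 3$ such that no algorithm decides, in time $O(2^{(1-\varepsilon)n})$, the satisfiability of $k$-CNF formulas with $n$ variables (every clause has $k$ literals, and no clause is repeated). For $d_2,d_\infty\ge 1$ the $\ell_2$-product of $\ell_\infty$ metrics on $\mathbb{R}^{d_2\times d_\infty}$ is $$\Delta_{2,\infty}(x,y)=\sqrt{\sum_{i=1}^{d_2}\Big(\max_{1\le j\le d_\infty}|x_{i,j}-y_{i,j}|\Big)^2},$$ and the diameter of a finite non-empty set $X\subset\mathbb{R}^{d_2\times d_\infty}$ is $\operatorname{diam}X=\max_{x,y\in X}\Delta_{2,\infty}(x,y)$. **Theorem (Product-Metric Diameter).** Assume SETH. Let $\varepsilon,\delta>0$ be constants. Then there is a function $D:\mathbb{N}\to\mathbb{N}$ with $D(N)\le N^{o(1)}$ such that no algorithm with running time $O(N^{2-\varepsilon})$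 achieves a $(2-\delta)$-approximation of the diameter of sets $X\subset\mathbb{R}^{d_2\times d_\infty}$ of $N\ge 1$ different points, even if only sets with $d_2 d_\infty\le D(N)$ and with all coordinates in $\{-1,0,1\}$ are considered. This holds for both meanings of approximation: no such algorithm finds, for every such $X$, two points $x,y\in X$ with $\operatorname{diam}X\le(2-\delta)\,\Delta_{2,\infty}(x,y)$, and no such algorithm finds, for every such $X$, a rational number $v$ with $v\le\operatorname{diam}X\le(2-\delta)\,v$. -/

import Mathlib

/-! ### Random access machines with logarithmic cost -/

namespace RAM

/-- Arithmetic operations on natural numbers: addition, truncated subtraction, multiplication,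
division with rounding down (division by zero gives zero). -/
inductive BinOp where
  | add
  | sub
  | mul
  | div

def BinOp.eval : BinOp → ℕ → ℕ → ℕ
  | .add, x, y => x + y
  | .sub, x, y => x - y
  | .mul, x, y => x * y
  | .div, x, y => x / y

/-- Programs of a random access machine, with structured control flow. The arguments of the
constructors are names of registers, except for the second argument of `const`. -/
inductive Program where
  /-- do nothing -/
  | nop : Program
  /-- `const r c` : `R[r] := c` -/
  | const (r c : ℕ) : Program
  /-- `arith o r a b` : `R[r] := R[a] o R[b]` -/
  | arith (o : BinOp) (r a b : ℕ) : Program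
  /-- `load r a` : `R[r] := M[R[a]]` -/
  | load (r a : ℕ) : Program
  /-- `store a r` : `M[R[a]] := R[r]` -/
  | store (a r : ℕ) : Program
  /-- first `p`, then `q` -/
  | seq (p q : Program) : Program
  /-- if `R[r] ≠ 0` then `p` else `q` -/
  | ite (r : ℕ) (p q : Program) : Program
  /-- while `R[r] ≠ 0` do `p` -/
  | loop (r : ℕ) (p : Program) : Program

/-- The registers `R` and the memory `M`; every cell holds a natural number. A program names
only finitely many registers, while the memory is addressed indirectly. -/
structure State where
  reg : ℕ → ℕ
  mem : ℕ → ℕ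

def State.setReg (s : State) (r v : ℕ) : State :=
  { s with reg := Function.update s.reg r v }

def State.setMem (s : State) (a v : ℕ) : State :=
  { s with mem := Function.update s.mem a v }

/-- The logarithmic cost of handling the number `v`: one more than its number of binary digits. -/
def len (v : ℕ) : ℕ := Nat.size v + 1

/-- `Runs p s t s'`: started in the state `s`, the program `p` halts in the state `s'` at total
cost `t`. An instruction is charged the lengths of the operands and addresses that it handles. -/
inductive Runs : Program → State → ℕ → State → Prop where
  | nop (s : State) : Runs .nop s 1 s
  | const (s : State) (r c : ℕ) : Runs (.const r c) s (len c) (s.setReg r c)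
  | arith (s : State) (o : BinOp) (r a b : ℕ) :
      Runs (.arith o r a b) s (len (s.reg a) + len (s.reg b))
        (s.setReg r (o.eval (s.reg a) (s.reg b)))
  | load (s : State) (r a : ℕ) :
      Runs (.load r a) s (len (s.reg a) + len (s.mem (s.reg a)))
        (s.setReg r (s.mem (s.reg a)))
  | store (s : State) (a r : ℕ) :
      Runs (.store a r) s (len (s.reg a) + len (s.reg r)) (s.setMem (s.reg a) (s.reg r))
  | seq {p q : Program} {s₁ s₂ s₃ : State} {t₁ t₂ : ℕ} :
      Runs p s₁ t₁ s₂ → Runs q s₂ t₂ s₃ → Runs (.seq p q) s₁ (t₁ + t₂) s₃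
  | iteTrue {r : ℕ} {p q : Program} {s s' : State} {t : ℕ} :
      s.reg r ≠ 0 → Runs p s t s' → Runs (.ite r p q) s (len (s.reg r) + t) s'
  | iteFalse {r : ℕ} {p q : Program} {s s' : State} {t : ℕ} :
      s.reg r = 0 → Runs q s t s' → Runs (.ite r p q) s (len (s.reg r) + t) s'
  | loopDone {r : ℕ} {p : Program} {s : State} :
      s.reg r = 0 → Runs (.loop r p) s (len (s.reg r)) s
  | loopStep {r : ℕ} {p : Program} {s₁ s₂ s₃ : State} {t₁ t₂ : ℕ} :
      s₁.reg r ≠ 0 → Runs p s₁ t₁ s₂ → Runs (.loop r p) s₂ t₂ s₃ →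
      Runs (.loop r p) s₁ (len (s₁.reg r) + t₁ + t₂) s₃

/-- The initial state on input `xs`: the input stands in the memory from address `0` on, and
everything else is `0`. -/
def initState (xs : List ℕ) : State where
  reg := fun _ => 0
  mem := fun a => xs.getD a 0

/-- On input `xs` the program `p` halts at cost at most `T`, and the numbers in the output
registers `0` and `1` satisfy `good`. -/
def SucceedsWithin (p : Program) (xs : List ℕ) (T : ℝ) (good : ℕ → ℕ → Prop) : Prop :=
  ∃ (t : ℕ) (s : State),
    Runs p (initState xs) t s ∧ (t : ℝ) ≤ T ∧ good (s.reg 0) (s.reg 1)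

end RAM

/-! ### `k`-SAT and the Strong Exponential Time Hypothesis -/

/-- A variable among `n` variables, with the truth value that makes the literal true. -/
abbrev Literal (n : ℕ) := Fin n × Bool

/-- A clause with `k` literals, which need not be different. -/
abbrev Clause (k n : ℕ) := Fin k → Literal n

/-- A `k`-CNF formula on `n` variables: a conjunction of clauses, without repeated clauses. -/
structure KCNF (k n : ℕ) where
  clauses : List (Clause k n)
  nodup : clauses.Nodup

namespace KCNF

variable {k n : ℕ}

def Satisfiable (φ : KCNF k n) : Prop :=
  ∃ v : Fin n → Bool, ∀ c ∈ φ.clauses, ∃ i, v (c i).1 = (c i).2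

/-- The formula as input of a machine: the number of variables, the number of clauses, and then
the literals of all the clauses in turn; the literals of variable `x` have the codes `2x + 1`
(positive) and `2x` (negative). -/
def encode (φ : KCNF k n) : List ℕ :=
  n :: φ.clauses.length ::
    φ.clauses.flatMap fun c => List.ofFn fun i => 2 * ((c i).1 : ℕ) + (c i).2.toNat

end KCNF

/-- The program `p` decides `k`-SAT, within cost `T n` on formulas with `n` variables. -/
def DecidesKSAT (k : ℕ) (p : RAM.Program) (T : ℕ → ℝ) : Prop :=
  ∀ (n : ℕ) (φ : KCNF k n),
    RAM.SucceedsWithin p φ.encode (T n) fun out _ => out = 1 ↔ φ.Satisfiable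

/-- The Strong Exponential Time Hypothesis: for every `ε > 0` there is a `k ≥ 3` such that `k`-SAT
on `n` variables cannot be solved in time `O(2 ^ ((1 - ε) n))`. -/
def SETH : Prop :=
  ∀ ε : ℝ, 0 < ε → ∃ k : ℕ, 3 ≤ k ∧
    ¬ ∃ (p : RAM.Program) (C : ℝ),
      DecidesKSAT k p fun n => C * (2 : ℝ) ^ ((1 - ε) * (n : ℝ))

/-! ### The diameter in the `ℓ₂`-product of `ℓ_∞` metrics -/

/-- `ℝ ^ (d₂ × d∞)` with the `ℓ₂`-product of `d₂` copies of the `ℓ_∞` metric on `ℝ ^ d∞`. -/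
abbrev ProductSpace (dTwo dInf : ℕ) := PiLp 2 fun _ : Fin dTwo => (Fin dInf → ℝ)

/-- A set of `N` different points with integer coordinates, listed in some order. -/
structure DiameterInstance (N dTwo dInf : ℕ) where
  coord : Fin N → Fin dTwo → Fin dInf → ℤ
  injective : Function.Injective coord

namespace DiameterInstance

variable {N dTwo dInf : ℕ}

noncomputable def point (X : DiameterInstance N dTwo dInf) (a : Fin N) : ProductSpace dTwo dInf :=
  WithLp.toLp 2 fun i j => (X.coord a i j : ℝ)

/-- The largest distance between two of the points. -/
noncomputable def diam (X : DiameterInstance N dTwo dInf) : ℝ :=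
  Metric.diam (Set.range X.point)

/-- The instance as input of a machine: `N`, `d₂`, `d∞`, and then the coordinates of all the points
in turn, row by row. The integers are coded by `0 ↦ 0, -1 ↦ 1, 1 ↦ 2, -2 ↦ 3, …`. -/
def encode (X : DiameterInstance N dTwo dInf) : List ℕ :=
  N :: dTwo :: dInf ::
    (List.finRange N).flatMap fun a =>
      (List.finRange dTwo).flatMap fun i =>
        List.ofFn fun j => Equiv.intEquivNat (X.coord a i j)

/-- `a` and `b` are positions of two points whose distance is the diameter up to a factor `α`. -/
def IsApproxPair (X : DiameterInstance N dTwo dInf) (α : ℝ) (a b : ℕ) : Prop :=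
  ∃ (ha : a < N) (hb : b < N), X.diam ≤ α * dist (X.point ⟨a, ha⟩) (X.point ⟨b, hb⟩)

/-- The rational number `a / b` is the diameter up to a factor `α`. -/
def IsApproxValue (X : DiameterInstance N dTwo dInf) (α : ℝ) (a b : ℕ) : Prop :=
  0 < b ∧ (a : ℝ) / b ≤ X.diam ∧ X.diam ≤ α * ((a : ℝ) / b)

end DiameterInstance

/-- Within cost `T N`, the program `p` returns a pair of points that approximates the diameter up
to a factor `α`, on all sets of `N ≥ 1` points of dimensions `d₂, d∞ ≥ 1` with `d₂ d∞ ≤ D N` and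
all coordinates in `{-1, 0, 1}`. -/
def FindsApproxPair (p : RAM.Program) (α : ℝ) (D : ℕ → ℕ) (T : ℕ → ℝ) : Prop :=
  ∀ (N dTwo dInf : ℕ), 1 ≤ N → 1 ≤ dTwo → 1 ≤ dInf → dTwo * dInf ≤ D N →
    ∀ X : DiameterInstance N dTwo dInf, (∀ a i j, |X.coord a i j| ≤ 1) →
      RAM.SucceedsWithin p X.encode (T N) (X.IsApproxPair α)

/-- The same for a program that returns an approximate value of the diameter. -/
def FindsApproxValue (p : RAM.Program) (α : ℝ) (D : ℕ → ℕ) (T : ℕ → ℝ) : Prop :=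
  ∀ (N dTwo dInf : ℕ), 1 ≤ N → 1 ≤ dTwo → 1 ≤ dInf → dTwo * dInf ≤ D N →
    ∀ X : DiameterInstance N dTwo dInf, (∀ a i j, |X.coord a i j| ≤ 1) →
      RAM.SucceedsWithin p X.encode (T N) (X.IsApproxValue α)

/-- `D N = N ^ o(1)`. -/
def Subpolynomial (D : ℕ → ℕ) : Prop :=
  ∀ η : ℝ, 0 < η → ∀ᶠ N : ℕ in Filter.atTop, (D N : ℝ) ≤ (N : ℝ) ^ η

/-! The proof is a reduction from `k`-SAT that turns a Merlin–Arthur style protocol into a metric.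
Split the variables into two halves. A point is a number: bit `0` tells to which half it belongs,
the next bits assign that half, and the remaining digits, in base `q = order k c n` with `q` prime,
are a guessed proof. The rows (the factors of the ℓ₂-product) are the field elements `z`, i.e. the
random choices of the protocol. The columns are the possible messages of the second half, plus tag
columns with bits of the point that only keep the points different. In row `z` an even point has `1`
at every message that it accepts, and an odd point has `-1` at the single message that it sends. So
a row contributes `2` to the distance of an even and an odd point if the message is accepted, and at
most `1` otherwise; two points of equal parity are at distance at most `1` in every row.

The protocol counts false clauses. The `2n` literals are cut into `G = groups k n` groups of width
`T`. For each clause a product of `k` polynomials, with exponents in base `G`, has the falsity of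
the clause as one coefficient (`coeff_prod_sum`). Multiplication by a power of `X` moves this
coefficient to the exponent `M - 1`, where `M = G ^ k`, so in the sum over the clauses this
coefficient is the number of false clauses (`coeff_clausePoly`). Each factor is additive in the two
halves; hence `k * T` field elements sent by the second half suffice to evaluate the sum at `z`
(`eval_clausePoly`). The proof lists all coefficients except the one at `M - 1`, which is taken to
be `0`. If no clause is false, the honest proof is accepted in every row (`exists_accepted`), and
the squared distance is at least `4q`. Otherwise two different polynomials of degree at most `2M`
agree in at most `2M` rows (`card_accept_le`), and the squared distance is at most `q + 6M`. The
choice of `q` makes the ratio of the distances exceed `2 - δ`.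

With `G` about `n ^ (1 / (k + 1))`, messages have `O((n / G) log n) = o(n)` bits and proofs have
`O(G ^ k log n) = o(n)` bits. Thus there are `N = 2 ^ (n / 2 + o(n))` points of dimension `2 ^ o(n)
= N ^ o(1)`, and time `N ^ (2 - ε)` would contradict SETH.

What remains is the cost on the machine. `Comp` is a class of functions, closed under arithmetic,
case distinction and bounded sums and products, whose cost is polynomial in a loop bound but only
linear in the bit length of the data. It contains every cell of the instance, and `exists_reduction`
assembles the complete program from such functions. -/

namespace RAM

/-! ### Bit lengths and updates of states -/

theorem len_pos (v : ℕ) : 1 ≤ len v := Nat.le_add_left _ _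

theorem len_mono {a b : ℕ} (h : a ≤ b) : len a ≤ len b :=
  Nat.succ_le_succ (Nat.size_le_size h)

theorem len_le_add_one (v : ℕ) : len v ≤ v + 1 :=
  Nat.succ_le_succ (Nat.size_le.2 Nat.lt_two_pow_self)

theorem len_le_of_lt_two_pow {v e : ℕ} (h : v < 2 ^ e) : len v ≤ e + 1 :=
  Nat.succ_le_succ (Nat.size_le.2 h)

/-- The right side is exactly the charge for the instruction, so a result is never longer than what
was paid for it. It also makes accumulators grow only additively in length. -/
theorem BinOp.len_eval_le (o : BinOp) (x y : ℕ) : len (o.eval x y) ≤ len x + len y := by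
  have hx := Nat.lt_size_self x
  have hy := Nat.lt_size_self y
  cases o with
  | add =>
    have h : x + y < 2 ^ (Nat.size x + Nat.size y + 1) := by
      have h1 : 2 ^ Nat.size x ≤ 2 ^ (Nat.size x + Nat.size y) :=
        Nat.pow_le_pow_right (by norm_num) (by omega)
      have h2 : 2 ^ Nat.size y ≤ 2 ^ (Nat.size x + Nat.size y) :=
        Nat.pow_le_pow_right (by norm_num) (by omega)
      rw [pow_succ]; omega
    have := len_le_of_lt_two_pow h
    simp only [BinOp.eval, len] at *; omega
  | sub => exact (len_mono (Nat.sub_le x y)).trans (Nat.le_add_right _ _)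
  | mul =>
    have h : x * y < 2 ^ (Nat.size x + Nat.size y) := by
      rw [pow_add]; exact Nat.mul_lt_mul'' hx hy
    have := len_le_of_lt_two_pow h
    simp only [BinOp.eval, len] at *; omega
  | div => exact (len_mono (Nat.div_le_self x y)).trans (Nat.le_add_right _ _)

@[simp] theorem State.setReg_reg (s : State) (r v x : ℕ) :
    (s.setReg r v).reg x = if x = r then v else s.reg x := by
  simp [State.setReg, Function.update_apply]

@[simp] theorem State.setReg_mem (s : State) (r v : ℕ) : (s.setReg r v).mem = s.mem := rfl

@[simp] theorem State.setMem_reg (s : State) (r v : ℕ) : (s.setMem r v).reg = s.reg := rfl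

@[simp] theorem State.setMem_mem (s : State) (r v x : ℕ) :
    (s.setMem r v).mem x = if x = r then v else s.mem x := by
  simp [State.setMem, Function.update_apply]

/-- A type whose elements give the values of finitely many variables and a read-only memory.
Variable `0` bounds the number of iterations of loops. -/
class Ctx (α : Type) where
  arity : ℕ
  arity_pos : 0 < arity
  var : α → ℕ → ℕ
  mem : α → ℕ → ℕ

instance {α : Type} [Ctx α] : Ctx (α × ℕ) where
  arity := Ctx.arity α + 1
  arity_pos := Nat.succ_pos _
  var p r := if r < Ctx.arity α then Ctx.var p.1 r else p.2
  mem p := Ctx.mem p.1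

namespace Ctx

variable {α : Type} [Ctx α]

/-- The bound on the number of iterations of loops. -/
def lim (a : α) : ℕ := var a 0

/-- The state `s` stores the variables at the locations `loc`, and the memory. -/
def Holds (loc : ℕ → ℕ) (a : α) (s : State) : Prop :=
  (∀ r < arity α, s.reg (loc r) = var a r) ∧ s.mem = mem a

/-- All variables and memory cells have length at most `B`. -/
def Bounded (a : α) (B : ℕ) : Prop :=
  (∀ r < arity α, len (var a r) ≤ B) ∧ ∀ x, len (mem a x) ≤ B

theorem Bounded.one_le {a : α} {B : ℕ} (h : Bounded a B) : 1 ≤ B :=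
  (len_pos _).trans (h.1 0 (arity_pos))

@[simp] theorem lim_prod (p : α × ℕ) : lim p = lim p.1 := by
  simp [lim, var, arity_pos]

end Ctx

/-! ### A calculus of cheaply computable functions -/

open Ctx

/-- `f` can be computed, for arguments in `S`, by a program whose cost, and the length of whose
result, is polynomial in the loop bound and linear in the length of the variables. -/
def Comp {α : Type} [Ctx α] (S : α → Prop) (f : α → ℕ) : Prop :=
  ∃ K : ℕ, (∀ a B, S a → Bounded a B → len (f a) ≤ (lim a + 2) ^ K * B) ∧
    ∀ (d : ℕ) (loc : ℕ → ℕ), (∀ r < arity α, loc r < d) → ∃ (p : Program) (w : ℕ),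
      ∀ (a : α) (s : State) (B : ℕ), S a → Holds loc a s → Bounded a B →
        ∃ (t : ℕ) (s' : State), Runs p s t s' ∧ t ≤ (lim a + 2) ^ K * B ∧ s'.mem = s.mem ∧
          s'.reg d = f a ∧ ∀ r, r < d ∨ d + w ≤ r → s'.reg r = s.reg r

namespace Comp

variable {α : Type} [Ctx α] {S : α → Prop} {f g : α → ℕ}

theorem congr (hf : Comp S f) (h : ∀ a, S a → f a = g a) : Comp S g := by
  obtain ⟨K, h1, h2⟩ := hf
  refine ⟨K, fun a B ha hB => h a ha ▸ h1 a B ha hB, fun d loc hd => ?_⟩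
  obtain ⟨p, w, hp⟩ := h2 d loc hd
  exact ⟨p, w, fun a s B ha => h a ha ▸ hp a s B ha⟩

theorem weaken {S' : α × ℕ → Prop} (hf : Comp S f) (h : ∀ a, S' a → S a.1) :
    Comp S' fun p => f p.1 := by
  obtain ⟨K, h1, h2⟩ := hf
  have hB : ∀ (a : α × ℕ) B, Bounded a B → Bounded a.1 B := fun a B hB =>
    ⟨fun r hr => by simpa [var, hr] using hB.1 r (Nat.lt_succ_of_lt hr), hB.2⟩
  refine ⟨K, fun a B ha hb => by simpa using h1 a.1 B (h a ha) (hB a B hb), fun d loc hd => ?_⟩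
  obtain ⟨p, w, hp⟩ := h2 d loc fun r hr => hd r (Nat.lt_succ_of_lt hr)
  refine ⟨p, w, fun a s B ha hs hb => ?_⟩
  have := hp a.1 s B (h a ha)
    ⟨fun r hr => by simpa [var, hr] using hs.1 r (Nat.lt_succ_of_lt hr), hs.2⟩ (hB a B hb)
  simpa using this

theorem le_pow_mul {a : α} {B K c : ℕ} (h : c ≤ 2 ^ K) (hB : 1 ≤ B) :
    c ≤ (lim a + 2) ^ K * B :=
  h.trans ((Nat.pow_le_pow_left (by omega) K).trans (Nat.le_mul_of_pos_right _ hB))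

theorem const (c : ℕ) : Comp S fun _ => c := by
  refine ⟨len c, fun a B _ hB => le_pow_mul Nat.lt_two_pow_self.le hB.one_le, fun d loc _ =>
    ⟨.const d c, 1, fun a s B _ _ hB => ⟨_, _, Runs.const s d c,
      le_pow_mul Nat.lt_two_pow_self.le hB.one_le, rfl, by simp, fun r hr => ?_⟩⟩⟩
  have : r ≠ d := by omega
  simp [this]

theorem var (r : ℕ) (hr : r < arity α) : Comp S fun a => Ctx.var a r := by
  refine ⟨2, fun a B _ hB => ?_, fun d loc hd =>
    ⟨.seq (.const d 0) (.arith .add d (loc r) d), 1, fun a s B _ hs hB =>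
      ⟨_, _, (Runs.const s d 0).seq (Runs.arith _ _ _ _ _), ?_, rfl, ?_, fun x hx => ?_⟩⟩⟩
  · exact (hB.1 r hr).trans (Nat.le_mul_of_pos_left _ (by positivity))
  · have h1 := hd r hr
    have h2 := hB.1 r hr
    have h3 := hB.one_le
    have h4 : loc r ≠ d := by omega
    have h5 : 4 * B ≤ (lim a + 2) ^ 2 * B :=
      Nat.mul_le_mul_right _ ((by norm_num : 4 ≤ 2 ^ 2).trans (Nat.pow_le_pow_left (by omega) 2))
    simp only [State.setReg_reg, h4, if_false, if_true, hs.1 r hr]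
    have : len 0 = 1 := rfl
    omega
  · have h1 := hd r hr
    have h4 : loc r ≠ d := by omega
    simp [h4, BinOp.eval, hs.1 r hr]
  · have : x ≠ d := by omega
    simp [this]

theorem snd {S : α × ℕ → Prop} : Comp S fun p : α × ℕ => p.2 :=
  (var (arity α) (Nat.lt_succ_self _)).congr fun p _ => by simp [Ctx.var]

theorem pow_mul_le {a : α} {K K' B : ℕ} (h : K ≤ K') :
    (lim a + 2) ^ K * B ≤ (lim a + 2) ^ K' * B :=
  Nat.mul_le_mul_right _ (Nat.pow_le_pow_right (by omega) h)

theorem four_mul_pow_mul_le {a : α} {K B : ℕ} :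
    4 * ((lim a + 2) ^ K * B) ≤ (lim a + 2) ^ (K + 2) * B := by
  rw [pow_add, mul_comm _ ((lim a + 2) ^ 2), mul_assoc]
  exact Nat.mul_le_mul_right _
    ((by norm_num : 4 ≤ 2 ^ 2).trans (Nat.pow_le_pow_left (by omega) 2))

theorem bin (o : BinOp) (hf : Comp S f) (hg : Comp S g) :
    Comp S fun a => o.eval (f a) (g a) := by
  obtain ⟨K₁, h1, h2⟩ := hf
  obtain ⟨K₂, h3, h4⟩ := hg
  have key : ∀ (a : α) (B : ℕ), (lim a + 2) ^ K₁ * B ≤ (lim a + 2) ^ (K₁ + K₂) * B ∧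
      (lim a + 2) ^ K₂ * B ≤ (lim a + 2) ^ (K₁ + K₂) * B ∧
      4 * ((lim a + 2) ^ (K₁ + K₂) * B) ≤ (lim a + 2) ^ (K₁ + K₂ + 2) * B := fun a B => by
    exact ⟨pow_mul_le (by omega), pow_mul_le (by omega), four_mul_pow_mul_le⟩
  refine ⟨K₁ + K₂ + 2, fun a B ha hB => ?_, fun d loc hd => ?_⟩
  · have := o.len_eval_le (f a) (g a)
    have := h1 a B ha hB
    have := h3 a B ha hB
    have := key a B
    beta_reduce
    omega
  · obtain ⟨p, w, hp⟩ := h2 d loc hd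
    obtain ⟨p', w', hp'⟩ := h4 (d + 1) loc fun r hr => (hd r hr).trans (Nat.lt_succ_self d)
    refine ⟨.seq p (.seq p' (.arith o d d (d + 1))), 1 + w + w', fun a s B ha hs hB => ?_⟩
    obtain ⟨t, s₁, r1, b1, m1, e1, f1⟩ := hp a s B ha hs hB
    obtain ⟨t', s₂, r2, b2, m2, e2, f2⟩ := hp' a s₁ B ha
      ⟨fun r hr => (f1 _ (Or.inl (hd r hr))).trans (hs.1 r hr), m1.trans hs.2⟩ hB
    have e3 : s₂.reg d = f a := (f2 d (Or.inl (Nat.lt_succ_self d))).trans e1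
    refine ⟨_, _, r1.seq (r2.seq (Runs.arith _ _ _ _ _)), ?_, m2.trans m1, by simp [e2, e3],
      fun r hr => ?_⟩
    · rw [e2, e3]
      have := h1 a B ha hB
      have := h3 a B ha hB
      have := key a B
      omega
    · have h5 : r ≠ d := by omega
      simp only [State.setReg_reg, h5, if_false]
      rw [f2 r (by omega), f1 r (by omega)]

theorem load (hf : Comp S f) : Comp S fun a => Ctx.mem a (f a) := by
  obtain ⟨K, h1, h2⟩ := hf
  have key : ∀ (a : α) (B : ℕ), B ≤ (lim a + 2) ^ K * B ∧
      4 * ((lim a + 2) ^ K * B) ≤ (lim a + 2) ^ (K + 2) * B := fun a B => by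
    exact ⟨Nat.le_mul_of_pos_left _ (by positivity), four_mul_pow_mul_le⟩
  refine ⟨K + 2, fun a B ha hB => ?_, fun d loc hd => ?_⟩
  · have := hB.2 (f a)
    have := key a B
    beta_reduce
    omega
  · obtain ⟨p, w, hp⟩ := h2 d loc hd
    refine ⟨.seq p (.load d d), 1 + w, fun a s B ha hs hB => ?_⟩
    obtain ⟨t, s₁, r1, b1, m1, e1, f1⟩ := hp a s B ha hs hB
    refine ⟨_, _, r1.seq (Runs.load _ _ _), ?_, m1, ?_, fun r hr => ?_⟩
    · rw [e1, m1, hs.2]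
      have := hB.2 (f a)
      have := h1 a B ha hB
      have := key a B
      omega
    · simp [e1, m1, hs.2]
    · have h5 : r ≠ d := by omega
      simp only [State.setReg_reg, h5, if_false]
      exact f1 r (by omega)

end Comp

/-! ### Counting loops -/

/-- Iterated application of an operation to the values of a function. -/
def BinOp.fold (o : BinOp) (c : ℕ) (f : ℕ → ℕ) : ℕ → ℕ
  | 0 => c
  | n + 1 => o.eval (o.fold c f n) (f n)

theorem BinOp.len_fold_le (o : BinOp) (c : ℕ) (f : ℕ → ℕ) (n E : ℕ) (h : ∀ i < n, len (f i) ≤ E) :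
    len (o.fold c f n) ≤ len c + n * E := by
  induction n with
  | zero => simp [BinOp.fold]
  | succ n ih =>
    have h1 := ih fun i hi => h i (Nat.lt_succ_of_lt hi)
    have h2 := h n (Nat.lt_succ_self n)
    have h3 := o.len_eval_le (o.fold c f n) (f n)
    rw [Nat.succ_mul]
    simp only [BinOp.fold]
    omega

/-- The body of a counting loop: remaining iterations in `d`, the number one in `d + 1`, accumulator
in `d + 2`, index in `d + 3`. -/
def foldBody (o : BinOp) (d : ℕ) (p : Program) : Program :=
  .seq p (.seq (.arith o (d + 2) (d + 2) (d + 4))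
    (.seq (.arith .add (d + 3) (d + 3) (d + 1)) (.arith .sub d d (d + 1))))

/-- Induction on the number `k` of remaining iterations. `I` stands for the storage of the context;
as it depends only on the memory and the registers below `d`, the loop cannot destroy it. One
iteration may cost about `n * E`, because the accumulator can reach that length. -/
theorem runs_foldLoop (o : BinOp) (c d w n E : ℕ) (p : Program) (f : ℕ → ℕ) (I : State → Prop)
    (hI : ∀ s s' : State, I s → s'.mem = s.mem → (∀ r < d, s'.reg r = s.reg r) → I s')
    (hf : ∀ i < n, len (f i) ≤ E)
    (hp : ∀ (s : State), I s → s.reg (d + 3) < n → ∃ t s', Runs p s t s' ∧ t ≤ E ∧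
      s'.mem = s.mem ∧ s'.reg (d + 4) = f (s.reg (d + 3)) ∧
      ∀ r, r < d + 4 ∨ d + 4 + w ≤ r → s'.reg r = s.reg r) :
    ∀ (k i : ℕ) (s : State), i + k = n → I s → s.reg d = k → s.reg (d + 1) = 1 →
      s.reg (d + 2) = o.fold c f i → s.reg (d + 3) = i →
      ∃ t s', Runs (.loop d (foldBody o d p)) s t s' ∧
        t ≤ 1 + k * (n * E + 2 * E + 4 * len n + 10 + len c) ∧ s'.mem = s.mem ∧
        s'.reg d = 0 ∧ s'.reg (d + 2) = o.fold c f n ∧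
        ∀ r, r < d ∨ d + 4 + w ≤ r → s'.reg r = s.reg r := by
  intro k
  induction k with
  | zero =>
    intro i s hi _ h0 _ h2 _
    refine ⟨_, s, Runs.loopDone h0, ?_, rfl, h0, ?_, fun _ _ => rfl⟩
    · rw [h0]; simp [len]
    · rw [h2]; congr 1
  | succ k ih =>
    intro i s hi hs h0 h1 h2 h3
    obtain ⟨t, s₁, r1, b1, m1, e1, f1⟩ := hp s hs (by omega)
    have g0 := f1 d (by omega)
    have g1 := f1 (d + 1) (by omega)
    have g2 := f1 (d + 2) (by omega)
    have g3 := f1 (d + 3) (by omega)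
    have hb := r1.seq ((Runs.arith s₁ o (d + 2) (d + 2) (d + 4)).seq
      ((Runs.arith _ .add (d + 3) (d + 3) (d + 1)).seq (Runs.arith _ .sub d d (d + 1))))
    obtain ⟨t', s', r2, b2, m2, e2, e3, f2⟩ := ih (i + 1)
      (((s₁.setReg (d + 2) (o.fold c f (i + 1))).setReg (d + 3) (i + 1)).setReg d k) (by omega)
      (hI s _ hs (by simp [m1]) fun r hr => by
        have a1 : r ≠ d + 2 := by omega
        have a2 : r ≠ d + 3 := by omega
        have a3 : r ≠ d := by omega
        simp only [State.setReg_reg, a1, a2, a3, if_false]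
        exact f1 r (by omega))
      (by simp) (by simp [g1, h1]) (by simp) (by simp)
    simp only [State.setReg_reg, BinOp.eval, g0, g1, g2, g3, h0, h1, h2, h3, e1,
      Nat.add_left_cancel_iff, Nat.reduceEqDiff, if_false,
      Nat.left_eq_add, Nat.add_sub_cancel, OfNat.ofNat_ne_zero] at hb
    refine ⟨_, s', Runs.loopStep (by omega) hb r2, ?_, by simp [m2, m1], e2, e3, fun r hr => ?_⟩
    · have c1 := hf i (by omega)
      have c2 := o.len_fold_le c f i E fun j hj => hf j (by omega)
      have c3 : i * E ≤ n * E := Nat.mul_le_mul_right _ (by omega)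
      have c4 : len i ≤ len n := len_mono (by omega)
      have c5 : len (k + 1) ≤ len n := len_mono (by omega)
      have c6 : len 1 = 2 := rfl
      rw [Nat.succ_mul, h0]
      omega
    · rw [f2 r hr]
      have a1 : r ≠ d + 2 := by omega
      have a2 : r ≠ d + 3 := by omega
      have a3 : r ≠ d := by omega
      simp only [State.setReg_reg, a1, a2, a3, if_false]
      exact f1 r (by omega)

namespace Comp

variable {α : Type} [Ctx α] {S : α → Prop} {f g b : α → ℕ}

/-- The index is the additional variable of the context `α × ℕ`. Its length is at most `lim a + 1`,
so the length bound `B` becomes at most `(lim a + 2) * B`. Iterations and accumulator cost two more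
factors `lim a`, and the dependence on `B` stays linear. -/
theorem fold (o : BinOp) (c : ℕ) {S' : α × ℕ → Prop} {F : α → ℕ → ℕ} (hb : Comp S b)
    (hF : Comp S' fun p => F p.1 p.2) (hlim : ∀ a, S a → b a ≤ lim a)
    (hS : ∀ a i, S a → i < b a → S' (a, i)) :
    Comp S fun a => o.fold c (F a) (b a) := by
  obtain ⟨K₁, h1, h2⟩ := hb
  obtain ⟨K₂, h3, h4⟩ := hF
  have hBd : ∀ (a : α) (B i : ℕ), Bounded a B → i ≤ lim a → Bounded (a, i) ((lim a + 2) * B) := by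
    intro a B i hB hi
    have hle : B ≤ (lim a + 2) * B := Nat.le_mul_of_pos_left _ (by omega)
    refine ⟨fun r _ => ?_, fun x => (hB.2 x).trans hle⟩
    by_cases hr : r < arity α
    · simpa [Ctx.var, hr] using (hB.1 r hr).trans hle
    · simp only [Ctx.var, hr, if_false]
      have := len_le_add_one i
      have : (lim a + 2) * 1 ≤ (lim a + 2) * B := Nat.mul_le_mul_left _ hB.one_le
      omega
  set K := K₁ + K₂ + 3 with hK
  have hFlen : ∀ (a : α) (B : ℕ), S a → Bounded a B → ∀ i < b a,
      len (F a i) ≤ (lim a + 2) ^ K * B := by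
    intro a B ha hB i hi
    have := h3 (a, i) _ (hS a i ha hi) (hBd a B i hB (hi.le.trans (hlim a ha)))
    simp only [lim_prod] at this
    refine this.trans ?_
    rw [← mul_assoc, ← pow_succ]
    exact pow_mul_le (by omega)
  have h5 : ∀ (a : α) (B : ℕ), S a → Bounded a B → 
      1 ≤ (lim a + 2) ^ K * B ∧ len (b a) ≤ (lim a + 2) ^ K * B ∧
      B ≤ (lim a + 2) ^ K * B := fun a B ha hB =>
    ⟨Nat.mul_pos (by positivity) hB.one_le, (h1 a B ha hB).trans (pow_mul_le (by omega)),
      Nat.le_mul_of_pos_left _ (by positivity)⟩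
  -- The `2` pays for the square of the number of iterations, and `len c + 32` for the initial value
  -- and the numerical constants, as the base is at least `2`.
  refine ⟨K + 2 + (len c + 32), fun a B ha hB => ?_, fun d loc hd => ?_⟩
  · have e1 := o.len_fold_le c (F a) (b a) _ (hFlen a B ha hB)
    have e2 := h5 a B ha hB
    have e3 : b a * ((lim a + 2) ^ K * B) ≤ lim a * ((lim a + 2) ^ K * B) :=
      Nat.mul_le_mul_right _ (hlim a ha)
    have e4 : len c ≤ len c * ((lim a + 2) ^ K * B) := Nat.le_mul_of_pos_right _ e2.1
    calc len (o.fold c (F a) (b a)) ≤ (len c + lim a) * ((lim a + 2) ^ K * B) := by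
          rw [add_mul]; omega
      _ ≤ (lim a + 2) ^ (2 + (len c + 32)) * ((lim a + 2) ^ K * B) := by
          apply Nat.mul_le_mul_right
          have a1 : len c ≤ 2 ^ (len c) := Nat.lt_two_pow_self.le
          have a2 : 2 ^ len c ≤ (lim a + 2) ^ (1 + (len c + 32)) :=
            (Nat.pow_le_pow_right (by norm_num) (by omega)).trans
              (Nat.pow_le_pow_left (by omega) _)
          have a3 : lim a + 2 ≤ (lim a + 2) ^ (1 + (len c + 32)) :=
            Nat.le_self_pow (by omega) _
          rw [show 2 + (len c + 32) = (1 + (len c + 32)) + 1 by ring, pow_succ]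
          nlinarith
      _ = _ := by rw [← mul_assoc, ← pow_add]; congr 2; ring
  · obtain ⟨pb, wb, hpb⟩ := h2 d loc hd
    obtain ⟨p, w, hp⟩ := h4 (d + 4) (Function.update loc (arity α) (d + 3)) (by
      intro r hr
      by_cases h : r = arity α
      · subst h; simp
      · have hr' : r < arity α := lt_of_le_of_ne (Nat.lt_succ_iff.1 hr) h
        have := hd r hr'
        simp [Function.update_of_ne h]; omega)
    refine ⟨.seq pb (.seq (.const (d + 1) 1) (.seq (.const (d + 2) c) (.seq (.const (d + 3) 0)
      (.seq (.loop d (foldBody o d p)) (.arith .add d d (d + 2)))))), wb + (4 + w),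
      fun a s B ha hs hB => ?_⟩
    obtain ⟨t, s₁, r1, b1, m1, e1, f1⟩ := hpb a s B ha hs hB
    set E := (lim a + 2) ^ K * B with hE
    have H5 := h5 a B ha hB
    obtain ⟨t', s₂, r2, b2, m2, e2, e3, f2⟩ := runs_foldLoop o c d w (b a) E p (F a)
      (fun s => Holds loc a s)
      (fun s s' h hm hr => ⟨fun r h' => (hr _ (hd r h')).trans (h.1 r h'), hm.trans h.2⟩)
      (hFlen a B ha hB)
      (fun s hs hi => by
        obtain ⟨t, s', r, b, m, e, f⟩ := hp (a, s.reg (d + 3)) s ((lim a + 2) * B)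
          (hS a _ ha hi) ⟨fun r hr => by
            by_cases h : r = arity α
            · subst h; simp [Ctx.var]
            · have hr' : r < arity α := lt_of_le_of_ne (Nat.lt_succ_iff.1 hr) h
              simp [Function.update_of_ne h, Ctx.var, hr', hs.1 r hr'], hs.2⟩
          (hBd a B _ hB (hi.le.trans (hlim a ha)))
        refine ⟨t, s', r, b.trans ?_, m, e, f⟩
        simp only [lim_prod]
        rw [← mul_assoc, ← pow_succ]
        exact pow_mul_le (by omega))
      (b a) 0 (((s₁.setReg (d + 1) 1).setReg (d + 2) c).setReg (d + 3) 0) (by omega)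
      ⟨fun r hr => by
        have := hd r hr
        have a1 : loc r ≠ d + 3 := by omega
        have a2 : loc r ≠ d + 2 := by omega
        have a3 : loc r ≠ d + 1 := by omega
        simp only [State.setReg_reg, a1, a2, a3, if_false]
        exact (f1 _ (Or.inl this)).trans (hs.1 r hr), by simpa using m1.trans hs.2⟩
      (by simp [e1]) (by simp) (by simp [BinOp.fold]) (by simp)
    refine ⟨_, _, r1.seq ((Runs.const _ _ _).seq ((Runs.const _ _ _).seq ((Runs.const _ _ _).seq
      (r2.seq (Runs.arith _ _ _ _ _))))), ?_, by simpa using m2.trans m1, ?_, fun r hr => ?_⟩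
    · rw [e2, e3]
      have c1 : len (o.fold c (F a) (b a)) ≤ len c + b a * E :=
        o.len_fold_le c (F a) (b a) _ (hFlen a B ha hB)
      have c2 : b a * E ≤ lim a * E := Nat.mul_le_mul_right _ (hlim a ha)
      have c3 : t ≤ E := b1.trans (pow_mul_le (by omega))
      have c4 : len 1 = 2 := rfl
      have c5 : len 0 = 1 := rfl
      have c6 : len c ≤ len c * E := Nat.le_mul_of_pos_right _ H5.1
      have c7 : b a * (b a * E + 2 * E + 4 * len (b a) + 10 + len c) ≤
          lim a * (lim a * E + 16 * E + len c * E) := Nat.mul_le_mul (hlim a ha) (by omega)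
      calc _ ≤ 10 * E + 2 * (len c * E) + lim a * E +
            lim a * (lim a * E + 16 * E + len c * E) := by omega
        _ = (lim a * lim a + 17 * lim a + len c * lim a + 2 * len c + 10) * E := by ring
        _ ≤ (lim a + 2) ^ (2 + (len c + 32)) * E := by
            apply Nat.mul_le_mul_right
            have a1 : len c ≤ 2 ^ (len c) := Nat.lt_two_pow_self.le
            have a4 : (2 ^ len c) * 2 ^ 32 ≤ (lim a + 2) ^ (len c + 32) := by
              rw [← pow_add]; exact Nat.pow_le_pow_left (by omega) _
            have a5 : len c + 32 ≤ (lim a + 2) ^ (len c + 32) := by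
              have := Nat.one_le_two_pow (n := len c)
              norm_num at a4; omega
            rw [pow_add]
            refine le_trans ?_ (Nat.mul_le_mul_left _ a5)
            nlinarith [Nat.zero_le (len c * lim a), Nat.zero_le (len c * lim a ^ 2)]
        _ = _ := by rw [hE, ← mul_assoc, ← pow_add]; congr 2; ring
    · simp [BinOp.eval, e2, e3]
    · have h5 : r ≠ d := by omega
      have a1 : r ≠ d + 3 := by omega
      have a2 : r ≠ d + 2 := by omega
      have a3 : r ≠ d + 1 := by omega
      simp only [State.setReg_reg, h5, if_false]
      rw [f2 r (by omega)]
      simp only [State.setReg_reg, a1, a2, a3, if_false]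
      exact f1 r (by omega)

theorem sum {S' : α × ℕ → Prop} {F : α → ℕ → ℕ} (hb : Comp S b)
    (hF : Comp S' fun p => F p.1 p.2) (hlim : ∀ a, S a → b a ≤ lim a)
    (hS : ∀ a i, S a → i < b a → S' (a, i)) :
    Comp S fun a => ∑ i ∈ Finset.range (b a), F a i :=
  (fold .add 0 hb hF hlim hS).congr fun a _ => by
    induction b a with
    | zero => rfl
    | succ n ih => rw [Finset.sum_range_succ, ← ih]; rfl

theorem prod {S' : α × ℕ → Prop} {F : α → ℕ → ℕ} (hb : Comp S b)
    (hF : Comp S' fun p => F p.1 p.2) (hlim : ∀ a, S a → b a ≤ lim a)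
    (hS : ∀ a i, S a → i < b a → S' (a, i)) :
    Comp S fun a => ∏ i ∈ Finset.range (b a), F a i :=
  (fold .mul 1 hb hF hlim hS).congr fun a _ => by
    induction b a with
    | zero => rfl
    | succ n ih => rw [Finset.prod_range_succ, ← ih]; rfl

theorem add (hf : Comp S f) (hg : Comp S g) : Comp S fun a => f a + g a := bin .add hf hg
theorem sub (hf : Comp S f) (hg : Comp S g) : Comp S fun a => f a - g a := bin .sub hf hg
theorem mul (hf : Comp S f) (hg : Comp S g) : Comp S fun a => f a * g a := bin .mul hf hg
theorem div (hf : Comp S f) (hg : Comp S g) : Comp S fun a => f a / g a := bin .div hf hg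

theorem mod (hf : Comp S f) (hg : Comp S g) : Comp S fun a => f a % g a :=
  (hf.sub (hg.mul (hf.div hg))).congr fun _ _ => (Nat.mod_eq_sub_mul_div).symm

theorem pow (hf : Comp S f) (hg : Comp S g) (h : ∀ a, S a → g a ≤ lim a) :
    Comp S fun a => f a ^ g a :=
  (prod (S' := fun p => S p.1) (F := fun a _ => f a) hg (hf.weaken fun _ h => h) h
    fun _ _ h _ => h).congr fun _ _ => by simp

/-- A fixed exponent is unrolled into multiplications, so no loop bound is needed. Therefore the
loop bound itself can be computed this way. -/
theorem pow_const (hf : Comp S f) (c : ℕ) : Comp S fun a => f a ^ c := by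
  induction c with
  | zero => simpa only [pow_zero] using const 1
  | succ c ih => simpa only [pow_succ] using ih.mul hf

/-- Truncated subtraction gives the indicator `1 - (1 - (v - u))`, and no branching is needed. Both
alternatives are always evaluated, so each must be computable on all of `S` and not only in its own
case. -/
theorem ite_lt {u v : α → ℕ} (hu : Comp S u) (hv : Comp S v) (hf : Comp S f) (hg : Comp S g) :
    Comp S fun a => if u a < v a then f a else g a :=
  have h := (const 1).sub ((const 1).sub (hv.sub hu))
  ((h.mul hf).add (((const 1).sub h).mul hg)).congr fun a _ => by
    split_ifs with h
    · have : 1 - (1 - (v a - u a)) = 1 := by omega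
      simp [this]
    · have : 1 - (1 - (v a - u a)) = 0 := by omega
      simp [this]

theorem ite_eq {u v : α → ℕ} (hu : Comp S u) (hv : Comp S v) (hf : Comp S f) (hg : Comp S g) :
    Comp S fun a => if u a = v a then f a else g a :=
  (ite_lt (const 0) ((hu.sub hv).add (hv.sub hu)) hg hf).congr fun a _ => by
    split_ifs <;> first | rfl | omega

theorem ite_le {u v : α → ℕ} (hu : Comp S u) (hv : Comp S v) (hf : Comp S f) (hg : Comp S g) :
    Comp S fun a => if u a ≤ v a then f a else g a :=
  (ite_lt hv hu hg hf).congr fun a _ => by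
    split_ifs <;> first | rfl | omega

end Comp

end RAM

/-! ### The generic reduction: write an instance, run a given program on it, interpret the result -/

namespace RAM

open Ctx

/-- The registers `0, …, 5` of a state as variables. -/
instance : Ctx State where
  arity := 6
  arity_pos := by norm_num
  var s r := s.reg r
  mem s := s.mem

theorem lim_state (s : State) : lim s = s.reg 0 := rfl

theorem Comp.reg {S : State → Prop} (r : ℕ) (hr : r < 6) : Comp S fun s : State => s.reg r :=
  Comp.var r hr

/-- The value is computed from register `6` upward and then copied, so that it may overwrite a
variable on which it depends. -/
theorem exists_assign {S : State → Prop} {f : State → ℕ} (hf : Comp S f) (x : ℕ) (hx : x < 6) :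
    ∃ (K : ℕ) (p : Program) (w : ℕ), ∀ (s : State) (B : ℕ), S s → Bounded s B →
      len (f s) ≤ (s.reg 0 + 2) ^ K * B ∧
      ∃ t s', Runs p s t s' ∧ t ≤ (s.reg 0 + 2) ^ K * B ∧ s'.mem = s.mem ∧ s'.reg x = f s ∧
        ∀ r, r ≠ x → r < 6 ∨ w ≤ r → s'.reg r = s.reg r := by
  obtain ⟨K, h1, h2⟩ := hf
  obtain ⟨p, w, hp⟩ := h2 6 id fun r hr => hr
  refine ⟨K + 2, .seq p (.seq (.const x 0) (.arith .add x 6 x)), 6 + w, fun s B hs hB => ?_⟩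
  have a1 := h1 s B hs hB
  rw [lim_state] at a1
  have a2 : 4 * ((s.reg 0 + 2) ^ K * B) ≤ (s.reg 0 + 2) ^ (K + 2) * B :=
    Comp.four_mul_pow_mul_le (a := s)
  have a3 := len_pos (f s)
  refine ⟨by omega, ?_⟩
  obtain ⟨t, s₁, r1, b1, m1, e1, f1⟩ := hp s s B hs ⟨fun _ _ => rfl, rfl⟩ hB
  rw [lim_state] at b1
  refine ⟨_, _, r1.seq ((Runs.const _ _ _).seq (Runs.arith _ _ _ _ _)), ?_, m1, ?_,
    fun r hr hr' => ?_⟩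
  · have h6 : 6 ≠ x := by omega
    have : len 0 = 1 := rfl
    simp only [State.setReg_reg, h6, if_false, if_true, e1]
    omega
  · have h6 : 6 ≠ x := by omega
    simp [h6, e1, BinOp.eval]
  · simp only [State.setReg_reg, hr, if_false]
    exact f1 r (by omega)

/-- Overwriting the memory is harmless here: the value `g` depends only on registers. Register `4`
counts the cells written and register `5` those that remain. -/
theorem exists_storeLoop {V : ℕ → ℕ → ℕ → Prop} {g : ℕ → ℕ → ℕ → ℕ → ℕ}
    (hg : Comp (fun s : State => V (s.reg 0) (s.reg 1) (s.reg 2))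
      fun s => g (s.reg 1) (s.reg 2) (s.reg 3) (s.reg 4)) :
    ∃ (K : ℕ) (p : Program) (w : ℕ), ∀ (s : State) (B : ℕ), V (s.reg 0) (s.reg 1) (s.reg 2) →
      Bounded s B → s.reg 4 = 0 →
      (∀ i < s.reg 5, len (g (s.reg 1) (s.reg 2) (s.reg 3) i) ≤ B) →
      ∃ t s', Runs p s t s' ∧ t ≤ 1 + s.reg 5 * ((s.reg 0 + 2) ^ K * B) ∧
        (∀ r < 4, s'.reg r = s.reg r) ∧
        (∀ a, s'.mem a = if a < s.reg 5 then g (s.reg 1) (s.reg 2) (s.reg 3) a else s.mem a) ∧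
        ∀ r, w ≤ r → s'.reg r = s.reg r := by
  obtain ⟨K, -, h2⟩ := hg
  obtain ⟨p, w, hp⟩ := h2 6 id fun r hr => hr
  refine ⟨K + 4, .loop 5 (.seq p (.seq (.store 4 6) (.seq (.const 7 1)
    (.seq (.arith .add 4 4 7) (.arith .sub 5 5 7))))), 8 + w, fun s₀ B hV hB h4 hgB => ?_⟩
  set Z := s₀.reg 5 with hZ
  have hlenZ : len Z ≤ B := hB.1 5 (by decide)
  have key : ∀ (k i : ℕ) (s : State), i + k = Z → (∀ r < 4, s.reg r = s₀.reg r) →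
      s.reg 4 = i → s.reg 5 = k →
      (∀ a, s.mem a = if a < i then g (s₀.reg 1) (s₀.reg 2) (s₀.reg 3) a else s₀.mem a) →
      ∃ t s', Runs (.loop 5 (.seq p (.seq (.store 4 6) (.seq (.const 7 1)
        (.seq (.arith .add 4 4 7) (.arith .sub 5 5 7)))))) s t s' ∧
        t ≤ 1 + k * ((s₀.reg 0 + 2) ^ (K + 4) * B) ∧ (∀ r < 4, s'.reg r = s₀.reg r) ∧
        (∀ a, s'.mem a = if a < Z then g (s₀.reg 1) (s₀.reg 2) (s₀.reg 3) a else s₀.mem a) ∧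
        ∀ r, 8 + w ≤ r → s'.reg r = s.reg r := by
    intro k
    induction k with
    | zero =>
      intro i s hi hr h4 h5 hm
      refine ⟨_, s, Runs.loopDone h5, by rw [h5]; simp [len], hr, ?_, fun _ _ => rfl⟩
      have : i = Z := by omega
      exact this ▸ hm
    | succ k ih =>
      intro i s hi hr h4 h5 hm
      have hb : Bounded s B := by
        refine ⟨fun r hr6 => ?_, fun x => ?_⟩
        · have hr6' : r < 6 := hr6
          change len (s.reg r) ≤ B
          rcases (by omega : r < 4 ∨ r = 4 ∨ r = 5) with h | h | h
          · rw [hr r h]; exact hB.1 r hr6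
          · rw [h, h4]; exact (len_mono (by omega)).trans hlenZ
          · rw [h, h5]; exact (len_mono (by omega)).trans hlenZ
        · change len (s.mem x) ≤ B
          rw [hm]
          split_ifs with h
          · exact hgB x (by omega)
          · exact hB.2 x
      have q0 := hr 0 (by norm_num)
      have q1 := hr 1 (by norm_num)
      have q2 := hr 2 (by norm_num)
      have q3 := hr 3 (by norm_num)
      obtain ⟨t, s₁, r1, b1, m1, e1, f1⟩ := hp s s B (by simpa only [q0, q1, q2] using hV)
        ⟨fun _ _ => rfl, rfl⟩ hb
      rw [lim_state, q0] at b1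
      simp only [q1, q2, q3, h4] at e1
      have g4 := f1 4 (by omega)
      have g5 := f1 5 (by omega)
      have hrun := r1.seq ((Runs.store s₁ 4 6).seq ((Runs.const _ 7 1).seq
        ((Runs.arith _ .add 4 4 7).seq (Runs.arith _ .sub 5 5 7))))
      obtain ⟨t', s', r2, b2, f2, m2, f3⟩ := ih (i + 1)
        ((((s₁.setMem i (g (s₀.reg 1) (s₀.reg 2) (s₀.reg 3) i)).setReg 7 1).setReg 4
          (i + 1)).setReg 5 k) (by omega)
        (fun r h => by
          have a1 : r ≠ 5 := by omega
          have a2 : r ≠ 4 := by omega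
          have a3 : r ≠ 7 := by omega
          simp only [State.setReg_reg, State.setMem_reg, a1, a2, a3, if_false]
          rw [f1 r (by omega), hr r h])
        (by simp) (by simp)
        (fun a => by
          simp only [State.setReg_mem, State.setMem_mem, m1, hm]
          by_cases h1 : a = i
          · simp [h1]
          · have : a < i ↔ a < i + 1 := by omega
            simp [h1, this])
      simp only [State.setReg_reg, State.setMem_reg, BinOp.eval, g4, g5, h4, h5, e1,
        Nat.reduceEqDiff, if_true, if_false, Nat.add_sub_cancel] at hrun
      refine ⟨_, s', Runs.loopStep (by omega) hrun r2, ?_, f2, m2, fun r h => ?_⟩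
      · have c1 := hgB i (by omega)
        have c2 : len i ≤ B := (len_mono (by omega)).trans hlenZ
        have c3 : len (k + 1) ≤ B := (len_mono (by omega)).trans hlenZ
        have c4 : 4 * ((s₀.reg 0 + 2) ^ K * B) ≤ (s₀.reg 0 + 2) ^ (K + 2) * B :=
          Comp.four_mul_pow_mul_le (a := s₀)
        have c5 : 4 * ((s₀.reg 0 + 2) ^ (K + 2) * B) ≤ (s₀.reg 0 + 2) ^ (K + 4) * B :=
          Comp.four_mul_pow_mul_le (a := s₀)
        have c6 : B ≤ (s₀.reg 0 + 2) ^ K * B := Nat.le_mul_of_pos_left _ (by positivity)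
        have c7 : 1 ≤ B := hB.one_le
        have c8 : len 1 = 2 := rfl
        rw [Nat.succ_mul, h5]
        omega
      · rw [f3 r h]
        have a1 : r ≠ 5 := by omega
        have a2 : r ≠ 4 := by omega
        have a3 : r ≠ 7 := by omega
        simp only [State.setReg_reg, State.setMem_reg, a1, a2, a3, if_false]
        exact f1 r (by omega)
  exact key Z 0 s₀ (by omega) (fun _ _ => rfl) h4 rfl (fun a => by simp)

/-! ### Renaming of registers, and lengths during a run -/

/-- The program with all register names increased by `c`. -/
def Program.shift (c : ℕ) : Program → Program
  | .nop => .nop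
  | .const r v => .const (r + c) v
  | .arith o r a b => .arith o (r + c) (a + c) (b + c)
  | .load r a => .load (r + c) (a + c)
  | .store a r => .store (a + c) (r + c)
  | .seq p q => .seq (p.shift c) (q.shift c)
  | .ite r p q => .ite (r + c) (p.shift c) (q.shift c)
  | .loop r p => .loop (r + c) (p.shift c)

/-- The state `s` with registers moved up by `c`, and the registers below `c` taken from `low`. -/
def State.shift (c : ℕ) (low : ℕ → ℕ) (s : State) : State where
  reg r := if r < c then low r else s.reg (r - c)
  mem := s.mem

@[simp] theorem State.shift_reg_add (c : ℕ) (low : ℕ → ℕ) (s : State) (r : ℕ) :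
    (s.shift c low).reg (r + c) = s.reg r := by
  simp [State.shift]

@[simp] theorem State.shift_mem (c : ℕ) (low : ℕ → ℕ) (s : State) :
    (s.shift c low).mem = s.mem := rfl

theorem State.shift_setReg (c : ℕ) (low : ℕ → ℕ) (s : State) (r v : ℕ) :
    (s.setReg r v).shift c low = (s.shift c low).setReg (r + c) v := by
  simp only [State.shift, State.setReg, State.mk.injEq, and_true]
  funext x
  by_cases h : x < c
  · have : x ≠ r + c := by omega
    simp [h, Function.update_of_ne this]
  · by_cases h' : x = r + c
    · subst h'; simp
    · have : x - c ≠ r := by omega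
      simp [h, Function.update_of_ne this, Function.update_of_ne h']

theorem State.shift_setMem (c : ℕ) (low : ℕ → ℕ) (s : State) (r v : ℕ) :
    (s.setMem r v).shift c low = (s.shift c low).setMem r v := rfl

/-- A renamed program never touches the registers below `c`, so data kept there survive its run. No
instruction is charged for names of registers, hence the cost is the same. -/
theorem Runs.shift (c : ℕ) (low : ℕ → ℕ) {p : Program} {s s' : State} {t : ℕ}
    (h : Runs p s t s') : Runs (p.shift c) (s.shift c low) t (s'.shift c low) := by
  induction h with
  | nop s => exact Runs.nop _
  | const s r v => rw [State.shift_setReg]; exact Runs.const _ _ _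
  | arith s o r a b =>
    rw [State.shift_setReg]
    simpa [Program.shift] using Runs.arith (s.shift c low) o (r + c) (a + c) (b + c)
  | load s r a =>
    rw [State.shift_setReg]
    simpa [Program.shift] using Runs.load (s.shift c low) (r + c) (a + c)
  | store s a r =>
    rw [State.shift_setMem]
    simpa [Program.shift] using Runs.store (s.shift c low) (a + c) (r + c)
  | seq _ _ ih1 ih2 => exact ih1.seq ih2
  | @iteTrue r _ _ s _ _ h _ ih =>
    simpa [Program.shift] using Runs.iteTrue (q := _) (r := r + c) (by simpa using h) ih
  | @iteFalse r _ _ s _ _ h _ ih =>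
    simpa [Program.shift] using Runs.iteFalse (p := _) (r := r + c) (by simpa using h) ih
  | @loopDone r _ s h =>
    simpa [Program.shift] using Runs.loopDone (p := _) (r := r + c) (s := s.shift c low) (by simpa using h)
  | @loopStep r _ s _ _ _ _ h _ _ ih1 ih2 =>
    simpa [Program.shift] using Runs.loopStep (r := r + c) (by simpa using h) ih1 ih2

/-- Every value that is written has length at most the cost of the instruction that writes it. -/
theorem Runs.len_le {p : Program} {s s' : State} {t : ℕ} (h : Runs p s t s') (B : ℕ) (ht : t ≤ B)
    (hs : (∀ r, len (s.reg r) ≤ B) ∧ ∀ a, len (s.mem a) ≤ B) :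
    (∀ r, len (s'.reg r) ≤ B) ∧ ∀ a, len (s'.mem a) ≤ B := by
  have hreg : ∀ (s : State) (r v : ℕ), len v ≤ B →
      ((∀ r, len (s.reg r) ≤ B) ∧ ∀ a, len (s.mem a) ≤ B) →
      (∀ x, len ((s.setReg r v).reg x) ≤ B) ∧ ∀ a, len ((s.setReg r v).mem a) ≤ B := by
    intro s r v hv hs
    refine ⟨fun x => ?_, hs.2⟩
    rw [State.setReg_reg]
    split_ifs
    exacts [hv, hs.1 x]
  induction h with
  | nop s => exact hs
  | const s r v => exact hreg s r v ht hs
  | arith s o r a b => exact hreg s r _ ((o.len_eval_le _ _).trans ht) hs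
  | load s r a => exact hreg s r _ ((Nat.le_add_left _ _).trans ht) hs
  | store s a r =>
    refine ⟨hs.1, fun x => ?_⟩
    rw [State.setMem_mem]
    split_ifs
    exacts [(Nat.le_add_left _ _).trans ht, hs.2 x]
  | seq _ _ ih1 ih2 => exact ih2 (by omega) (ih1 (by omega) hs)
  | iteTrue _ _ ih => exact ih (by omega) hs
  | iteFalse _ _ ih => exact ih (by omega) hs
  | loopDone _ => exact hs
  | loopStep _ _ _ ih1 ih2 => exact ih2 (by omega) (ih1 (by omega) hs)

/-- The new instance is written over the input; hence the input is first packed into the single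
number `F`, kept in a register from which cells and answer are computed. The registers `0, …, 5`
hold the loop bound, `n`, `m`, `F`, the position and the number of cells; the last two later receive
the output of `p`. -/
theorem exists_reduction {V : ℕ → ℕ → ℕ → Prop} {Lf : ℕ → ℕ} {Ff : ℕ → ℕ → (ℕ → ℕ) → ℕ}
    {Zf : ℕ → ℕ → ℕ} {cell : ℕ → ℕ → ℕ → ℕ → ℕ} {post : ℕ → ℕ → ℕ → ℕ → ℕ → ℕ}
    (hL : Comp (fun _ : State => True) fun s => Lf (s.reg 1))
    (hF : Comp (fun s : State => V (s.reg 0) (s.reg 1) (s.reg 2))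
      fun s => Ff (s.reg 1) (s.reg 2) s.mem)
    (hZ : Comp (fun s : State => V (s.reg 0) (s.reg 1) (s.reg 2)) fun s => Zf (s.reg 1) (s.reg 2))
    (hcell : Comp (fun s : State => V (s.reg 0) (s.reg 1) (s.reg 2))
      fun s => cell (s.reg 1) (s.reg 2) (s.reg 3) (s.reg 4))
    (hpost : Comp (fun s : State => V (s.reg 0) (s.reg 1) (s.reg 2))
      fun s => post (s.reg 1) (s.reg 2) (s.reg 3) (s.reg 4) (s.reg 5))
    (p : Program) :
    ∃ (K : ℕ) (P : Program), ∀ (xs ys : List ℕ) (n m F B t : ℕ) (s : State),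
      n = xs.getD 0 0 → m = xs.getD 1 0 → F = Ff n m (fun a => xs.getD a 0) →
      V (Lf n) n m → (∀ a, len (xs.getD a 0) ≤ B) →
      (∀ a, ys.getD a 0 = if a < Zf n m then cell n m F a else 0) → xs.length ≤ Zf n m →
      Runs p (initState ys) t s →
      ∃ t' s', Runs P (initState xs) t' s' ∧
        t' ≤ (Lf n + 2) ^ K * B * (Zf n m + t + 1) ∧
        s'.reg 0 = post n m F (s.reg 0) (s.reg 1) := by
  obtain ⟨KL, pL, wL, hL⟩ := exists_assign hL 0 (by norm_num)
  obtain ⟨KF, pF, wF, hF⟩ := exists_assign hF 3 (by norm_num)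
  obtain ⟨KZ, pZ, wZ, hZ⟩ := exists_assign hZ 5 (by norm_num)
  obtain ⟨Ks, ps, ws, hs⟩ := exists_storeLoop hcell
  obtain ⟨Kc, hc, -⟩ := hcell
  obtain ⟨Kp, pp, wp, hp⟩ := exists_assign hpost 0 (by norm_num)
  set c := wL + wF + wZ + ws + wp + 6 with hcdef
  refine ⟨KL + KF + KZ + Kc + Ks + Kp + 5,
    .seq (.seq (.load 1 0) (.seq (.const 2 1) (.load 2 2))) (.seq pL (.seq pF (.seq pZ (.seq ps
      (.seq (p.shift c) (.seq (.seq (.const 4 0) (.seq (.arith .add 4 (0 + c) 4)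
        (.seq (.const 5 0) (.arith .add 5 (1 + c) 5)))) pp)))))),
    fun xs ys n m F B t s hn hm hFdef hV hB hys hxs hrun => ?_⟩
  set Q := Lf n + 2 with hQ
  set E := Q ^ (KL + KF + KZ + Kc + Ks + Kp) * B with hE
  have hEle : ∀ j ≤ KL + KF + KZ + Kc + Ks + Kp, Q ^ j * B ≤ E := fun j hj =>
    Nat.mul_le_mul_right _ (Nat.pow_le_pow_right (by omega) hj)
  have hB1 : 1 ≤ B := (len_pos _).trans (hB 0)
  -- reading the header
  set s₁ : State := ⟨fun r => if r = 1 then n else if r = 2 then m else 0,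
    fun a => xs.getD a 0⟩ with hs₁
  have run₁ := (Runs.load (initState xs) 1 0).seq ((Runs.const _ 2 1).seq (Runs.load _ 2 2))
  have e₁ : ((((initState xs).setReg 1 ((initState xs).mem ((initState xs).reg 0))).setReg 2 1
      ).setReg 2 (xs.getD 1 0)) = s₁ := by
    simp only [State.setReg, initState, hs₁, State.mk.injEq, and_true]
    funext r
    by_cases h1 : r = 1
    · subst h1; simp [hn]
    · by_cases h2 : r = 2
      · subst h2; simp [hm]
      · simp [h1, h2]
  have bd₁ : Bounded s₁ B := by
    refine ⟨fun r _ => ?_, hB⟩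
    change len (if r = 1 then n else if r = 2 then m else 0) ≤ B
    split_ifs
    exacts [hn ▸ hB 0, hm ▸ hB 1, hB1]
  -- the loop bound
  obtain ⟨l₂, t₂, s₂, run₂, c₂, m₂, v₂, f₂⟩ := hL s₁ B trivial bd₁
  have hs10 : s₁.reg 0 = 0 := rfl
  have hs11 : s₁.reg 1 = n := rfl
  have hs12 : s₁.reg 2 = m := rfl
  -- Register `0` is still `0`, so the loop bound is computed under the loop bound `0`.
  have hpowL : (0 + 2) ^ KL * B ≤ Q ^ KL * B :=
    Nat.mul_le_mul_right _ (Nat.pow_le_pow_left (by omega) _)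
  rw [hs10, hs11] at l₂
  rw [hs10] at c₂
  rw [hs11] at v₂
  have hBL : B ≤ Q ^ KL * B := Nat.le_mul_of_pos_left _ (by positivity)
  have bd₂ : Bounded s₂ (Q ^ KL * B) := by
    refine ⟨fun r hr => ?_, fun a => ?_⟩
    · change len (s₂.reg r) ≤ _
      by_cases h : r = 0
      · rw [h, v₂]; exact l₂.trans hpowL
      · rw [f₂ r h (Or.inl hr)]; exact (bd₁.1 r hr).trans hBL
    · change len (s₂.mem a) ≤ _
      rw [m₂]; exact (bd₁.2 a).trans hBL
  have r21 : s₂.reg 1 = n := f₂ 1 (by norm_num) (by norm_num)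
  have r22 : s₂.reg 2 = m := f₂ 2 (by norm_num) (by norm_num)
  have r24 : s₂.reg 4 = 0 := f₂ 4 (by norm_num) (by norm_num)
  -- the packed formula
  obtain ⟨l₃, t₃, s₃, run₃, c₃, m₃, v₃, f₃⟩ := hF s₂ _ (by rw [v₂, r21, r22]; exact hV) bd₂
  have hmem : s₂.mem = fun a => xs.getD a 0 := m₂
  rw [v₂, r21, r22, hmem, ← hFdef, ← hQ, ← mul_assoc, ← pow_add] at l₃
  rw [v₂, ← hQ, ← mul_assoc, ← pow_add] at c₃
  rw [r21, r22, hmem, ← hFdef] at v₃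
  have bd₃ : Bounded s₃ (Q ^ (KF + KL) * B) := by
    have h0 : Q ^ KL * B ≤ Q ^ (KF + KL) * B :=
      Nat.mul_le_mul_right _ (Nat.pow_le_pow_right (by omega) (by omega))
    refine ⟨fun r hr => ?_, fun a => ?_⟩
    · change len (s₃.reg r) ≤ _
      by_cases h : r = 3
      · rw [h, v₃]; exact l₃
      · rw [f₃ r h (Or.inl hr)]; exact (bd₂.1 r hr).trans h0
    · change len (s₃.mem a) ≤ _
      rw [m₃]; exact (bd₂.2 a).trans h0
  have r30 : s₃.reg 0 = Lf n := (f₃ 0 (by norm_num) (by norm_num)).trans v₂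
  have r31 : s₃.reg 1 = n := (f₃ 1 (by norm_num) (by norm_num)).trans r21
  have r32 : s₃.reg 2 = m := (f₃ 2 (by norm_num) (by norm_num)).trans r22
  have r34 : s₃.reg 4 = 0 := (f₃ 4 (by norm_num) (by norm_num)).trans r24
  -- the number of cells
  obtain ⟨l₄, t₄, s₄, run₄, c₄, m₄, v₄, f₄⟩ := hZ s₃ _ (by rw [r30, r31, r32]; exact hV) bd₃
  rw [r30, r31, r32, ← hQ, ← mul_assoc, ← pow_add] at l₄
  rw [r30, ← hQ, ← mul_assoc, ← pow_add] at c₄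
  rw [r31, r32] at v₄
  have bd₄ : Bounded s₄ (Q ^ (KZ + (KF + KL)) * B) := by
    have h0 : Q ^ (KF + KL) * B ≤ Q ^ (KZ + (KF + KL)) * B :=
      Nat.mul_le_mul_right _ (Nat.pow_le_pow_right (by omega) (by omega))
    refine ⟨fun r hr => ?_, fun a => ?_⟩
    · change len (s₄.reg r) ≤ _
      by_cases h : r = 5
      · rw [h, v₄]; exact l₄
      · rw [f₄ r h (Or.inl hr)]; exact (bd₃.1 r hr).trans h0
    · change len (s₄.mem a) ≤ _
      rw [m₄]; exact (bd₃.2 a).trans h0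
  have r40 : s₄.reg 0 = Lf n := (f₄ 0 (by norm_num) (by norm_num)).trans r30
  have r41 : s₄.reg 1 = n := (f₄ 1 (by norm_num) (by norm_num)).trans r31
  have r42 : s₄.reg 2 = m := (f₄ 2 (by norm_num) (by norm_num)).trans r32
  have r43 : s₄.reg 3 = F := (f₄ 3 (by norm_num) (by norm_num)).trans v₃
  have r44 : s₄.reg 4 = 0 := (f₄ 4 (by norm_num) (by norm_num)).trans r34
  -- writing the cells
  set B₄ := Q ^ (Kc + (KZ + (KF + KL))) * B with hB₄
  have h34 : Q ^ (KZ + (KF + KL)) * B ≤ B₄ :=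
    Nat.mul_le_mul_right _ (Nat.pow_le_pow_right (by omega) (by omega))
  have hcl : ∀ i < Zf n m, len (cell n m F i) ≤ B₄ := by
    intro i hi
    have := hc (s₄.setReg 4 i) (Q ^ (KZ + (KF + KL)) * B) (by simpa [r40, r41, r42] using hV) (by
      refine ⟨fun r hr => ?_, fun a => bd₄.2 a⟩
      change len ((s₄.setReg 4 i).reg r) ≤ _
      rw [State.setReg_reg]
      split_ifs with h
      · refine (len_mono hi.le).trans ?_
        rw [← v₄]; exact bd₄.1 5 (by decide)
      · exact bd₄.1 r hr)
    rw [lim_state] at this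
    simp only [State.setReg_reg, r40, r41, r42, r43, if_true,
      Nat.reduceEqDiff, if_false, OfNat.zero_ne_ofNat, OfNat.one_ne_ofNat, ← hQ, ← mul_assoc,
      ← pow_add] at this
    exact this
  obtain ⟨t₅, s₅, run₅, c₅, g₅, m₅, f₅⟩ := hs s₄ B₄ (by rw [r40, r41, r42]; exact hV)
    ⟨fun r hr => (bd₄.1 r hr).trans h34, fun a => (bd₄.2 a).trans h34⟩ r44
    (by rw [v₄, r41, r42, r43]; exact hcl)
  rw [v₄, r40, ← hQ, hB₄, ← mul_assoc (Q ^ Ks), ← pow_add] at c₅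
  -- The registers from `c` on are untouched and still `0`, and the old input has been overwritten
  -- completely because it is not longer than the block of written cells. So `p` finds its own
  -- initial state.
  have e₅ : s₅ = (initState ys).shift c s₅.reg := by
    have hreg : s₅.reg = ((initState ys).shift c s₅.reg).reg := by
      funext r
      by_cases h : r < c
      · simp [State.shift, h]
      · simp only [State.shift, h, if_false, initState]
        rw [f₅ r (by omega), f₄ r (by omega) (by omega), f₃ r (by omega) (by omega),
          f₂ r (by omega) (by omega)]
        have h1 : r ≠ 1 := by omega
        have h2 : r ≠ 2 := by omega
        simp [hs₁, h1, h2]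
    have hmem : s₅.mem = ((initState ys).shift c s₅.reg).mem := by
      funext a
      simp only [State.shift_mem, initState]
      rw [m₅, hys, v₄, r41, r42, r43]
      split_ifs with h
      · rfl
      · rw [m₄, m₃, hmem]
        exact List.getD_eq_default _ _ (by omega)
    calc s₅ = ⟨s₅.reg, s₅.mem⟩ := rfl
      _ = ⟨((initState ys).shift c s₅.reg).reg, ((initState ys).shift c s₅.reg).mem⟩ := by
        rw [← hreg, ← hmem]
  have hB₄1 : 1 ≤ B₄ := Nat.mul_pos (by positivity) hB1
  -- the given program
  have run₆ := hrun.shift c s₅.reg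
  rw [← e₅] at run₆
  have len₆ := hrun.len_le (B₄ + t) (Nat.le_add_left _ _) (by
    refine ⟨fun r => ?_, fun a => ?_⟩
    · exact (show len 0 ≤ B₄ + t from hB₄1.trans (Nat.le_add_right _ _))
    · simp only [initState]
      rw [hys]
      split_ifs with h
      · exact (hcl a h).trans (Nat.le_add_right _ _)
      · exact hB₄1.trans (Nat.le_add_right _ _))
  set s₆ := s.shift c s₅.reg with hs₆
  have low₆ : ∀ r < c, s₆.reg r = s₅.reg r := fun r hr => by simp [hs₆, State.shift, hr]
  -- moving the results
  set s₇ := (s₆.setReg 4 (s.reg 0)).setReg 5 (s.reg 1) with hs₇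
  have hc4 : 0 + c ≠ 4 := by omega
  have hc5 : 1 + c ≠ 5 := by omega
  have hc45 : 1 + c ≠ 4 := by omega
  have run₇ := (Runs.const s₆ 4 0).seq ((Runs.arith _ .add 4 (0 + c) 4).seq
    ((Runs.const _ 5 0).seq (Runs.arith _ .add 5 (1 + c) 5)))
  have a0 : s₆.reg (0 + c) = s.reg 0 := State.shift_reg_add _ _ _ _
  have a1 : s₆.reg (1 + c) = s.reg 1 := State.shift_reg_add _ _ _ _
  have e₇ : ((((s₆.setReg 4 0).setReg 4 (s.reg 0)).setReg 5 0).setReg 5 (s.reg 1)) = s₇ := by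
    simp only [hs₇, State.setReg, Function.update_idem]
  simp only [State.setReg_reg, hc4, hc5, hc45, if_true, if_false, a0, a1, BinOp.eval,
    Nat.add_zero, e₇] at run₇
  have bd₇ : Bounded s₇ (B₄ + t) := by
    refine ⟨fun r hr => ?_, fun a => len₆.2 a⟩
    change len (s₇.reg r) ≤ _
    have hr' : r < 6 := hr
    simp only [hs₇, State.setReg_reg]
    split_ifs with h5 h4
    · exact len₆.1 1
    · exact len₆.1 0
    · rw [low₆ r (by omega), g₅ r (by omega)]
      exact ((bd₄.1 r hr).trans h34).trans (Nat.le_add_right _ _)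
  have r7 : s₇.reg 0 = Lf n ∧ s₇.reg 1 = n ∧ s₇.reg 2 = m ∧ s₇.reg 3 = F ∧
      s₇.reg 4 = s.reg 0 ∧ s₇.reg 5 = s.reg 1 := by
    simp only [hs₇, State.setReg_reg]
    refine ⟨?_, ?_, ?_, ?_, by simp, by simp⟩
    · simp [low₆ 0 (by omega), g₅ 0 (by omega), r40]
    · simp [low₆ 1 (by omega), g₅ 1 (by omega), r41]
    · simp [low₆ 2 (by omega), g₅ 2 (by omega), r42]
    · simp [low₆ 3 (by omega), g₅ 3 (by omega), r43]
  obtain ⟨q0, q1, q2, q3, q4, q5⟩ := r7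
  obtain ⟨-, t₈, s₈, run₈, c₈, -, v₈, -⟩ := hp s₇ _ (by rw [q0, q1, q2]; exact hV) bd₇
  rw [q1, q2, q3, q4, q5] at v₈
  rw [q0, ← hQ] at c₈
  have hx1 : ((((initState xs).setReg 1 ((initState xs).mem ((initState xs).reg 0))).setReg 2
      1).reg 2) = 1 := by simp
  have hx2 : ((((initState xs).setReg 1 ((initState xs).mem ((initState xs).reg 0))).setReg 2
      1).mem 1) = xs.getD 1 0 := rfl
  rw [hx1, hx2, e₁] at run₁
  refine ⟨_, s₈, run₁.seq (run₂.seq (run₃.seq (run₄.seq (run₅.seq (run₆.seq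
    (run₇.seq run₈)))))), ?_, v₈⟩
  have i1 : len ((initState xs).reg 0) = 1 := rfl
  have i2 : len 1 = 2 := rfl
  have i3 : len 0 = 1 := rfl
  have i4 : len ((initState xs).mem ((initState xs).reg 0)) ≤ B := hB 0
  have i5 := hB 1
  have k1 := hEle 0 (by omega)
  rw [pow_zero, one_mul] at k1
  have k2 : t₂ ≤ E := c₂.trans (hpowL.trans (hEle _ (by omega)))
  have k3 : t₃ ≤ E := c₃.trans (hEle _ (by omega))
  have k4 : t₄ ≤ E := c₄.trans (hEle _ (by omega))
  have k5 : t₅ ≤ 1 + Zf n m * E :=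
    c₅.trans (Nat.add_le_add_left (Nat.mul_le_mul_left _ (hEle _ (by omega))) _)
  have k6 : B₄ ≤ E := hEle _ (by omega)
  have k7 := len₆.1 0
  have k8 := len₆.1 1
  -- The output of `p` may have length of the order of `t`. As the cost of the last stage is linear
  -- in the length, only a factor `E` is lost; a power of `t` would ruin the exponent.
  have k9 : t₈ ≤ E + E * t := by
    refine c₈.trans ?_
    rw [mul_add]
    refine Nat.add_le_add ?_ (Nat.mul_le_mul_right _ ?_)
    · rw [hB₄, ← mul_assoc, ← pow_add]
      exact hEle _ (by omega)
    · exact (Nat.le_mul_of_pos_right _ hB1).trans (hEle _ (by omega))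
  have k10 : t ≤ E * t := Nat.le_mul_of_pos_left _ (by omega)
  rw [i1, i2, i3]
  calc _ ≤ 32 * E * (Zf n m + t + 1) := by
        have : 32 * E * (Zf n m + t + 1) = 32 * (Zf n m * E) + 32 * (E * t) + 32 * E := by ring
        omega
    _ ≤ Q ^ 5 * E * (Zf n m + t + 1) := by
        have : 32 ≤ Q ^ 5 := (by norm_num : 32 ≤ 2 ^ 5).trans (Nat.pow_le_pow_left (by omega) 5)
        gcongr
    _ = _ := by rw [hE, pow_add Q _ 5]; ring

end RAM

/-! ### Digits -/

theorem sum_digits_lt {B : ℕ} {d : ℕ → ℕ} (k : ℕ) (h : ∀ i < k, d i < B) :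
    ∑ i ∈ Finset.range k, d i * B ^ i < B ^ k := by
  induction k with
  | zero => simp
  | succ k ih =>
    rw [Finset.sum_range_succ, pow_succ]
    have h1 := ih fun i hi => h i (Nat.lt_succ_of_lt hi)
    have h2 := h k (Nat.lt_succ_self k)
    calc _ < B ^ k + d k * B ^ k := by omega
      _ = (d k + 1) * B ^ k := by ring
      _ ≤ B * B ^ k := Nat.mul_le_mul_right _ h2
      _ = _ := mul_comm _ _

theorem sum_digits_div_mod {B : ℕ} {d : ℕ → ℕ} (k : ℕ) (h : ∀ i < k, d i < B) {j : ℕ}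
    (hj : j < k) : (∑ i ∈ Finset.range k, d i * B ^ i) / B ^ j % B = d j := by
  have hB : 0 < B := (Nat.zero_le _).trans_lt (h j hj)
  induction k with
  | zero => omega
  | succ k ih =>
    rw [Finset.sum_range_succ]
    rcases Nat.lt_succ_iff_lt_or_eq.1 hj with h1 | rfl
    · obtain ⟨l, rfl⟩ : ∃ l, k = j + 1 + l := ⟨k - (j + 1), by omega⟩
      have : d (j + 1 + l) * B ^ (j + 1 + l) = (B * (d (j + 1 + l) * B ^ l)) * B ^ j := by ring
      rw [this, Nat.add_mul_div_right _ _ (by positivity), Nat.add_mul_mod_self_left]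
      exact ih (fun i hi => h i (Nat.lt_succ_of_lt hi)) h1
    · rw [Nat.add_mul_div_right _ _ (by positivity),
        Nat.div_eq_of_lt (sum_digits_lt _ fun i hi => h i (Nat.lt_succ_of_lt hi)), zero_add,
        Nat.mod_eq_of_lt (h _ hj)]

/-! ### Coefficients of products of sparse polynomials -/

open Polynomial in
-- Expansions in base `G` are unique, so each monomial of the product arises from one choice of
-- terms. In the induction the first `k` factors have degree below `G ^ k`: a digit `g` smaller than
-- `e k` would need a coefficient beyond this degree, and a larger one overshoots the exponent.
theorem coeff_prod_sum {R : Type*} [CommRing R] (G : ℕ) (f : ℕ → ℕ → R) (k : ℕ) :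
    (∀ i, G ^ k ≤ i → (∏ s ∈ Finset.range k,
      ∑ g ∈ Finset.range G, C (f s g) * X ^ (g * G ^ s)).coeff i = 0) ∧
    ∀ e : ℕ → ℕ, (∀ s < k, e s < G) → (∏ s ∈ Finset.range k,
      ∑ g ∈ Finset.range G, C (f s g) * X ^ (g * G ^ s)).coeff
        (∑ s ∈ Finset.range k, e s * G ^ s) = ∏ s ∈ Finset.range k, f s (e s) := by
  induction k with
  | zero =>
    refine ⟨fun i hi => ?_, fun e _ => by simp⟩
    have : i ≠ 0 := by simp at hi; omega
    simp [coeff_one, this]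
  | succ k ih =>
    obtain ⟨ih1, ih2⟩ := ih
    set A := ∏ s ∈ Finset.range k, ∑ g ∈ Finset.range G, C (f s g) * X ^ (g * G ^ s) with hA
    have hc : ∀ i, (∏ s ∈ Finset.range (k + 1),
        ∑ g ∈ Finset.range G, C (f s g) * X ^ (g * G ^ s)).coeff i =
        ∑ g ∈ Finset.range G, if g * G ^ k ≤ i then A.coeff (i - g * G ^ k) * f k g else 0 := by
      intro i
      rw [Finset.prod_range_succ, ← hA, Finset.mul_sum, finsetSum_coeff]
      refine Finset.sum_congr rfl fun g _ => ?_
      rw [mul_comm (C _), ← mul_assoc, coeff_mul_C, coeff_mul_X_pow']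
      split_ifs <;> simp
    refine ⟨fun i hi => ?_, fun e he => ?_⟩
    · rw [hc]
      refine Finset.sum_eq_zero fun g hg => ?_
      have hg' : g + 1 ≤ G := Finset.mem_range.1 hg
      have h1 : (g + 1) * G ^ k ≤ G ^ (k + 1) := by
        rw [pow_succ, mul_comm]; exact Nat.mul_le_mul_left _ hg'
      rw [add_mul, one_mul] at h1
      rw [ih1 _ (by omega)]; simp
    · rw [hc, Finset.sum_range_succ, Finset.prod_range_succ]
      have hlt := sum_digits_lt k fun s hs => he s (Nat.lt_succ_of_lt hs)
      have hek := he k (Nat.lt_succ_self k)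
      rw [Finset.sum_eq_single (e k)]
      · rw [if_pos (Nat.le_add_left _ _), Nat.add_sub_cancel,
          ih2 e fun s hs => he s (Nat.lt_succ_of_lt hs)]
      · intro g _ hne
        rcases lt_or_gt_of_ne hne with h | h
        · have h1 : (g + 1) * G ^ k ≤ e k * G ^ k := Nat.mul_le_mul_right _ h
          rw [add_mul, one_mul] at h1
          rw [ih1 _ (by omega)]; simp
        · have h1 : (e k + 1) * G ^ k ≤ g * G ^ k := Nat.mul_le_mul_right _ h
          rw [add_mul, one_mul] at h1
          rw [if_neg (by omega)]
      · intro h; exact absurd (Finset.mem_range.2 hek) h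

/-! ### The parameters of the reduction -/

namespace SatToDiameter

/-- Is `i ≥ 2` composite? -/
def compositeInd (i : ℕ) : ℕ := if ∏ d ∈ Finset.range (i - 2), i % (d + 2) = 0 then 1 else 0

/-- The smallest prime above `x`. -/
def nextPrime (x : ℕ) : ℕ :=
  ∑ j ∈ Finset.range (2 * x + 1),
    if ∏ i ∈ Finset.range (j + 1), (if x < i then compositeInd i else 1) = 0 then 0 else 1

theorem compositeInd_eq_zero_iff {i : ℕ} (hi : 2 ≤ i) : compositeInd i = 0 ↔ i.Prime := by
  unfold compositeInd
  rw [Nat.prime_def_lt']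
  simp only [Finset.prod_eq_zero_iff, Finset.mem_range, ite_eq_right_iff, one_ne_zero, imp_false,
    not_exists, not_and]
  refine ⟨fun h => ⟨hi, fun m h1 h2 h3 => h (m - 2) (by omega) ?_⟩, fun h d hd h' => ?_⟩
  · rw [Nat.sub_add_cancel h1]; exact Nat.mod_eq_zero_of_dvd h3
  · exact h.2 (d + 2) (by omega) (by omega) (Nat.dvd_of_mod_eq_zero h')

/-- The sum counts the `j ≤ 2 * x` for which no prime lies in `(x, j]`. These are the `j` below the
first prime `p > x`, so the count is `p`; Bertrand's postulate gives `p ≤ 2 * x`. -/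
theorem nextPrime_spec {x : ℕ} (hx : 1 ≤ x) :
    (nextPrime x).Prime ∧ x < nextPrime x ∧ nextPrime x ≤ 2 * x := by
  have hex : ∃ p, p.Prime ∧ x < p ∧ p ≤ 2 * x := Nat.exists_prime_lt_and_le_two_mul x (by omega)
  classical
  set p := Nat.find hex with hp
  have hspec := Nat.find_spec hex
  rw [← hp] at hspec
  suffices h : nextPrime x = p by rw [h]; exact hspec
  have hterm : ∀ j ∈ Finset.range (2 * x + 1),
      (if ∏ i ∈ Finset.range (j + 1), (if x < i then compositeInd i else 1) = 0 then 0 else 1) =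
      if j < p then 1 else 0 := by
    intro j hj
    have hj' := Finset.mem_range.1 hj
    by_cases h : j < p
    · rw [if_pos h, if_neg]
      rw [Finset.prod_eq_zero_iff]
      rintro ⟨i, hi, h0⟩
      have hi' := Finset.mem_range.1 hi
      split_ifs at h0 with hxi
      rw [compositeInd_eq_zero_iff (by omega)] at h0
      exact Nat.find_min hex (m := i) (by omega) ⟨h0, hxi, by omega⟩
    · rw [if_neg h, if_pos]
      refine Finset.prod_eq_zero (i := p) (Finset.mem_range.2 (by omega)) ?_
      rw [if_pos hspec.2.1, compositeInd_eq_zero_iff (by omega)]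
      exact hspec.1
  rw [nextPrime, Finset.sum_congr rfl hterm, Finset.sum_ite, Finset.sum_const_zero, add_zero,
    Finset.sum_const, smul_eq_mul, mul_one]
  have : (Finset.range (2 * x + 1)).filter (· < p) = Finset.range p := by
    ext j; simp only [Finset.mem_filter, Finset.mem_range]; omega
  rw [this, Finset.card_range]

/-- The number of variables in each half. -/
def half (n : ℕ) : ℕ := (n + 1) / 2

/-- The number of groups of literals. -/
def groups (k n : ℕ) : ℕ := ∑ j ∈ Finset.range (n + 1), if j ^ (k + 1) ≤ n then 1 else 0

/-- The number of literals in a group. -/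
def width (k n : ℕ) : ℕ := 2 * n / groups k n + 1

/-- The number of `k`-tuples of groups. -/
def tuples (k n : ℕ) : ℕ := groups k n ^ k

/-- The order of the field. -/
def order (k c n : ℕ) : ℕ := nextPrime ((6 * c + 1) * (2 * n + 2) ^ k)

/-- The number of messages. -/
def messages (k c n : ℕ) : ℕ := order k c n ^ (k * width k n)

/-- The number of columns that make the points different. -/
def tags (k c n : ℕ) : ℕ := half n + 1 + 2 * tuples k n * order k c n

/-- The number of columns. -/
def columns (k c n : ℕ) : ℕ := messages k c n + tags k c n

/-- The number of points. -/
def points (k c n : ℕ) : ℕ := 2 ^ (half n + 1) * order k c n ^ (2 * tuples k n)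

/-- The number counted is the least `g` with `n < g ^ (k + 1)`. This order of magnitude makes both
the messages, of about `n / g` field elements, and the proofs, of about `g ^ k`, sublinear in `n`.
-/
theorem groups_spec (k n : ℕ) :
    1 ≤ groups k n ∧ (groups k n - 1) ^ (k + 1) ≤ n ∧ n < groups k n ^ (k + 1) := by
  classical
  have hex : ∃ g, n < g ^ (k + 1) :=
    ⟨n + 1, (Nat.lt_succ_self n).trans_le (Nat.le_self_pow (by omega) _)⟩
  set p := Nat.find hex with hp
  have hspec := Nat.find_spec hex
  rw [← hp] at hspec
  have hple : p ≤ n + 1 := Nat.find_min' hex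
    ((Nat.lt_succ_self n).trans_le (Nat.le_self_pow (by omega) _))
  have hpos : 1 ≤ p := by
    by_contra h
    have : p = 0 := by omega
    rw [this] at hspec
    simp at hspec
  suffices h : groups k n = p by
    rw [h]
    refine ⟨hpos, ?_, hspec⟩
    have := Nat.find_min hex (m := p - 1) (by omega)
    omega
  have hterm : ∀ j ∈ Finset.range (n + 1), (if j ^ (k + 1) ≤ n then 1 else 0) =
      if j < p then 1 else 0 := by
    intro j _
    have : j ^ (k + 1) ≤ n ↔ j < p := by
      refine ⟨fun h => ?_, fun h => ?_⟩
      · by_contra h'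
        have := Nat.pow_le_pow_left (not_lt.1 h') (k + 1)
        omega
      · have := Nat.find_min hex h
        omega
    simp [this]
  rw [groups, Finset.sum_congr rfl hterm, Finset.sum_ite, Finset.sum_const_zero, add_zero,
    Finset.sum_const, smul_eq_mul, mul_one]
  have : (Finset.range (n + 1)).filter (· < p) = Finset.range p := by
    ext j; simp only [Finset.mem_filter, Finset.mem_range]; omega
  rw [this, Finset.card_range]

theorem order_spec (k c n : ℕ) : (order k c n).Prime ∧
    (6 * c + 1) * (2 * n + 2) ^ k < order k c n ∧
    order k c n ≤ 2 * ((6 * c + 1) * (2 * n + 2) ^ k) :=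
  nextPrime_spec (Nat.mul_pos (by omega) (by positivity))

theorem groups_le (k n : ℕ) : groups k n ≤ n + 1 := by
  have h := (groups_spec k n).2.1
  have := Nat.le_self_pow (n := k + 1) (by omega) (groups k n - 1)
  omega

theorem tuples_pos (k n : ℕ) : 1 ≤ tuples k n := Nat.one_le_pow _ _ (groups_spec k n).1

theorem tuples_le (k n : ℕ) : tuples k n ≤ (2 * n + 2) ^ k :=
  Nat.pow_le_pow_left ((groups_le k n).trans (by omega)) k

theorem width_le (k n : ℕ) : width k n ≤ 2 * n + 1 :=
  Nat.succ_le_succ (Nat.div_le_self _ _)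

theorem width_pos (k n : ℕ) : 0 < width k n := Nat.succ_pos _

theorem div_width_lt {k n l : ℕ} (hl : l < 2 * n) : l / width k n < groups k n := by
  have h := (groups_spec k n).1
  rw [Nat.div_lt_iff_lt_mul (width_pos k n), width]
  have := Nat.lt_mul_div_succ (2 * n) h
  omega

/-- This is the reason for the factor `6 * c + 1` in the order: the excess `6 * tuples k n` in the
squared distance becomes at most a `c`-th part of the order. -/
theorem mul_tuples_le_order (k c n : ℕ) : 6 * tuples k n * c ≤ order k c n := by
  have h1 := (order_spec k c n).2.1
  have h2 := tuples_le k n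
  nlinarith

/-! ### The points -/

/-- Is the literal `l` a literal of the half `σ` that is false under the bits `1, 2, …` of `a`? -/
def falseLit (h σ a l : ℕ) : ℕ :=
  if l / 2 < σ * h then 0
  else if l / 2 < σ * h + h then (if a / 2 ^ (l / 2 - σ * h + 1) % 2 = l % 2 then 0 else 1)
  else 0

/-- The literal at position `s` of clause `i`. -/
def lit (k n F i s : ℕ) : ℕ := F / (2 * n + 1) ^ (i * k + s) % (2 * n + 1)

/-- The encoding of the false literals at position `t` of the groups. -/
def evalLit (k n σ a s t z : ℕ) : ℕ :=
  ∑ g ∈ Finset.range (groups k n),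
    falseLit (half n) σ a (g * width k n + t) * z ^ (g * groups k n ^ s)

/-- The message of the second half. -/
def message (k c n a z : ℕ) : ℕ :=
  ∑ i ∈ Finset.range (k * width k n),
    evalLit k n 1 a (i / width k n) (i % width k n) z % order k c n * order k c n ^ i

/-- The number of false clauses, in encoded form. -/
def evalClauses (k c n m F a z j : ℕ) : ℕ :=
  ∑ i ∈ Finset.range m,
    z ^ (tuples k n - 1 -
      ∑ s ∈ Finset.range k, lit k n F i s / width k n * groups k n ^ s) *
    ∏ s ∈ Finset.range k, (evalLit k n 0 a s (lit k n F i s % width k n) z +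
      j / order k c n ^ (s * width k n + lit k n F i s % width k n) % order k c n)

/-- The value of the proof contained in `a`. -/
def evalProof (k c n a z : ℕ) : ℕ :=
  ∑ i ∈ Finset.range (2 * tuples k n - 1), if i = tuples k n - 1 then 0 else
    a / 2 ^ (half n + 1) / order k c n ^ i % order k c n * z ^ i

/-- The codes of the coordinates of the points. -/
def code (k c n m F a z j : ℕ) : ℕ :=
  if j < messages k c n then
    if a % 2 = 0 then
      if evalClauses k c n m F a z j % order k c n = evalProof k c n a z % order k c n
      then 2 else 0
    else if j = message k c n a z then 1 else 0
  else 2 * (a / 2 ^ (j - messages k c n) % 2)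

/-- The number of false clauses for the assignment given by `a` and `b`. -/
def falseClauses (k n m F a b : ℕ) : ℕ :=
  ∑ i ∈ Finset.range m, ∏ s ∈ Finset.range k,
    (falseLit (half n) 0 a (lit k n F i s) + falseLit (half n) 1 b (lit k n F i s))

theorem code_le_two (k c n m F a z j : ℕ) : code k c n m F a z j ≤ 2 := by
  unfold code
  have := Nat.mod_lt (a / 2 ^ (j - messages k c n)) (show 2 > 0 by norm_num)
  split_ifs <;> omega

/-- Each literal belongs to at most one half, so falsity is a sum of two terms, each known to one
side. -/
theorem falseLit_add_le_one (h a b l : ℕ) : falseLit h 0 a l + falseLit h 1 b l ≤ 1 := by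
  unfold falseLit
  split_ifs <;> omega

theorem falseClauses_le (k n m F a b : ℕ) : falseClauses k n m F a b ≤ m := by
  unfold falseClauses
  calc _ ≤ ∑ i ∈ Finset.range m, 1 := Finset.sum_le_sum fun i _ =>
        Finset.prod_le_one (fun _ _ => Nat.zero_le _) fun s _ => falseLit_add_le_one _ _ _ _
    _ = m := by simp

/-! ### The polynomial protocol and its soundness -/

section Polynomials

open Polynomial

variable (k c n m F a b : ℕ)

/-- The polynomial that counts the false clauses. -/
noncomputable def clausePoly : (ZMod (order k c n))[X] :=
  ∑ i ∈ Finset.range m,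
    X ^ (tuples k n - 1 - ∑ s ∈ Finset.range k, lit k n F i s / width k n * groups k n ^ s) *
    ∏ s ∈ Finset.range k, ∑ g ∈ Finset.range (groups k n),
      C (((falseLit (half n) 0 a (g * width k n + lit k n F i s % width k n) +
        falseLit (half n) 1 b (g * width k n + lit k n F i s % width k n) : ℕ) :
          ZMod (order k c n))) * X ^ (g * groups k n ^ s)

variable {k c n m F a b}

theorem sum_div_width_lt {i : ℕ} (hlit : ∀ s < k, lit k n F i s < 2 * n) :
    ∑ s ∈ Finset.range k, lit k n F i s / width k n * groups k n ^ s < tuples k n :=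
  sum_digits_lt k fun s hs => div_width_lt (hlit s hs)

/-- In the product for a clause, the tuple of groups of its literals has its own exponent `e`, with
the product of the falsities as coefficient. The power of `X` moves `e` to `tuples k n - 1`, the
same place for all clauses. -/
theorem coeff_clausePoly (hlit : ∀ i < m, ∀ s < k, lit k n F i s < 2 * n) :
    (clausePoly k c n m F a b).coeff (tuples k n - 1) = (falseClauses k n m F a b : ℕ) := by
  rw [clausePoly, finsetSum_coeff, falseClauses, Nat.cast_sum]
  refine Finset.sum_congr rfl fun i hi => ?_
  have hl := hlit i (Finset.mem_range.1 hi)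
  have h1 := sum_div_width_lt hl
  set e := ∑ s ∈ Finset.range k, lit k n F i s / width k n * groups k n ^ s with he
  have h2 : tuples k n - 1 = e + (tuples k n - 1 - e) := by omega
  conv_lhs => rw [h2, Nat.add_sub_cancel_left, coeff_X_pow_mul]
  rw [he, (coeff_prod_sum _ _ k).2 _ fun s hs => div_width_lt (hl s hs), Nat.cast_prod]
  refine Finset.prod_congr rfl fun s _ => ?_
  rw [Nat.div_add_mod']

theorem coeff_clausePoly_eq_zero {l : ℕ} (hl : 2 * tuples k n - 1 ≤ l) :
    (clausePoly k c n m F a b).coeff l = 0 := by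
  rw [clausePoly, finsetSum_coeff]
  refine Finset.sum_eq_zero fun i _ => ?_
  rw [coeff_X_pow_mul']
  split_ifs
  · have := tuples_pos k n
    exact (coeff_prod_sum _ _ k).1 _ (by unfold tuples at *; omega)
  · rfl

theorem message_div_mod {z s t : ℕ} (hs : s < k) (ht : t < width k n) :
    message k c n b z / order k c n ^ (s * width k n + t) % order k c n =
      evalLit k n 1 b s t z % order k c n := by
  have hq := (order_spec k c n).1.pos
  have hlt : s * width k n + t < k * width k n := by
    have : (s + 1) * width k n ≤ k * width k n := Nat.mul_le_mul_right _ hs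
    rw [add_mul, one_mul] at this
    omega
  rw [message, sum_digits_div_mod (k * width k n) (fun i _ => Nat.mod_lt _ hq) hlt]
  have h1 : (s * width k n + t) / width k n = s := by
    rw [mul_comm, Nat.mul_add_div (width_pos k n), Nat.div_eq_of_lt ht, add_zero]
  have h2 : (s * width k n + t) % width k n = t := by
    rw [mul_comm, Nat.mul_add_mod, Nat.mod_eq_of_lt ht]
  rw [h1, h2]

/-- Evaluation of a factor is linear in the falsities: the share of `a` is computed from `a`, and
that of `b` is a digit of the message, indexed by the position `s` in the clause and the position of
the literal in its group. -/
theorem eval_clausePoly (z : ℕ) :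
    (clausePoly k c n m F a b).eval (z : ZMod (order k c n)) =
      (evalClauses k c n m F a z (message k c n b z) : ℕ) := by
  rw [clausePoly, eval_finsetSum, evalClauses, Nat.cast_sum]
  refine Finset.sum_congr rfl fun i _ => ?_
  rw [eval_mul, eval_pow, eval_X, Nat.cast_mul, Nat.cast_pow, eval_prod, Nat.cast_prod]
  congr 1
  refine Finset.prod_congr rfl fun s hs => ?_
  rw [message_div_mod (Finset.mem_range.1 hs) (Nat.mod_lt _ (width_pos k n)), eval_finsetSum,
    Nat.cast_add, ZMod.natCast_mod, evalLit, evalLit, Nat.cast_sum, Nat.cast_sum,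
    ← Finset.sum_add_distrib]
  refine Finset.sum_congr rfl fun g _ => ?_
  simp only [eval_mul, eval_C, eval_pow, eval_X]
  push_cast
  ring

variable (k c n a) in
/-- The polynomial contained in `a`. -/
noncomputable def proofPoly : (ZMod (order k c n))[X] :=
  ∑ i ∈ Finset.range (2 * tuples k n - 1), if i = tuples k n - 1 then 0 else
    C ((a / 2 ^ (half n + 1) / order k c n ^ i : ℕ) : ZMod (order k c n)) * X ^ i

theorem eval_proofPoly (z : ℕ) :
    (proofPoly k c n a).eval (z : ZMod (order k c n)) = (evalProof k c n a z : ℕ) := by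
  rw [proofPoly, eval_finsetSum, evalProof, Nat.cast_sum]
  refine Finset.sum_congr rfl fun i _ => ?_
  split_ifs <;> simp

theorem coeff_proofPoly (l : ℕ) : (proofPoly k c n a).coeff l =
    if l < 2 * tuples k n - 1 ∧ l ≠ tuples k n - 1 then
      ((a / 2 ^ (half n + 1) / order k c n ^ l : ℕ) : ZMod (order k c n)) else 0 := by
  rw [proofPoly, finsetSum_coeff]
  have : ∀ i ∈ Finset.range (2 * tuples k n - 1), (if i = tuples k n - 1 then
      (0 : (ZMod (order k c n))[X]) else C ((a / 2 ^ (half n + 1) / order k c n ^ i : ℕ) :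
        ZMod (order k c n)) * X ^ i).coeff l = if l = i then (if i = tuples k n - 1 then 0 else
        ((a / 2 ^ (half n + 1) / order k c n ^ i : ℕ) : ZMod (order k c n))) else 0 := by
    intro i _
    split_ifs <;> simp_all [coeff_X_pow]
  rw [Finset.sum_congr rfl this, Finset.sum_ite_eq]
  simp only [Finset.mem_range]
  split_ifs <;> simp_all

/-- Soundness: whatever proof `a` contains, an accepting `z` is a root of the difference of the two
polynomials, which is nonzero and of degree at most `2 * tuples k n`. -/
theorem card_accept_le (hlit : ∀ i < m, ∀ s < k, lit k n F i s < 2 * n)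
    (hm : m < order k c n) (h : falseClauses k n m F a b ≠ 0) :
    ((Finset.range (order k c n)).filter fun z =>
      evalClauses k c n m F a z (message k c n b z) % order k c n =
        evalProof k c n a z % order k c n).card ≤ 2 * tuples k n := by
  have : Fact (order k c n).Prime := ⟨(order_spec k c n).1⟩
  set P := clausePoly k c n m F a b - proofPoly k c n a with hP
  -- The proof polynomial has no term at `tuples k n - 1`, so the difference has there the number of
  -- false clauses, which is positive and below the characteristic.
  have hP0 : P ≠ 0 := by
    intro h0
    have h1 : P.coeff (tuples k n - 1) = 0 := by rw [h0, coeff_zero]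
    rw [hP, coeff_sub, coeff_clausePoly hlit, coeff_proofPoly, if_neg (by simp), sub_zero,
      ZMod.natCast_eq_zero_iff] at h1
    have h2 := Nat.le_of_dvd (Nat.pos_of_ne_zero h) h1
    have h3 := falseClauses_le k n m F a b
    omega
  have hdeg : P.natDegree ≤ 2 * tuples k n := by
    refine natDegree_le_iff_coeff_eq_zero.2 fun l hl => ?_
    rw [hP, coeff_sub, coeff_clausePoly_eq_zero (by omega), coeff_proofPoly, if_neg (by omega),
      sub_zero]
  refine le_trans ?_ ((card_roots' P).trans hdeg)
  refine le_trans ?_ (Multiset.toFinset_card_le _)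
  refine Finset.card_le_card_of_injOn (fun z : ℕ => (z : ZMod (order k c n))) ?_ ?_
  · intro z hz
    have hz' := (Finset.mem_filter.1 hz).2
    rw [Finset.mem_coe, Multiset.mem_toFinset, mem_roots hP0, IsRoot.def, hP, eval_sub,
      eval_clausePoly, eval_proofPoly, sub_eq_zero]
    exact (ZMod.natCast_eq_natCast_iff _ _ _).2 hz'
  · intro z hz z' hz' h
    have h1 := Finset.mem_range.1 (Finset.mem_filter.1 hz).1
    have h2 := Finset.mem_range.1 (Finset.mem_filter.1 hz').1
    have := (ZMod.natCast_eq_natCast_iff' _ _ _).1 h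
    rwa [Nat.mod_eq_of_lt h1, Nat.mod_eq_of_lt h2] at this

end Polynomials

end SatToDiameter

/-! ### Assignments and completeness of the protocol -/

namespace SatToDiameter

/-- The value of variable `x` in the assignment given by `a` and `b`. -/
def assignment (h a b x : ℕ) : ℕ :=
  if x < h then a / 2 ^ (x + 1) % 2 else b / 2 ^ (x - h + 1) % 2

theorem falseLit_add {h a b l : ℕ} (hl : l / 2 < 2 * h) :
    falseLit h 0 a l + falseLit h 1 b l = if assignment h a b (l / 2) = l % 2 then 0 else 1 := by
  unfold falseLit assignment
  by_cases h1 : l / 2 < h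
  · simp [h1]
  · have h2 : l / 2 < h + h := by omega
    simp [h1, h2]

theorem falseClauses_eq_zero_iff {k n m F a b : ℕ}
    (hlit : ∀ i < m, ∀ s < k, lit k n F i s < 2 * n) :
    falseClauses k n m F a b = 0 ↔ ∀ i < m, ∃ s < k,
      assignment (half n) a b (lit k n F i s / 2) = lit k n F i s % 2 := by
  simp only [falseClauses, Finset.sum_eq_zero_iff, Finset.prod_eq_zero_iff, Finset.mem_range]
  refine forall₂_congr fun i hi => exists_congr fun s => and_congr_right fun hs => ?_
  have := hlit i hi s hs
  rw [falseLit_add (by unfold half; omega)]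
  split_ifs with h <;> simp [h]

theorem falseLit_zero_congr {h a a' : ℕ} (H : ∀ i < h, a / 2 ^ (i + 1) % 2 = a' / 2 ^ (i + 1) % 2)
    (l : ℕ) : falseLit h 0 a l = falseLit h 0 a' l := by
  unfold falseLit
  by_cases hl : l / 2 < h
  · simp [hl, H _ hl]
  · simp [hl]

theorem exists_bits (h σ : ℕ) (hσ : σ < 2) (v : ℕ → ℕ) (hv : ∀ i, v i < 2) :
    ∃ a < 2 ^ (h + 1), a % 2 = σ ∧ ∀ i < h, a / 2 ^ (i + 1) % 2 = v i := by
  have hd : ∀ i < h + 1, (if i = 0 then σ else v (i - 1)) < 2 := by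
    intro i _; split_ifs <;> simp [*]
  refine ⟨_, sum_digits_lt (h + 1) hd, ?_, fun i hi => ?_⟩
  · simpa using sum_digits_div_mod (h + 1) hd (j := 0) (by omega)
  · simpa using sum_digits_div_mod (h + 1) hd (j := i + 1) (by omega)

theorem exists_assignment (h : ℕ) (v : ℕ → ℕ) (hv : ∀ i, v i < 2) :
    ∃ a < 2 ^ (h + 1), ∃ b < 2 ^ (h + 1), a % 2 = 0 ∧ b % 2 = 1 ∧
      ∀ x < 2 * h, assignment h a b x = v x := by
  obtain ⟨a, ha, ha2, hav⟩ := exists_bits h 0 (by norm_num) v hv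
  obtain ⟨b, hb, hb2, hbv⟩ := exists_bits h 1 (by norm_num) (fun i => v (h + i)) fun i => hv _
  refine ⟨a, ha, b, hb, ha2, hb2, fun x hx => ?_⟩
  unfold assignment
  split_ifs with hxh
  · exact hav x hxh
  · rw [hbv _ (by omega)]; congr 1; omega

theorem two_pow_le_points (k c n : ℕ) : 2 ^ (half n + 1) ≤ points k c n :=
  Nat.le_mul_of_pos_right _ (pow_pos (order_spec k c n).1.pos _)

/-- The honest proof consists of the coefficients of the clause polynomial, written as digits above
the bits of `a₀`. It depends on `b` as well; that is harmless, because every possible proof occurs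
in some point. -/
theorem exists_accepted {k c n m F a₀ b : ℕ} (hlit : ∀ i < m, ∀ s < k, lit k n F i s < 2 * n)
    (ha₀ : a₀ < 2 ^ (half n + 1)) (heven : a₀ % 2 = 0) (h : falseClauses k n m F a₀ b = 0) :
    ∃ a < points k c n, a % 2 = 0 ∧ ∀ z, evalClauses k c n m F a z (message k c n b z) %
      order k c n = evalProof k c n a z % order k c n := by
  have : NeZero (order k c n) := ⟨(order_spec k c n).1.ne_zero⟩
  have hq := (order_spec k c n).1.pos
  set d := fun i => ((clausePoly k c n m F a₀ b).coeff i).val with hd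
  have hdlt : ∀ i < 2 * tuples k n - 1, d i < order k c n := fun i _ => ZMod.val_lt _
  set w := ∑ i ∈ Finset.range (2 * tuples k n - 1), d i * order k c n ^ i with hw
  have hwlt : w < order k c n ^ (2 * tuples k n) :=
    (sum_digits_lt _ hdlt).trans_le (Nat.pow_le_pow_right hq (by omega))
  set a := a₀ + 2 ^ (half n + 1) * w with ha
  have hdiv : a / 2 ^ (half n + 1) = w := by
    rw [ha, Nat.add_mul_div_left _ _ (by positivity), Nat.div_eq_of_lt ha₀, zero_add]
  have hbits : ∀ i < half n, a / 2 ^ (i + 1) % 2 = a₀ / 2 ^ (i + 1) % 2 := by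
    intro i hi
    obtain ⟨l, hl⟩ : ∃ l, half n + 1 = (i + 1) + (l + 1) := ⟨half n - i - 1, by omega⟩
    have : 2 ^ (half n + 1) * w = 2 ^ (i + 1) * (2 * (2 ^ l * w)) := by
      rw [hl, pow_add, pow_succ 2 l]; ring
    rw [ha, this, Nat.add_mul_div_left _ _ (by positivity), Nat.add_mul_mod_self_left]
  have hpoly : clausePoly k c n m F a b = clausePoly k c n m F a₀ b := by
    unfold clausePoly
    simp only [falseLit_zero_congr hbits]
  refine ⟨a, ?_, ?_, fun z => ?_⟩
  · calc a < 2 ^ (half n + 1) * (w + 1) := by rw [ha, mul_add]; omega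
      _ ≤ _ := Nat.mul_le_mul_left _ hwlt
  · rw [ha, pow_succ, mul_comm _ 2, mul_assoc, Nat.add_mul_mod_self_left, heven]
  · refine (ZMod.natCast_eq_natCast_iff _ _ _).1 ?_
    rw [← eval_clausePoly, ← eval_proofPoly]
    congr 1
    ext l
    rw [coeff_proofPoly, hdiv, hpoly]
    split_ifs with hl
    · rw [← ZMod.natCast_mod (w / _), hw, sum_digits_div_mod _ hdlt hl.1, hd]
      simp
    · by_cases hl' : l < 2 * tuples k n - 1
      -- The coefficient that the proof omits is `0`, as no clause is false.
      · have : l = tuples k n - 1 := by tauto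
        rw [this, coeff_clausePoly hlit, h, Nat.cast_zero]
      · exact coeff_clausePoly_eq_zero (by omega)

/-! ### Distances -/

theorem points_le_two_pow_tags (k c n : ℕ) : points k c n ≤ 2 ^ tags k c n := by
  have : order k c n ^ (2 * tuples k n) ≤ 2 ^ (2 * tuples k n * order k c n) := by
    rw [mul_comm _ (order k c n), pow_mul 2]
    exact Nat.pow_le_pow_left Nat.lt_two_pow_self.le _
  rw [points, tags, pow_add 2 (half n + 1)]
  exact Nat.mul_le_mul_left _ this

/-- The points constructed from a formula. -/
def instanceOf (k c n m F : ℕ) :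
    DiameterInstance (points k c n) (order k c n) (columns k c n) where
  coord a z j := Equiv.intEquivNat.symm (code k c n m F a z j)
  injective := by
    intro a b hab
    refine Fin.ext (Nat.eq_of_testBit_eq fun i => ?_)
    by_cases hi : i < tags k c n
    -- The tag columns are the same in all rows, so row `0` already separates the points.
    · have h1 := congrFun (congrFun hab ⟨0, (order_spec k c n).1.pos⟩)
        ⟨messages k c n + i, Nat.add_lt_add_left hi _⟩
      have h2 := Equiv.intEquivNat.symm.injective h1
      simp only [code, if_neg (Nat.not_lt.2 (Nat.le_add_right _ _)), Nat.add_sub_cancel_left] at h2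
      rw [Nat.testBit_eq_decide_div_mod_eq, Nat.testBit_eq_decide_div_mod_eq,
        Nat.eq_of_mul_eq_mul_left two_pos h2]
    · have hp : points k c n ≤ 2 ^ i := (points_le_two_pow_tags k c n).trans
        (Nat.pow_le_pow_right (by norm_num) (not_lt.1 hi))
      rw [Nat.testBit_lt_two_pow (a.2.trans_le hp), Nat.testBit_lt_two_pow (b.2.trans_le hp)]

theorem intEquivNat_symm_zero : Equiv.intEquivNat.symm 0 = 0 :=
  (Equiv.symm_apply_eq _).2 (by decide)

theorem intEquivNat_symm_one : Equiv.intEquivNat.symm 1 = -1 :=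
  (Equiv.symm_apply_eq _).2 (by decide)

theorem intEquivNat_symm_two : Equiv.intEquivNat.symm 2 = 1 :=
  (Equiv.symm_apply_eq _).2 (by decide)

theorem abs_coord_le {x : ℕ} (hx : x ≤ 2) : |Equiv.intEquivNat.symm x| ≤ 1 := by
  interval_cases x <;>
    simp [intEquivNat_symm_zero, intEquivNat_symm_one, intEquivNat_symm_two]

theorem dist_coord_le_two {x y : ℕ} (hx : x ≤ 2) (hy : y ≤ 2) :
    dist ((Equiv.intEquivNat.symm x : ℤ) : ℝ) ((Equiv.intEquivNat.symm y : ℤ) : ℝ) ≤ 2 := by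
  rw [Real.dist_eq]
  interval_cases x <;> interval_cases y <;>
    simp only [intEquivNat_symm_zero, intEquivNat_symm_one, intEquivNat_symm_two] <;> norm_num

theorem dist_coord_le_one {x y : ℕ} (hx : x ≤ 2) (hy : y ≤ 2) (h1 : ¬ (x = 1 ∧ y = 2))
    (h2 : ¬ (x = 2 ∧ y = 1)) :
    dist ((Equiv.intEquivNat.symm x : ℤ) : ℝ) ((Equiv.intEquivNat.symm y : ℤ) : ℝ) ≤ 1 := by
  rw [Real.dist_eq]
  interval_cases x <;> interval_cases y <;>
    first
    | exact absurd ⟨rfl, rfl⟩ h1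
    | exact absurd ⟨rfl, rfl⟩ h2
    | simp only [intEquivNat_symm_zero, intEquivNat_symm_one, intEquivNat_symm_two]; norm_num

theorem code_eq_one {k c n m F a z j : ℕ} (h : code k c n m F a z j = 1) :
    j < messages k c n ∧ a % 2 = 1 ∧ j = message k c n a z := by
  unfold code at h
  split_ifs at h <;> omega

theorem code_eq_two {k c n m F a z j : ℕ} (h : code k c n m F a z j = 2)
    (hj : j < messages k c n) : a % 2 = 0 ∧
      evalClauses k c n m F a z j % order k c n = evalProof k c n a z % order k c n := by
  unfold code at h
  split_ifs at h <;> omega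

variable {k c n m F : ℕ}

theorem dist_sq_point (a b : Fin (points k c n)) :
    dist ((instanceOf k c n m F).point a) ((instanceOf k c n m F).point b) ^ 2 =
      ∑ z : Fin (order k c n), dist (fun j : Fin (columns k c n) =>
        ((Equiv.intEquivNat.symm (code k c n m F a z j) : ℤ) : ℝ))
        (fun j => ((Equiv.intEquivNat.symm (code k c n m F b z j) : ℤ) : ℝ)) ^ 2 :=
  PiLp.dist_sq_eq_of_L2 _ _

/-- Does the first half `a` accept the second half `b` for the field element `z`? -/
def Accepts (k c n m F a b z : ℕ) : Prop :=
  evalClauses k c n m F a z (message k c n b z) % order k c n =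
    evalProof k c n a z % order k c n

instance (k c n m F a b z : ℕ) : Decidable (Accepts k c n m F a b z) := by
  unfold Accepts; infer_instance

theorem message_lt (b z : ℕ) : message k c n b z < messages k c n :=
  sum_digits_lt _ fun _ _ => Nat.mod_lt _ (order_spec k c n).1.pos

theorem columns_pos (k c n : ℕ) : 0 < columns k c n :=
  Nat.add_pos_left (pow_pos (order_spec k c n).1.pos _) _

/-- In every row, the column of the message of `b` has `1` for `a` and `-1` for `b`. -/
theorem le_dist_sq_of_accepts {a b : ℕ} (ha : a < points k c n) (hb : b < points k c n)
    (ha2 : a % 2 = 0) (hb2 : b % 2 = 1) (h : ∀ z, Accepts k c n m F a b z) :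
    4 * (order k c n : ℝ) ≤ dist ((instanceOf k c n m F).point ⟨a, ha⟩)
      ((instanceOf k c n m F).point ⟨b, hb⟩) ^ 2 := by
  rw [dist_sq_point]
  calc 4 * (order k c n : ℝ) = ∑ z : Fin (order k c n), (4 : ℝ) := by simp [mul_comm]
    _ ≤ _ := Finset.sum_le_sum fun z _ => ?_
  have hm := message_lt (k := k) (c := c) (n := n) b z
  have h1 := dist_le_pi_dist (fun j : Fin (columns k c n) =>
        ((Equiv.intEquivNat.symm (code k c n m F a z j) : ℤ) : ℝ))
        (fun j => ((Equiv.intEquivNat.symm (code k c n m F b z j) : ℤ) : ℝ))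
        ⟨message k c n b z, hm.trans_le (Nat.le_add_right _ _)⟩
  have h2 : code k c n m F a z (message k c n b z) = 2 := by
    rw [code, if_pos hm, if_pos ha2]; exact if_pos (h z)
  have h3 : code k c n m F b z (message k c n b z) = 1 := by
    rw [code, if_pos hm, if_neg (by omega), if_pos rfl]
  simp only [h2, h3, intEquivNat_symm_one, intEquivNat_symm_two, Real.dist_eq] at h1
  norm_num at h1
  nlinarith

/-- The codes `1` and `2` stand for `-1` and `1`. A row adds at most `4 = 1 + 3` to the squared
distance, and at most `1` when `-1` never meets `1` in it. -/
theorem dist_sq_le_of_forall (a b : Fin (points k c n)) (p : ℕ → Prop) [DecidablePred p]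
    (h : ∀ z, ¬ p z → ∀ j, ¬ (code k c n m F a z j = 1 ∧ code k c n m F b z j = 2) ∧
      ¬ (code k c n m F a z j = 2 ∧ code k c n m F b z j = 1)) :
    dist ((instanceOf k c n m F).point a) ((instanceOf k c n m F).point b) ^ 2 ≤
      order k c n + 3 * ((Finset.range (order k c n)).filter p).card := by
  rw [dist_sq_point]
  calc _ ≤ ∑ z : Fin (order k c n), (1 + 3 * if p z then (1 : ℝ) else 0) :=
        Finset.sum_le_sum fun z _ => ?_
    _ = _ := by
        rw [Fin.sum_univ_eq_sum_range (fun z => 1 + 3 * if p z then (1 : ℝ) else 0),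
          Finset.sum_add_distrib, ← Finset.mul_sum, Finset.sum_boole]
        simp
  split_ifs with hp
  · have : dist (fun j : Fin (columns k c n) =>
        ((Equiv.intEquivNat.symm (code k c n m F a z j) : ℤ) : ℝ))
        (fun j => ((Equiv.intEquivNat.symm (code k c n m F b z j) : ℤ) : ℝ)) ≤ 2 :=
      (dist_pi_le_iff (by norm_num)).2 fun j =>
        dist_coord_le_two (code_le_two _ _ _ _ _ _ _ _) (code_le_two _ _ _ _ _ _ _ _)
    nlinarith [dist_nonneg (x := fun j : Fin (columns k c n) =>
        ((Equiv.intEquivNat.symm (code k c n m F a z j) : ℤ) : ℝ))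
        (y := fun j => ((Equiv.intEquivNat.symm (code k c n m F b z j) : ℤ) : ℝ))]
  · have : dist (fun j : Fin (columns k c n) =>
        ((Equiv.intEquivNat.symm (code k c n m F a z j) : ℤ) : ℝ))
        (fun j => ((Equiv.intEquivNat.symm (code k c n m F b z j) : ℤ) : ℝ)) ≤ 1 :=
      (dist_pi_le_iff (by norm_num)).2 fun j =>
        dist_coord_le_one (code_le_two _ _ _ _ _ _ _ _) (code_le_two _ _ _ _ _ _ _ _)
          (h z hp j).1 (h z hp j).2
    nlinarith [dist_nonneg (x := fun j : Fin (columns k c n) =>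
        ((Equiv.intEquivNat.symm (code k c n m F a z j) : ℤ) : ℝ))
        (y := fun j => ((Equiv.intEquivNat.symm (code k c n m F b z j) : ℤ) : ℝ))]

theorem accepts_of_code {a b z j : ℕ} (ha : code k c n m F a z j = 2)
    (hb : code k c n m F b z j = 1) : a % 2 = 0 ∧ b % 2 = 1 ∧ Accepts k c n m F a b z := by
  obtain ⟨h1, h2, h3⟩ := code_eq_one hb
  obtain ⟨h4, h5⟩ := code_eq_two ha h1
  exact ⟨h4, h2, by rw [Accepts, ← h3]; exact h5⟩

theorem dist_sq_le (hlit : ∀ i < m, ∀ s < k, lit k n F i s < 2 * n) (hm : m < order k c n)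
    (a b : Fin (points k c n)) (hab : falseClauses k n m F a b ≠ 0)
    (hba : falseClauses k n m F b a ≠ 0) :
    dist ((instanceOf k c n m F).point a) ((instanceOf k c n m F).point b) ^ 2 ≤
      order k c n + 6 * tuples k n := by
  -- Only odd points have the coordinate `-1`, and only in message columns, where `1` occurs only
  -- for even points. So the parity of `a` decides which of the two can be the accepting point.
  by_cases ha : (a : ℕ) % 2 = 0
  · refine (dist_sq_le_of_forall a b (Accepts k c n m F a b) fun z hz j => ⟨?_, ?_⟩).trans ?_
    · rintro ⟨h1, h2⟩
      have := (accepts_of_code h2 h1).2.1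
      omega
    · rintro ⟨h1, h2⟩
      exact hz (accepts_of_code h1 h2).2.2
    · have : (((Finset.range (order k c n)).filter (Accepts k c n m F a b)).card : ℝ) ≤
        (2 * tuples k n : ℕ) := Nat.cast_le.2 (card_accept_le hlit hm hab)
      push_cast at this
      linarith
  · refine (dist_sq_le_of_forall a b (Accepts k c n m F b a) fun z hz j => ⟨?_, ?_⟩).trans ?_
    · rintro ⟨h1, h2⟩
      exact hz (accepts_of_code h2 h1).2.2
    · rintro ⟨h1, h2⟩
      exact ha (accepts_of_code h1 h2).1
    · have : (((Finset.range (order k c n)).filter (Accepts k c n m F b a)).card : ℝ) ≤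
        (2 * tuples k n : ℕ) := Nat.cast_le.2 (card_accept_le hlit hm hba)
      push_cast at this
      linarith

theorem dist_point_le_diam (X : DiameterInstance n m F) (a b : Fin n) :
    dist (X.point a) (X.point b) ≤ X.diam :=
  Metric.dist_le_diam_of_mem (Set.finite_range _).isBounded ⟨a, rfl⟩ ⟨b, rfl⟩

end SatToDiameter

/-! ### Bounded sums and products in the calculus -/

namespace RAM.Comp

open Ctx

variable {α : Type} [Ctx α] {S : α → Prop} {f b : α → ℕ}

/-- The context with an additional variable below `b`. -/
abbrev Below (S : α → Prop) (b : α → ℕ) (p : α × ℕ) : Prop := S p.1 ∧ p.2 < b p.1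

theorem up (hf : Comp S f) : Comp (Below S b) fun p => f p.1 :=
  hf.weaken fun _ h => h.1

theorem sumRange {F : α → ℕ → ℕ} (hb : Comp S b) (hlim : ∀ a, S a → b a ≤ lim a)
    (hF : Comp (Below S b) fun p => F p.1 p.2) :
    Comp S fun a => ∑ i ∈ Finset.range (b a), F a i :=
  sum hb hF hlim fun _ _ h h' => ⟨h, h'⟩

theorem prodRange {F : α → ℕ → ℕ} (hb : Comp S b) (hlim : ∀ a, S a → b a ≤ lim a)
    (hF : Comp (Below S b) fun p => F p.1 p.2) :
    Comp S fun a => ∏ i ∈ Finset.range (b a), F a i :=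
  prod hb hF hlim fun _ _ h h' => ⟨h, h'⟩

end RAM.Comp

namespace SatToDiameter

open RAM Ctx

/-- The bound on the number of iterations of the loops of the reduction. -/
def limit (k c n : ℕ) : ℕ := (k + 24 * c + 8) * (2 * n + 2) ^ (2 * k + 2)

/-! ### All loops and exponents stay below the loop bound -/

section Bounds

variable (k c n : ℕ)

theorem mul_pow_le_limit {x j : ℕ} (hx : x ≤ k + 24 * c + 8) (hj : j ≤ 2 * k + 2) :
    x * (2 * n + 2) ^ j ≤ limit k c n :=
  Nat.mul_le_mul hx (Nat.pow_le_pow_right (by omega) hj)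

theorem add_two_le_limit : 2 * n + 2 ≤ limit k c n := by
  simpa using mul_pow_le_limit k c n (x := 1) (j := 1) (by omega) (by omega)

theorem k_le_limit : k ≤ limit k c n := by
  simpa using mul_pow_le_limit k c n (x := k) (j := 0) (by omega) (by omega)

theorem groups_le_limit : groups k n ≤ limit k c n :=
  (groups_le k n).trans ((by omega : n + 1 ≤ 2 * n + 2).trans (add_two_le_limit k c n))

theorem half_le_limit : half n + 1 ≤ limit k c n :=
  (by unfold half; omega : half n + 1 ≤ 2 * n + 2).trans (add_two_le_limit k c n)

theorem two_mul_tuples_le_limit : 2 * tuples k n ≤ limit k c n :=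
  (Nat.mul_le_mul_left 2 (tuples_le k n)).trans
    (mul_pow_le_limit k c n (x := 2) (j := k) (by omega) (by omega))

theorem mul_width_le_limit : k * width k n ≤ limit k c n := by
  have h1 : k * width k n ≤ k * (2 * n + 2) ^ 1 :=
    Nat.mul_le_mul_left k ((width_le k n).trans (by rw [pow_one]; omega))
  exact h1.trans (mul_pow_le_limit k c n (x := k) (j := 1) (by omega) (by omega))

theorem groups_mul_width_le_limit : groups k n * width k n + 1 ≤ limit k c n := by
  have h1 : groups k n * width k n ≤ (n + 1) * (2 * n + 1) :=
    Nat.mul_le_mul (groups_le k n) (width_le k n)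
  have h2 := mul_pow_le_limit k c n (x := 1) (j := 2) (by omega) (by omega)
  nlinarith

theorem two_mul_le_limit : 2 * ((6 * c + 1) * (2 * n + 2) ^ k) + 1 ≤ limit k c n := by
  have h1 := mul_pow_le_limit k c n (x := 12 * c + 3) (j := k) (by omega) (by omega)
  have h2 : 1 ≤ (2 * n + 2) ^ k := Nat.one_le_pow _ _ (by omega)
  nlinarith

theorem tags_le_limit : tags k c n ≤ limit k c n := by
  have h1 := mul_pow_le_limit k c n (x := 24 * c + 5) (j := 2 * k + 1) (by omega) (by omega)
  have h2 := tuples_le k n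
  have h3 := (order_spec k c n).2.2
  have h4 : 2 * tuples k n * order k c n ≤
      2 * (2 * n + 2) ^ k * (2 * ((6 * c + 1) * (2 * n + 2) ^ k)) :=
    Nat.mul_le_mul (Nat.mul_le_mul_left 2 h2) h3
  have h5 : 2 * (2 * n + 2) ^ k * (2 * ((6 * c + 1) * (2 * n + 2) ^ k)) =
      (24 * c + 4) * (2 * n + 2) ^ (2 * k) := by rw [two_mul k, pow_add]; ring
  have h6 : (2 * n + 2) ^ (2 * k) ≤ (2 * n + 2) ^ (2 * k + 1) :=
    Nat.pow_le_pow_right (by omega) (by omega)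
  have h7 : 2 * n + 2 ≤ (2 * n + 2) ^ (2 * k + 1) := Nat.le_self_pow (by omega) _
  have h8 : half n + 1 ≤ 2 * n + 2 := by unfold half; omega
  have h9 : (24 * c + 4) * (2 * n + 2) ^ (2 * k) ≤ (24 * c + 4) * (2 * n + 2) ^ (2 * k + 1) :=
    Nat.mul_le_mul_left _ h6
  have h10 : (24 * c + 5) * (2 * n + 2) ^ (2 * k + 1) =
      (24 * c + 4) * (2 * n + 2) ^ (2 * k + 1) + (2 * n + 2) ^ (2 * k + 1) := by ring
  unfold tags
  omega

variable {n} {m : ℕ}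

theorem mul_le_limit (hm : m ≤ (2 * n + 2) ^ k) : m * k ≤ limit k c n := by
  rw [mul_comm]
  exact (Nat.mul_le_mul_left k hm).trans
    (mul_pow_le_limit k c n (x := k) (j := k) (by omega) (by omega))

theorem m_le_limit (hm : m ≤ (2 * n + 2) ^ k) : m ≤ limit k c n := by
  have := mul_pow_le_limit k c n (x := 1) (j := k) (by omega) (by omega)
  omega

end Bounds

/-- The codes of the input for the diameter algorithm. -/
def cell (k c n m F x : ℕ) : ℕ :=
  if x = 0 then points k c n else if x = 1 then order k c n else if x = 2 then columns k c n
  else if x - 3 < points k c n * (order k c n * columns k c n) then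
    code k c n m F ((x - 3) / (order k c n * columns k c n))
      ((x - 3) / columns k c n % order k c n) ((x - 3) % columns k c n)
  else 0

/-- The number of memory cells to be written. -/
def cells (k c n m : ℕ) : ℕ :=
  3 + points k c n * (order k c n * columns k c n) + (2 + m * k)

/-- All literals of the formula in one number. -/
def pack (k n m : ℕ) (mem : ℕ → ℕ) : ℕ :=
  ∑ i ∈ Finset.range (m * k), mem (2 + i) * (2 * n + 1) ^ i

/-- Does the pair `a, b` give a satisfying assignment? -/
def checkPair (k n m F a b : ℕ) : ℕ :=
  if falseClauses k n m F a b = 0 then 1 else if falseClauses k n m F b a = 0 then 1 else 0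

/-- Is `a / b` larger than the diameter can be for an unsatisfiable formula? -/
def checkValue (k c n a b : ℕ) : ℕ :=
  if b ^ 2 * (order k c n * (c + 1)) < a ^ 2 * c then 1 else 0

/-! ### The instance and the final tests are computable -/

section Computability

variable {α : Type} [Ctx α] {S : α → Prop} {k c : ℕ} {n m F a b z j s t i σ l x : α → ℕ}

theorem comp_compositeInd (hi : Comp S i) (h : ∀ x, S x → i x ≤ lim x) :
    Comp S fun x => compositeInd (i x) :=
  .ite_eq (.prodRange (hi.sub (.const 2)) (fun x hx => (Nat.sub_le _ _).trans (h x hx))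
    (hi.up.mod (Comp.snd.add (.const 2)))) (.const 0) (.const 1) (.const 0)

theorem comp_nextPrime (hx : Comp S x) (h : ∀ a, S a → 2 * x a + 1 ≤ lim a) :
    Comp S fun a => nextPrime (x a) :=
  .sumRange (((Comp.const 2).mul hx).add (.const 1)) h
    (.ite_eq (.prodRange (Comp.snd.add (.const 1))
      (fun p hp => by
        have := h p.1 hp.1; have := hp.2; simp only [lim_prod]; beta_reduce at *; omega)
      (.ite_lt hx.up.up .snd (comp_compositeInd .snd fun p hp => by
        have := h p.1.1 hp.1.1; have := hp.1.2; have := hp.2; simp only [lim_prod]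
        beta_reduce at *; omega)
        (.const 1))) (.const 0) (.const 0) (.const 1))

theorem comp_half (hn : Comp S n) : Comp S fun x => half (n x) :=
  (hn.add (.const 1)).div (.const 2)

theorem comp_lit (hn : Comp S n) (hF : Comp S F) (hi : Comp S i) (hs : Comp S s)
    (h : ∀ x, S x → i x * k + s x ≤ lim x) : Comp S fun x => lit k (n x) (F x) (i x) (s x) :=
  have hB := ((Comp.const 2).mul hn).add (.const 1)
  (hF.div (hB.pow ((hi.mul (.const k)).add hs) h)).mod hB

theorem comp_limit (hn : Comp S n) : Comp S fun x => limit k c (n x) :=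
  (Comp.const _).mul ((((Comp.const 2).mul hn).add (.const 2)).pow_const _)

theorem comp_falseLit {h : α → ℕ} (hh : Comp S h) (hσ : Comp S σ) (ha : Comp S a) (hl : Comp S l)
    (hlim : ∀ x, S x → l x / 2 + 1 ≤ lim x) :
    Comp S fun x => falseLit (h x) (σ x) (a x) (l x) :=
  have h2 := hl.div (.const 2)
  .ite_lt h2 (hσ.mul hh) (.const 0) (.ite_lt h2 ((hσ.mul hh).add hh)
    (.ite_eq ((ha.div ((Comp.const 2).pow ((h2.sub (hσ.mul hh)).add (.const 1))
      fun x hx => (by omega : l x / 2 - σ x * h x + 1 ≤ l x / 2 + 1).trans (hlim x hx))).mod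
        (.const 2)) (hl.mod (.const 2)) (.const 0) (.const 1)) (.const 0))

variable (hn : Comp S n) (hv : ∀ x, S x → limit k c (n x) ≤ lim x)
include hn hv

theorem comp_groups : Comp S fun x => groups k (n x) :=
  .sumRange (hn.add (.const 1))
    (fun x hx => by have := hv x hx; have := add_two_le_limit k c (n x); omega)
    (.ite_le (Comp.snd.pow_const _) hn.up (.const 1) (.const 0))

theorem comp_width : Comp S fun x => width k (n x) :=
  (((Comp.const 2).mul hn).div (comp_groups hn hv)).add (.const 1)

theorem comp_tuples : Comp S fun x => tuples k (n x) :=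
  (comp_groups hn hv).pow_const k

theorem comp_order : Comp S fun x => order k c (n x) :=
  comp_nextPrime ((Comp.const _).mul ((((Comp.const 2).mul hn).add (.const 2)).pow_const _))
    fun x hx => (two_mul_le_limit k c (n x)).trans (hv x hx)

theorem comp_messages : Comp S fun x => messages k c (n x) :=
  (comp_order hn hv).pow ((Comp.const k).mul (comp_width hn hv))
    fun x hx => (mul_width_le_limit k c (n x)).trans (hv x hx)

theorem comp_tags : Comp S fun x => tags k c (n x) :=
  ((comp_half hn).add (.const 1)).add
    (((Comp.const 2).mul (comp_tuples hn hv)).mul (comp_order hn hv))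

theorem comp_columns : Comp S fun x => columns k c (n x) :=
  (comp_messages hn hv).add (comp_tags hn hv)

theorem comp_two_pow : Comp S fun x => 2 ^ (half (n x) + 1) :=
  (Comp.const 2).pow ((comp_half hn).add (.const 1))
    fun x hx => (half_le_limit k c (n x)).trans (hv x hx)

theorem comp_points : Comp S fun x => points k c (n x) :=
  (comp_two_pow hn hv).mul ((comp_order hn hv).pow ((Comp.const 2).mul (comp_tuples hn hv))
    fun x hx => (two_mul_tuples_le_limit k c (n x)).trans (hv x hx))

/-- Powers are loops, so exponents must stay below the loop bound. The hypotheses on `s` and `t`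
ensure this for `g * G ^ s` and for the bit positions in `a`, where `G` is the number of groups and
`g < G`. -/
theorem comp_evalLit (hσ : Comp S σ) (ha : Comp S a) (hs : Comp S s) (ht : Comp S t)
    (hz : Comp S z) (hsk : ∀ x, S x → s x < k) (htw : ∀ x, S x → t x < width k (n x)) :
    Comp S fun x => evalLit k (n x) (σ x) (a x) (s x) (t x) (z x) :=
  have hG := comp_groups hn hv
  .sumRange hG (fun x hx => (groups_le_limit k c (n x)).trans (hv x hx))
    ((comp_falseLit (comp_half hn).up hσ.up ha.up
      ((Comp.snd.mul (comp_width hn hv).up).add ht.up) fun p hp => by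
        have h1 := htw p.1 hp.1
        have h2 : (p.2 + 1) * width k (n p.1) ≤ groups k (n p.1) * width k (n p.1) :=
          Nat.mul_le_mul_right _ hp.2
        have h3 := groups_mul_width_le_limit k c (n p.1)
        have h4 := hv p.1 hp.1
        rw [add_mul, one_mul] at h2
        simp only [lim_prod]
        omega).mul
    (hz.up.pow (Comp.snd.mul (hG.up.pow hs.up fun p hp => by
        have := hsk p.1 hp.1
        have h3 := k_le_limit k c (n p.1)
        have h4 := hv p.1 hp.1
        simp only [lim_prod]
        omega)) fun p hp => by
      have h1 : p.2 * groups k (n p.1) ^ s p.1 ≤ groups k (n p.1) ^ (s p.1 + 1) := by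
        rw [pow_succ, mul_comm]; exact Nat.mul_le_mul_left _ hp.2.le
      have h2 : groups k (n p.1) ^ (s p.1 + 1) ≤ tuples k (n p.1) :=
        Nat.pow_le_pow_right (groups_spec k (n p.1)).1 (hsk p.1 hp.1)
      have h3 := two_mul_tuples_le_limit k c (n p.1)
      have h4 := hv p.1 hp.1
      simp only [lim_prod]
      omega))

theorem comp_message (ha : Comp S a) (hz : Comp S z) :
    Comp S fun x => message k c (n x) (a x) (z x) :=
  have hT := comp_width hn hv
  have hq := comp_order hn hv
  .sumRange ((Comp.const k).mul hT) (fun x hx => (mul_width_le_limit k c (n x)).trans (hv x hx))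
    (((comp_evalLit (k := k) (c := c) hn.up (fun p hp => by simpa using hv p.1 hp.1) (.const 1)
      ha.up (Comp.snd.div hT.up) (Comp.snd.mod hT.up) hz.up
      (fun p hp => Nat.div_lt_of_lt_mul (by rw [mul_comm]; exact hp.2))
      fun p _ => Nat.mod_lt _ (width_pos k _)).mod hq.up).mul
    (hq.up.pow .snd fun p hp => by
      have h1 := hp.2
      have h3 := mul_width_le_limit k c (n p.1)
      have h4 := hv p.1 hp.1
      simp only [lim_prod]
      beta_reduce at *
      omega))

theorem comp_evalClauses (hm : Comp S m) (hmv : ∀ x, S x → m x ≤ (2 * n x + 2) ^ k)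
    (hF : Comp S F) (ha : Comp S a) (hz : Comp S z) (hj : Comp S j) :
    Comp S fun x => evalClauses k c (n x) (m x) (F x) (a x) (z x) (j x) := by
  have hT := comp_width hn hv
  have hq := comp_order hn hv
  have hG := comp_groups hn hv
  have hM := comp_tuples hn hv
  have hl : Comp (Comp.Below (Comp.Below S m) fun _ => k) fun p => lit k (n p.1.1) (F p.1.1) p.1.2 p.2 :=
    comp_lit hn.up.up hF.up.up Comp.snd.up .snd fun p hp => by
      have h1 : (p.1.2 + 1) * k ≤ m p.1.1 * k := Nat.mul_le_mul_right _ hp.1.2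
      rw [add_mul, one_mul] at h1
      have h2 := hp.2
      have h3 := mul_le_limit k c (hmv _ hp.1.1)
      have h4 := hv _ hp.1.1
      simp only [lim_prod]
      beta_reduce at *
      omega
  have hk : ∀ p, Comp.Below S m p → k ≤ lim p := fun p hp => by
    have h3 := k_le_limit k c (n p.1)
    have h4 := hv _ hp.1
    simp only [lim_prod]
    omega
  refine .sumRange hm (fun x hx => (m_le_limit k c (hmv x hx)).trans (hv x hx)) (.mul ?_ ?_)
  · refine hz.up.pow ((hM.up.sub (.const 1)).sub (.sumRange (.const k) hk
      ((hl.div hT.up.up).mul (hG.up.up.pow .snd fun p hp => ?_)))) fun p hp => ?_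
    · have h1 := hk p.1 hp.1
      have h2 := hp.2
      rw [lim_prod]
      beta_reduce at *
      omega
    · have h3 := two_mul_tuples_le_limit k c (n p.1)
      have h4 := hv _ hp.1
      simp only [lim_prod]
      omega
  · refine .prodRange (.const k) hk (.add ?_ ?_)
    · exact comp_evalLit (k := k) (c := c) hn.up.up (fun p hp => by simpa using hv _ hp.1.1)
        (.const 0) ha.up.up .snd (hl.mod hT.up.up) hz.up.up (fun p hp => hp.2)
        fun p _ => Nat.mod_lt _ (width_pos k _)
    · refine (hj.up.up.div (hq.up.up.pow ((Comp.snd.mul hT.up.up).add (hl.mod hT.up.up))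
        fun p hp => ?_)).mod hq.up.up
      have h1 : (p.2 + 1) * width k (n p.1.1) ≤ k * width k (n p.1.1) :=
        Nat.mul_le_mul_right _ hp.2
      rw [add_mul, one_mul] at h1
      have h2 := Nat.mod_lt (lit k (n p.1.1) (F p.1.1) p.1.2 p.2) (width_pos k (n p.1.1))
      have h3 := mul_width_le_limit k c (n p.1.1)
      have h4 := hv _ hp.1.1
      simp only [lim_prod]
      omega

theorem comp_evalProof (ha : Comp S a) (hz : Comp S z) :
    Comp S fun x => evalProof k c (n x) (a x) (z x) := by
  have hq := comp_order hn hv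
  have hM := comp_tuples hn hv
  have hb : ∀ p, Comp.Below S (fun x => 2 * tuples k (n x) - 1) p → p.2 ≤ lim p := fun p hp => by
    have h3 := two_mul_tuples_le_limit k c (n p.1)
    have h4 := hv _ hp.1
    have h5 := hp.2
    simp only [lim_prod]
    beta_reduce at *
    omega
  exact .sumRange (((Comp.const 2).mul hM).sub (.const 1))
    (fun x hx => ((Nat.sub_le _ _).trans (two_mul_tuples_le_limit k c (n x))).trans (hv x hx))
    (.ite_eq .snd (hM.up.sub (.const 1)) (.const 0)
      ((((ha.div (comp_two_pow hn hv)).up.div (hq.up.pow .snd hb)).mod hq.up).mul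
        (hz.up.pow .snd hb)))

theorem comp_code (hm : Comp S m) (hmv : ∀ x, S x → m x ≤ (2 * n x + 2) ^ k)
    (hF : Comp S F) (ha : Comp S a) (hz : Comp S z) (hj : Comp S j)
    (hjc : ∀ x, S x → j x < columns k c (n x)) :
    Comp S fun x => code k c (n x) (m x) (F x) (a x) (z x) (j x) :=
  have hq := comp_order hn hv
  have hJ := comp_messages hn hv
  .ite_lt hj hJ
    (.ite_eq (ha.mod (.const 2)) (.const 0)
      (.ite_eq ((comp_evalClauses hn hv hm hmv hF ha hz hj).mod hq)
        ((comp_evalProof hn hv ha hz).mod hq) (.const 2) (.const 0))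
      (.ite_eq hj (comp_message hn hv ha hz) (.const 1) (.const 0)))
    ((Comp.const 2).mul ((ha.div ((Comp.const 2).pow (hj.sub hJ) fun x hx => by
      have h1 := hjc x hx
      have h2 := tags_le_limit k c (n x)
      have h3 := hv x hx
      unfold columns at h1
      omega)).mod (.const 2)))

theorem comp_cell (hm : Comp S m) (hmv : ∀ x, S x → m x ≤ (2 * n x + 2) ^ k)
    (hF : Comp S F) (hx : Comp S x) : Comp S fun y => cell k c (n y) (m y) (F y) (x y) :=
  have hN := comp_points hn hv
  have hq := comp_order hn hv
  have hC := comp_columns hn hv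
  have hx3 := hx.sub (.const 3)
  .ite_eq hx (.const 0) hN (.ite_eq hx (.const 1) hq (.ite_eq hx (.const 2) hC
    (.ite_lt hx3 (hN.mul (hq.mul hC))
      (comp_code hn hv hm hmv hF (hx3.div (hq.mul hC)) ((hx3.div hC).mod hq) (hx3.mod hC)
        fun y _ => Nat.mod_lt _ (columns_pos k c (n y)))
      (.const 0))))

theorem comp_cells (hm : Comp S m) : Comp S fun y => cells k c (n y) (m y) :=
  ((Comp.const 3).add ((comp_points hn hv).mul ((comp_order hn hv).mul (comp_columns hn hv)))).add
    ((Comp.const 2).add (hm.mul (.const k)))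

theorem comp_pack (hm : Comp S m) (hmv : ∀ x, S x → m x ≤ (2 * n x + 2) ^ k) :
    Comp S fun y => pack k (n y) (m y) (Ctx.mem y) :=
  have hb := fun x hx => (mul_le_limit k c (hmv x hx)).trans (hv x hx)
  .sumRange (hm.mul (.const k)) hb
    ((Comp.load ((Comp.const 2).add .snd)).mul
      ((((Comp.const 2).mul hn.up).add (.const 1)).pow .snd fun p hp => by
        simpa using hp.2.le.trans (hb p.1 hp.1)))

theorem comp_falseClauses (hm : Comp S m) (hmv : ∀ x, S x → m x ≤ (2 * n x + 2) ^ k)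
    (hF : Comp S F) (ha : Comp S a) (hb : Comp S b) :
    Comp S fun x => falseClauses k (n x) (m x) (F x) (a x) (b x) := by
  have hh := (comp_half hn).up (b := m)
  have hl : Comp (Comp.Below (Comp.Below S m) fun _ => k) fun p => lit k (n p.1.1) (F p.1.1) p.1.2 p.2 :=
    comp_lit hn.up.up hF.up.up Comp.snd.up .snd fun p hp => by
      have h1 : (p.1.2 + 1) * k ≤ m p.1.1 * k := Nat.mul_le_mul_right _ hp.1.2
      rw [add_mul, one_mul] at h1
      have h2 := hp.2
      have h3 := mul_le_limit k c (hmv _ hp.1.1)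
      have h4 := hv _ hp.1.1
      simp only [lim_prod]
      beta_reduce at *
      omega
  have hb' : ∀ p, Comp.Below (Comp.Below S m) (fun _ => k) p →
      lit k (n p.1.1) (F p.1.1) p.1.2 p.2 / 2 + 1 ≤ lim p := fun p hp => by
    have h1 : lit k (n p.1.1) (F p.1.1) p.1.2 p.2 < 2 * n p.1.1 + 1 :=
      Nat.mod_lt _ (Nat.succ_pos _)
    have h2 := add_two_le_limit k c (n p.1.1)
    have h3 := hv _ hp.1.1
    simp only [lim_prod]
    omega
  exact .sumRange hm (fun x hx => (m_le_limit k c (hmv x hx)).trans (hv x hx))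
    (.prodRange (.const k) (fun p hp => by
      have h3 := k_le_limit k c (n p.1)
      have h4 := hv _ hp.1
      simp only [lim_prod]
      omega)
      ((comp_falseLit hh.up (.const 0) ha.up.up hl hb').add
        (comp_falseLit hh.up (.const 1) hb.up.up hl hb')))

theorem comp_checkPair (hm : Comp S m) (hmv : ∀ x, S x → m x ≤ (2 * n x + 2) ^ k)
    (hF : Comp S F) (ha : Comp S a) (hb : Comp S b) :
    Comp S fun x => checkPair k (n x) (m x) (F x) (a x) (b x) :=
  .ite_eq (comp_falseClauses hn hv hm hmv hF ha hb) (.const 0) (.const 1)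
    (.ite_eq (comp_falseClauses hn hv hm hmv hF hb ha) (.const 0) (.const 1) (.const 0))

theorem comp_checkValue (ha : Comp S a) (hb : Comp S b) :
    Comp S fun x => checkValue k c (n x) (a x) (b x) :=
  .ite_lt ((hb.pow_const 2).mul ((comp_order hn hv).mul (.const (c + 1))))
    ((ha.pow_const 2).mul (.const c)) (.const 1) (.const 0)

end Computability

end SatToDiameter

/-! ### Subexponential growth -/

/-- `f` grows more slowly than every exponential function. -/
def Subexponential (f : ℕ → ℝ) : Prop :=
  ∀ η : ℝ, 0 < η → ∃ C : ℝ, ∀ n : ℕ, f n ≤ C * 2 ^ (η * n)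

namespace Subexponential

open Filter Asymptotics

variable {f g : ℕ → ℝ}

theorem mono (hg : Subexponential g) (h : ∀ n, f n ≤ g n) : Subexponential f := fun η hη =>
  let ⟨C, hC⟩ := hg η hη
  ⟨C, fun n => (h n).trans (hC n)⟩

theorem one_le_two_rpow {η : ℝ} (hη : 0 ≤ η) (n : ℕ) : (1 : ℝ) ≤ 2 ^ (η * n) :=
  Real.one_le_rpow (by norm_num) (by positivity)

theorem const (c : ℝ) : Subexponential fun _ => c := fun η hη =>
  ⟨|c|, fun n => by nlinarith [le_abs_self c, abs_nonneg c, one_le_two_rpow hη.le n]⟩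

theorem add (hf : Subexponential f) (hg : Subexponential g) :
    Subexponential fun n => f n + g n := fun η hη =>
  let ⟨C, hC⟩ := hf η hη
  let ⟨C', hC'⟩ := hg η hη
  ⟨C + C', fun n => by rw [add_mul]; exact add_le_add (hC n) (hC' n)⟩

theorem mul (hf : Subexponential f) (hg : Subexponential g) (hf0 : ∀ n, 0 ≤ f n)
    (hg0 : ∀ n, 0 ≤ g n) : Subexponential fun n => f n * g n := fun η hη =>
  let ⟨C, hC⟩ := hf (η / 2) (by positivity)
  let ⟨C', hC'⟩ := hg (η / 2) (by positivity)
  ⟨C * C', fun n => by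
    have h : (2 : ℝ) ^ (η * n) = 2 ^ (η / 2 * n) * 2 ^ (η / 2 * n) := by
      rw [← Real.rpow_add (by norm_num)]; congr 1; ring
    calc f n * g n ≤ (C * 2 ^ (η / 2 * n)) * (C' * 2 ^ (η / 2 * n)) :=
          mul_le_mul (hC n) (hC' n) (hg0 n) ((hf0 n).trans (hC n))
      _ = _ := by rw [h]; ring⟩

theorem pow (hf : Subexponential f) (hf0 : ∀ n, 0 ≤ f n) (k : ℕ) :
    Subexponential fun n => f n ^ k := by
  induction k with
  | zero => simpa using const 1
  | succ k ih =>
    simp only [pow_succ]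
    exact ih.mul hf (fun n => pow_nonneg (hf0 n) k) hf0

theorem natCast : Subexponential fun n => (n : ℝ) := fun η hη =>
  ⟨1 / (η * Real.log 2), fun n => by
    have hl : 0 < Real.log 2 := Real.log_pos (by norm_num)
    rw [Real.rpow_def_of_pos (by norm_num), div_mul_eq_mul_div, le_div_iff₀ (by positivity),
      one_mul]
    have := Real.add_one_le_exp (Real.log 2 * (η * n))
    nlinarith⟩

theorem of_eventually (hf0 : ∀ n, 0 ≤ f n)
    (h : ∀ η : ℝ, 0 < η → ∃ C : ℝ, ∀ᶠ n : ℕ in atTop, f n ≤ C * 2 ^ (η * n)) :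
    Subexponential f := by
  intro η hη
  obtain ⟨C, hC⟩ := h η hη
  obtain ⟨N, hN⟩ := eventually_atTop.1 hC
  refine ⟨|C| + ∑ i ∈ Finset.range N, f i, fun n => ?_⟩
  have h1 := one_le_two_rpow hη.le n
  have h2 : 0 ≤ ∑ i ∈ Finset.range N, f i := Finset.sum_nonneg fun i _ => hf0 i
  rcases lt_or_ge n N with hn | hn
  · have := Finset.single_le_sum (f := f) (fun i _ => hf0 i) (Finset.mem_range.2 hn)
    nlinarith [abs_nonneg C]
  · have := hN n hn
    nlinarith [le_abs_self C]

theorem two_rpow (h : g =o[atTop] fun n : ℕ => (n : ℝ) + 1) :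
    Subexponential fun n => 2 ^ g n := by
  -- The comparison function is `n + 1`; the constant `2 ^ η` absorbs the extra `1`.
  refine of_eventually (fun n => by positivity) fun η hη => ⟨2 ^ η, ?_⟩
  filter_upwards [h.bound hη] with n hn
  rw [← Real.rpow_add (by norm_num)]
  refine Real.rpow_le_rpow_of_exponent_le (by norm_num) ?_
  have h1 := le_abs_self (g n)
  rw [Real.norm_eq_abs, Real.norm_eq_abs, abs_of_nonneg (by positivity : (0 : ℝ) ≤ n + 1)] at hn
  linarith

end Subexponential

/-! ### Size of the constructed instances -/

namespace SatToDiameter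

open Filter Asymptotics

variable (k c : ℕ)

theorem tendsto_groups : Tendsto (fun n => (groups k n : ℝ)) atTop atTop := by
  refine tendsto_natCast_atTop_atTop.comp (tendsto_atTop.2 fun b => ?_)
  filter_upwards [eventually_ge_atTop (b ^ (k + 1))] with n hn
  by_contra h
  have h1 := (groups_spec k n).2.2
  have h2 := Nat.pow_le_pow_left (not_le.1 h).le (k + 1)
  omega

/-- Since `n` is below the power `k + 1` of the number `G` of groups, the order is bounded by a
fixed power of `G` up to a constant, and its logarithm is `O(1) + O(log G)`. -/
theorem isLittleO_log_order :
    (fun n => Real.logb 2 (order k c n)) =o[atTop] fun n => (groups k n : ℝ) := by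
  have hG := tendsto_groups k
  have h1 : (fun n => Real.log (groups k n)) =o[atTop] fun n => (groups k n : ℝ) :=
    Real.isLittleO_log_id_atTop.comp_tendsto hG
  have h2 : (fun _ : ℕ => Real.log (2 * (6 * c + 1) * 2 ^ k)) =o[atTop]
      fun n => (groups k n : ℝ) :=
    isLittleO_const_left.2 (Or.inr (tendsto_norm_atTop_atTop.comp hG))
  have h3 := (h2.add (h1.const_mul_left ((k + 1) * k))).const_mul_left (Real.log 2)⁻¹
  refine IsBigO.trans_isLittleO (IsBigO.of_bound 1 (Eventually.of_forall fun n => ?_)) h3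
  have hq := order_spec k c n
  have hq1 : (1 : ℝ) ≤ order k c n := by exact_mod_cast hq.1.one_lt.le
  have hg1 : (1 : ℝ) ≤ groups k n := by exact_mod_cast (groups_spec k n).1
  have hl : 0 < Real.log 2 := Real.log_pos (by norm_num)
  have hle : (order k c n : ℝ) ≤ 2 * (6 * c + 1) * 2 ^ k * (groups k n : ℝ) ^ ((k + 1) * k) := by
    have h4 : 2 * n + 2 ≤ 2 * groups k n ^ (k + 1) := by have := (groups_spec k n).2.2; omega
    have h5 : order k c n ≤ 2 * ((6 * c + 1) * (2 * groups k n ^ (k + 1)) ^ k) :=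
      hq.2.2.trans (Nat.mul_le_mul_left 2 (Nat.mul_le_mul_left _ (Nat.pow_le_pow_left h4 k)))
    calc (order k c n : ℝ) ≤ (2 * ((6 * c + 1) * (2 * groups k n ^ (k + 1)) ^ k) : ℕ) := by
          exact_mod_cast h5
      _ = _ := by push_cast; rw [mul_pow, ← pow_mul]; ring
  have hlog : Real.log (order k c n) ≤ Real.log (2 * (6 * c + 1) * 2 ^ k) +
      (k + 1) * k * Real.log (groups k n) := by
    refine (Real.log_le_log (by linarith) hle).trans_eq ?_
    rw [Real.log_mul (by positivity) (by positivity), Real.log_pow]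
    push_cast; ring
  have hlog0 : 0 ≤ Real.log (order k c n) := Real.log_nonneg hq1
  rw [one_mul, Real.norm_eq_abs, Real.norm_eq_abs, Real.logb, div_eq_inv_mul, abs_mul, abs_mul,
    abs_of_nonneg hlog0, abs_of_nonneg (hlog0.trans hlog)]
  exact mul_le_mul_of_nonneg_left hlog (abs_nonneg _)

theorem isBigO_width :
    (fun n => (width k n : ℝ)) =O[atTop] fun n : ℕ => ((n : ℝ) + 1) / groups k n := by
  refine IsBigO.of_bound 3 (Eventually.of_forall fun n => ?_)
  have hg1 : (1 : ℝ) ≤ groups k n := by exact_mod_cast (groups_spec k n).1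
  have hg2 : (groups k n : ℝ) ≤ n + 1 := by exact_mod_cast groups_le k n
  rw [Real.norm_of_nonneg (by positivity), Real.norm_of_nonneg (by positivity), width]
  push_cast
  have h1 : ((2 * n / groups k n : ℕ) : ℝ) ≤ 2 * n / groups k n := by
    simpa using Nat.cast_div_le (α := ℝ) (m := 2 * n) (n := groups k n)
  have h2 : 1 ≤ ((n : ℝ) + 1) / groups k n := (one_le_div (by linarith)).2 hg2
  have h3 : (2 * n : ℝ) / groups k n ≤ 2 * (((n : ℝ) + 1) / groups k n) := by
    rw [mul_div_assoc]
    gcongr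
    linarith
  linarith

theorem isBigO_groups_pow :
    (fun n => (groups k n : ℝ) ^ (k + 1)) =O[atTop] fun n : ℕ => (n : ℝ) + 1 := by
  refine IsBigO.of_bound (2 ^ (k + 1)) (Eventually.of_forall fun n => ?_)
  rw [Real.norm_of_nonneg (by positivity), Real.norm_of_nonneg (by positivity)]
  obtain ⟨h1, h2, -⟩ := groups_spec k n
  have h3 : groups k n ^ (k + 1) ≤ 2 ^ (k + 1) * (n + 1) := by
    rcases h1.lt_or_eq with h | h
    · calc groups k n ^ (k + 1) ≤ (2 * (groups k n - 1)) ^ (k + 1) :=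
            Nat.pow_le_pow_left (by omega) _
        _ = 2 ^ (k + 1) * (groups k n - 1) ^ (k + 1) := mul_pow _ _ _
        _ ≤ _ := Nat.mul_le_mul_left _ (h2.trans (Nat.le_succ n))
    · rw [← h, one_pow]; exact Nat.mul_pos (by positivity) (Nat.succ_pos _)
  exact_mod_cast h3

theorem order_pow_eq (n e : ℕ) :
    ((order k c n ^ e : ℕ) : ℝ) = 2 ^ (e * Real.logb 2 (order k c n)) := by
  have hq : (0 : ℝ) < order k c n := by exact_mod_cast (order_spec k c n).1.pos
  rw [mul_comm, Real.rpow_mul (by norm_num), Real.rpow_logb (by norm_num) (by norm_num) hq,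
    Real.rpow_natCast, Nat.cast_pow]

/-- The exponent of `2` is `O(n / G) * o(G) = o(n)`, where `G` is the number of groups. -/
theorem subexponential_messages : Subexponential fun n => (messages k c n : ℝ) := by
  simp only [messages, order_pow_eq]
  refine Subexponential.two_rpow ?_
  have h := ((isBigO_width k).const_mul_left k).mul_isLittleO (isLittleO_log_order k c)
  refine (h.congr_left fun n => by push_cast; ring).trans_isBigO
    (IsBigO.of_bound 1 (Eventually.of_forall fun n => ?_))
  have hg1 : (groups k n : ℝ) ≠ 0 := by
    have := (groups_spec k n).1
    positivity
  rw [div_mul_cancel₀ _ hg1, one_mul]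

/-- The exponent of `2` is `2 * G ^ k * o(G) = o(G ^ (k + 1)) = o(n)`. Together with the messages,
this forces the choice of the number `G` of groups. -/
theorem subexponential_proofs :
    Subexponential fun n => ((order k c n ^ (2 * tuples k n) : ℕ) : ℝ) := by
  simp only [order_pow_eq]
  refine Subexponential.two_rpow ?_
  have h := ((isBigO_refl (fun n => (groups k n : ℝ) ^ k) atTop).const_mul_left 2).mul_isLittleO
    (isLittleO_log_order k c)
  refine (h.congr_left fun n => by simp [tuples]).trans_isBigO ?_
  simpa only [← pow_succ] using isBigO_groups_pow k

theorem subexponential_limit : Subexponential fun n => (limit k c n : ℝ) := by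
  have h := (((Subexponential.const 2).mul .natCast (fun _ => by norm_num)
    fun _ => by positivity).add (.const 2)).pow (fun _ => by positivity) (2 * k + 2)
  refine ((Subexponential.const (k + 24 * c + 8)).mul h (fun _ => by positivity)
    fun _ => by positivity).mono fun n => ?_
  simp [limit]

theorem subexponential_limit_pow (K : ℕ) :
    Subexponential fun n => ((limit k c n : ℝ) + 2) ^ K :=
  ((subexponential_limit k c).add (.const 2)).pow (fun _ => by positivity) K

theorem subexponential_dimension :
    Subexponential fun n => ((order k c n * columns k c n : ℕ) : ℝ) := by
  have h1 : Subexponential fun n => (order k c n : ℝ) :=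
    (subexponential_limit k c).mono fun n => by
      have h1 := (order_spec k c n).2.2
      have h2 := two_mul_le_limit k c n
      exact_mod_cast (by omega : order k c n ≤ limit k c n)
  have h2 : Subexponential fun n => (tags k c n : ℝ) :=
    (subexponential_limit k c).mono fun n => by exact_mod_cast tags_le_limit k c n
  refine (h1.mul ((subexponential_messages k c).add h2) (fun _ => by positivity)
    fun _ => by positivity).mono fun n => ?_
  simp [columns]

theorem exists_points_le (η : ℝ) (hη : 0 < η) :
    ∃ C : ℝ, ∀ n, (points k c n : ℝ) ≤ C * 2 ^ ((1 / 2 + η) * n) := by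
  obtain ⟨C, hC⟩ := subexponential_proofs k c η hη
  refine ⟨4 * C, fun n => ?_⟩
  have h1 : ((2 ^ (half n + 1) : ℕ) : ℝ) ≤ 4 * 2 ^ (1 / 2 * (n : ℝ)) := by
    have h2 : ((half n : ℕ) : ℝ) ≤ n / 2 + 1 := by
      have : 2 * half n ≤ n + 2 := by unfold half; omega
      have : (2 * half n : ℝ) ≤ n + 2 := by exact_mod_cast this
      linarith
    have h4 : (4 : ℝ) = 2 ^ (2 : ℝ) := by norm_num
    rw [h4, ← Real.rpow_add (by norm_num), Nat.cast_pow, ← Real.rpow_natCast]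
    push_cast
    exact Real.rpow_le_rpow_of_exponent_le (by norm_num) (by linarith)
  calc (points k c n : ℝ) = ((2 ^ (half n + 1) : ℕ) : ℝ) *
        ((order k c n ^ (2 * tuples k n) : ℕ) : ℝ) := by rw [← Nat.cast_mul]; rfl
    _ ≤ (4 * 2 ^ (1 / 2 * (n : ℝ))) * (C * 2 ^ (η * n)) :=
      mul_le_mul h1 (hC n) (by positivity) (by positivity)
    _ = 4 * C * (2 ^ (1 / 2 * (n : ℝ)) * 2 ^ (η * n)) := by ring
    _ = _ := by rw [← Real.rpow_add (by norm_num), add_mul]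

theorem exists_cost_le (K : ℕ) (ε C : ℝ) (hε : 0 < ε) (hε1 : ε ≤ 1) :
    ∃ C' : ℝ, ∀ n t : ℕ, (t : ℝ) ≤ C * (points k c n : ℝ) ^ (2 - ε) →
      ((limit k c n : ℝ) + 2) ^ K * (points k c n * (order k c n * columns k c n : ℕ) +
        (limit k c n + 6) + t) ≤ C' * 2 ^ ((1 - ε / 4) * n) := by
  -- Writing the cells has the exponent `1 / 2 + 2 * η`, the run of the given program `(1 / 2 + η) *
  -- (2 - ε) ≤ 1 - ε / 2 + 2 * η`, and the overhead of the reduction adds `η`. The total `1 - ε / 2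
  -- + 3 * η` is at most `1 - ε / 4`.
  set η := ε / 16 with hη
  have hη0 : 0 < η := by positivity
  obtain ⟨C₁, h1⟩ := subexponential_limit_pow k c K η hη0
  obtain ⟨C₂, h2⟩ := exists_points_le k c η hη0
  obtain ⟨C₃, h3⟩ := subexponential_dimension k c η hη0
  obtain ⟨C₄, h4⟩ := ((subexponential_limit k c).add (.const 6)) η hη0
  refine ⟨|C₁| * (|C₂| * |C₃| + |C₄| + |C| * |C₂| ^ (2 - ε)), fun n t ht => ?_⟩
  set E : ℝ := 2 ^ ((1 - ε / 2 + 2 * η) * n) with hE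
  have hn : (0 : ℝ) ≤ n := Nat.cast_nonneg n
  have abs_le : ∀ {x y : ℝ} (z : ℝ), x ≤ y * 2 ^ z → x ≤ |y| * 2 ^ z := fun z h =>
    h.trans (mul_le_mul_of_nonneg_right (le_abs_self _) (by positivity))
  have hexp : ∀ {x : ℝ}, x ≤ 1 - ε / 2 + 2 * η → (2 : ℝ) ^ (x * n) ≤ E := fun h =>
    Real.rpow_le_rpow_of_exponent_le (by norm_num) (mul_le_mul_of_nonneg_right h hn)
  have e1 : points k c n * ((order k c n * columns k c n : ℕ) : ℝ) ≤ |C₂| * |C₃| * E := by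
    calc _ ≤ (|C₂| * 2 ^ ((1 / 2 + η) * n)) * (|C₃| * 2 ^ (η * n)) :=
          mul_le_mul (abs_le _ (h2 n)) (abs_le _ (h3 n)) (by positivity) (by positivity)
      _ = |C₂| * |C₃| * 2 ^ ((1 / 2 + η + η) * n) := by
          have : (2 : ℝ) ^ ((1 / 2 + η + η) * n) = 2 ^ ((1 / 2 + η) * n) * 2 ^ (η * n) := by
            rw [← Real.rpow_add (by norm_num), ← add_mul]
          rw [this]; ring
      _ ≤ _ := mul_le_mul_of_nonneg_left (hexp (by linarith)) (by positivity)
  have e2 : (limit k c n : ℝ) + 6 ≤ |C₄| * E :=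
    (abs_le _ (h4 n)).trans (mul_le_mul_of_nonneg_left (hexp (by linarith)) (abs_nonneg _))
  have e3 : (t : ℝ) ≤ |C| * |C₂| ^ (2 - ε) * E := by
    calc (t : ℝ) ≤ |C| * (points k c n : ℝ) ^ (2 - ε) :=
          ht.trans (mul_le_mul_of_nonneg_right (le_abs_self _) (by positivity))
      _ ≤ |C| * (|C₂| * 2 ^ ((1 / 2 + η) * n)) ^ (2 - ε) := by
          refine mul_le_mul_of_nonneg_left ?_ (abs_nonneg _)
          exact Real.rpow_le_rpow (by positivity) (abs_le _ (h2 n)) (by linarith)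
      _ = |C| * |C₂| ^ (2 - ε) * 2 ^ ((1 / 2 + η) * (2 - ε) * n) := by
          rw [Real.mul_rpow (abs_nonneg _) (by positivity), ← Real.rpow_mul (by norm_num),
            mul_right_comm _ (n : ℝ), mul_assoc]
          ring
      _ ≤ _ := mul_le_mul_of_nonneg_left (hexp (by nlinarith)) (by positivity)
  calc _ ≤ (|C₁| * 2 ^ (η * n)) * (|C₂| * |C₃| * E + |C₄| * E + |C| * |C₂| ^ (2 - ε) * E) :=
        mul_le_mul (abs_le _ (h1 n)) (by linarith) (by positivity) (by positivity)
    _ = |C₁| * (|C₂| * |C₃| + |C₄| + |C| * |C₂| ^ (2 - ε)) * (2 ^ (η * n) * E) := by ring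
    _ ≤ _ := by
        refine mul_le_mul_of_nonneg_left ?_ (by positivity)
        rw [hE, ← Real.rpow_add (by norm_num), ← add_mul]
        exact Real.rpow_le_rpow_of_exponent_le (by norm_num)
          (mul_le_mul_of_nonneg_right (by linarith) hn)

/-! ### The dimension as a function of the number of points -/

/-- The largest dimension of the constructed point sets of size at most `N`. -/
def maxDimension (N : ℕ) : ℕ :=
  (Finset.range (2 * Nat.log 2 N + 1)).sup fun n => order k c n * columns k c n

/-- There are at least `2 ^ (half n + 1)` points, so `n` lies in the range of the supremum. -/
theorem dimension_le_maxDimension (n : ℕ) :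
    order k c n * columns k c n ≤ maxDimension k c (points k c n) := by
  refine Finset.le_sup (f := fun n => order k c n * columns k c n) (Finset.mem_range.2 ?_)
  have h1 := two_pow_le_points k c n
  have h2 : half n + 1 ≤ Nat.log 2 (points k c n) :=
    Nat.le_log_of_pow_le (by norm_num) h1
  unfold half at h2
  omega

/-- The supremum is attained at some `n ≤ 2 * log₂ N`, where a subexponential bound in `n` becomes a
small power of `N`; another small power absorbs the constant. -/
theorem subpolynomial_maxDimension : Subpolynomial (maxDimension k c) := by
  intro η hη
  obtain ⟨C, hC⟩ := subexponential_dimension k c (η / 4) (by positivity)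
  have hlim : Tendsto (fun N : ℕ => (N : ℝ) ^ (η / 2)) atTop atTop :=
    (tendsto_rpow_atTop (by positivity)).comp tendsto_natCast_atTop_atTop
  filter_upwards [hlim.eventually_ge_atTop |C|, eventually_ge_atTop 1] with N hN hN1
  have hNpos : (0 : ℝ) < N := by exact_mod_cast hN1
  obtain ⟨n, hn, hmax⟩ := Finset.exists_mem_eq_sup (Finset.range (2 * Nat.log 2 N + 1))
    ⟨0, by simp⟩ fun n => order k c n * columns k c n
  have hn' : n ≤ 2 * Nat.log 2 N := Nat.lt_succ_iff.1 (Finset.mem_range.1 hn)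
  have hpow : (2 : ℝ) ^ (η / 4 * n) ≤ (N : ℝ) ^ (η / 2) := by
    have h1 : (2 : ℝ) ^ (Nat.log 2 N) ≤ N := by
      exact_mod_cast Nat.pow_log_le_self 2 (by omega)
    calc (2 : ℝ) ^ (η / 4 * n) ≤ 2 ^ ((Nat.log 2 N : ℝ) * (η / 2)) := by
          refine Real.rpow_le_rpow_of_exponent_le (by norm_num) ?_
          have : (n : ℝ) ≤ 2 * Nat.log 2 N := by exact_mod_cast hn'
          nlinarith
      _ = ((2 : ℝ) ^ (Nat.log 2 N)) ^ (η / 2) := by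
          rw [Real.rpow_mul (by norm_num), Real.rpow_natCast]
      _ ≤ _ := Real.rpow_le_rpow (by positivity) h1 (by positivity)
  rw [maxDimension, hmax]
  calc _ ≤ C * 2 ^ (η / 4 * n) := hC n
    _ ≤ |C| * 2 ^ (η / 4 * n) := mul_le_mul_of_nonneg_right (le_abs_self _) (by positivity)
    _ ≤ (N : ℝ) ^ (η / 2) * (N : ℝ) ^ (η / 2) :=
      mul_le_mul hN hpow (by positivity) (by positivity)
    _ = _ := by rw [← Real.rpow_add hNpos]; congr 1; ring

end SatToDiameter

namespace SatToDiameter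

open RAM

/-! ### Encodings -/

theorem getD_flatMap {α : Type*} (f : α → List ℕ) (w : ℕ) (l : List α)
    (hw : ∀ x ∈ l, (f x).length = w) (i j : ℕ) (hj : j < w) :
    (l.flatMap f).getD (i * w + j) 0 =
      if h : i < l.length then (f l[i]).getD j 0 else 0 := by
  induction l generalizing i with
  | nil => simp
  | cons x l ih =>
    rw [List.flatMap_cons]
    have hx : (f x).length = w := hw x (by simp)
    cases i with
    | zero =>
      rw [Nat.zero_mul, Nat.zero_add, List.getD_append _ _ _ _ (by omega), dif_pos (by simp)]
      rfl
    | succ i =>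
      rw [List.getD_append_right _ _ _ _ (by rw [hx, Nat.succ_mul]; omega), hx,
        show (i + 1) * w + j - w = i * w + j by rw [Nat.succ_mul]; omega,
        ih (fun y hy => hw y (List.mem_cons_of_mem _ hy))]
      simp

theorem length_flatMap_const {α : Type*} (f : α → List ℕ) (w : ℕ) (l : List α)
    (hw : ∀ x ∈ l, (f x).length = w) : (l.flatMap f).length = l.length * w := by
  induction l with
  | nil => simp
  | cons x l ih =>
    rw [List.flatMap_cons, List.length_append, hw x (by simp),
      ih fun y hy => hw y (List.mem_cons_of_mem _ hy), List.length_cons, Nat.succ_mul, add_comm]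

/-- After the header of three numbers, the point, the row and the column of a cell are the digits of
its position in the mixed radix given by the numbers of rows and columns. -/
theorem getD_encode_instanceOf (k c n m F x : ℕ) :
    (instanceOf k c n m F).encode.getD x 0 = cell k c n m F x := by
  unfold DiameterInstance.encode cell
  rcases x with _ | _ | _ | y
  · rfl
  · rfl
  · rfl
  rw [List.getD_cons_succ, List.getD_cons_succ, List.getD_cons_succ]
  simp only [Nat.add_eq_zero_iff, OfNat.ofNat_ne_zero, and_false, if_false, Nat.add_sub_cancel,
    show y + 1 + 1 + 1 = y + 3 from rfl,
    show y + 3 ≠ 1 by omega, show y + 3 ≠ 2 by omega]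
  set Q := order k c n
  set W := columns k c n with hW
  have hQ : 0 < Q := (order_spec k c n).1.pos
  have hWpos : 0 < W := columns_pos k c n
  have hlen : ∀ a ∈ List.finRange (points k c n), ((List.finRange Q).flatMap fun i =>
      List.ofFn fun j => Equiv.intEquivNat ((instanceOf k c n m F).coord a i j)).length =
      Q * W := fun a _ => by
    rw [length_flatMap_const _ W _ fun i _ => List.length_ofFn, List.length_finRange]
  have h1 := getD_flatMap _ (Q * W) (List.finRange (points k c n)) hlen (y / (Q * W))
    (y % (Q * W)) (Nat.mod_lt _ (Nat.mul_pos hQ hWpos))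
  rw [Nat.div_add_mod'] at h1
  rw [h1]
  simp only [List.length_finRange, Nat.div_lt_iff_lt_mul (Nat.mul_pos hQ hWpos)]
  split_ifs with h
  · have hi : y / W % Q < Q := Nat.mod_lt _ hQ
    have hj : y % W < W := Nat.mod_lt _ hWpos
    have hr : y % (Q * W) = y / W % Q * W + y % W := by
      rw [← Nat.mod_mul_left_div_self, ← Nat.mod_mul_left_mod y Q W, Nat.div_add_mod']
    rw [hr, getD_flatMap _ W _ (fun i _ => List.length_ofFn) _ _ hj]
    rw [dif_pos (by simpa using hi), List.getD_eq_getElem _ _ (by simpa using hj)]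
    simp [instanceOf, Q, W]
  · rfl

theorem cell_eq_zero {k c n m F x : ℕ} (h : cells k c n m ≤ x) : cell k c n m F x = 0 := by
  unfold cells at h
  unfold cell
  rw [if_neg (by omega), if_neg (by omega), if_neg (by omega), if_neg (by omega)]

variable {k n : ℕ} (φ : KCNF k n)

theorem length_encode : φ.encode.length = 2 + φ.clauses.length * k := by
  rw [KCNF.encode, List.length_cons, List.length_cons,
    length_flatMap_const _ k _ fun c _ => List.length_ofFn]
  omega

/-- Here the exclusion of repeated clauses is needed: it keeps the number of clauses polynomial in
`n`, so that the order of the field can exceed it. -/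
theorem length_clauses_le : φ.clauses.length ≤ (2 * n + 2) ^ k := by
  refine φ.nodup.length_le_card.trans ?_
  simp only [Fintype.card_pi, Fintype.card_prod, Fintype.card_fin, Fintype.card_bool,
    Finset.prod_const, Finset.card_univ]
  exact Nat.pow_le_pow_left (by omega) k

theorem getD_encode_two_add {i s : ℕ} (hi : i < φ.clauses.length) (hs : s < k) :
    φ.encode.getD (2 + (i * k + s)) 0 =
      2 * ((φ.clauses[i] ⟨s, hs⟩).1 : ℕ) + (φ.clauses[i] ⟨s, hs⟩).2.toNat := by
  rw [KCNF.encode, show 2 + (i * k + s) = i * k + s + 1 + 1 by ring, List.getD_cons_succ,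
    List.getD_cons_succ, getD_flatMap _ k _ (fun c _ => List.length_ofFn) _ _ hs, dif_pos hi,
    List.getD_eq_getElem _ _ (by simpa using hs)]
  simp

theorem getD_encode_lt (x : ℕ) (hx : 2 ≤ x) : φ.encode.getD x 0 < 2 * n + 1 := by
  by_cases h : x < φ.encode.length
  · have hk : 0 < k := by
      rcases Nat.eq_zero_or_pos k with rfl | hk
      · rw [length_encode] at h; omega
      · exact hk
    rw [length_encode] at h
    have hi : (x - 2) / k < φ.clauses.length := (Nat.div_lt_iff_lt_mul hk).2 (by omega)
    have hs := Nat.mod_lt (x - 2) hk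
    have hx' : x = 2 + ((x - 2) / k * k + (x - 2) % k) := by rw [Nat.div_add_mod']; omega
    rw [hx', getD_encode_two_add φ hi hs]
    have h1 := (φ.clauses[(x - 2) / k] ⟨_, hs⟩).1.2
    have h2 := Bool.toNat_le (φ.clauses[(x - 2) / k] ⟨_, hs⟩).2
    omega
  · rw [List.getD_eq_default _ _ (not_lt.1 h)]; omega

theorem getD_encode_le (c x : ℕ) : φ.encode.getD x 0 ≤ limit k c n := by
  have h := add_two_le_limit k c n
  rcases x with _ | _ | x
  · change n ≤ _; omega
  · change φ.clauses.length ≤ _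
    exact m_le_limit k c (length_clauses_le φ)
  · have := getD_encode_lt φ (x + 2) (by omega)
    exact this.le.trans (by omega)

/-- The literals of a formula in one number. -/
def packed : ℕ := pack k n φ.clauses.length fun x => φ.encode.getD x 0

theorem lit_packed {i s : ℕ} (hi : i < φ.clauses.length) (hs : s < k) :
    lit k n (packed φ) i s =
      2 * ((φ.clauses[i] ⟨s, hs⟩).1 : ℕ) + (φ.clauses[i] ⟨s, hs⟩).2.toNat := by
  have hlt : i * k + s < φ.clauses.length * k := by
    have : (i + 1) * k ≤ φ.clauses.length * k := Nat.mul_le_mul_right _ hi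
    rw [add_mul, one_mul] at this
    omega
  rw [← getD_encode_two_add φ hi hs, lit, packed, pack,
    sum_digits_div_mod _ (fun j _ => getD_encode_lt φ (2 + j) (by omega)) hlt]

theorem lit_packed_lt {i s : ℕ} (hi : i < φ.clauses.length) (hs : s < k) :
    lit k n (packed φ) i s < 2 * n := by
  rw [lit_packed φ hi hs]
  have h1 := (φ.clauses[i] ⟨s, hs⟩).1.2
  have h2 := Bool.toNat_le (φ.clauses[i] ⟨s, hs⟩).2
  omega

theorem lit_packed_div {i s : ℕ} (hi : i < φ.clauses.length) (hs : s < k) :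
    lit k n (packed φ) i s / 2 = (φ.clauses[i] ⟨s, hs⟩).1 := by
  rw [lit_packed φ hi hs]
  have h2 := Bool.toNat_le (φ.clauses[i] ⟨s, hs⟩).2
  omega

theorem lit_packed_mod {i s : ℕ} (hi : i < φ.clauses.length) (hs : s < k) :
    lit k n (packed φ) i s % 2 = (φ.clauses[i] ⟨s, hs⟩).2.toNat := by
  rw [lit_packed φ hi hs]
  have h2 := Bool.toNat_le (φ.clauses[i] ⟨s, hs⟩).2
  omega

variable {φ}

theorem satisfiable_of_falseClauses {a b : ℕ}
    (h : falseClauses k n φ.clauses.length (packed φ) a b = 0) : φ.Satisfiable := by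
  rw [falseClauses_eq_zero_iff fun i hi s hs => lit_packed_lt φ hi hs] at h
  refine ⟨fun x => decide (assignment (half n) a b x = 1), fun cl hcl => ?_⟩
  obtain ⟨i, hi, rfl⟩ := List.getElem_of_mem hcl
  obtain ⟨s, hs, h⟩ := h i hi
  rw [lit_packed_div φ hi hs, lit_packed_mod φ hi hs] at h
  refine ⟨⟨s, hs⟩, ?_⟩
  change decide (_ = 1) = _
  rw [h]
  cases (φ.clauses[i] ⟨s, hs⟩).2 <;> rfl

theorem exists_le_dist_sq (c : ℕ) (h : φ.Satisfiable) :
    ∃ a b, 4 * (order k c n : ℝ) ≤ dist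
      ((instanceOf k c n φ.clauses.length (packed φ)).point a)
      ((instanceOf k c n φ.clauses.length (packed φ)).point b) ^ 2 := by
  obtain ⟨v, hv⟩ := h
  obtain ⟨a, ha, b, hb, ha2, hb2, hab⟩ := exists_assignment (half n)
    (fun x => if h : x < n then (v ⟨x, h⟩).toNat else 0) fun i => by
      split_ifs
      · exact Nat.lt_succ_of_le (Bool.toNat_le _)
      · norm_num
  have hlit : ∀ i < φ.clauses.length, ∀ s < k, lit k n (packed φ) i s < 2 * n :=
    fun i hi s hs => lit_packed_lt φ hi hs
  have hfalse : falseClauses k n φ.clauses.length (packed φ) a b = 0 := by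
    rw [falseClauses_eq_zero_iff hlit]
    intro i hi
    obtain ⟨s, hs⟩ := hv _ (List.getElem_mem hi)
    refine ⟨s, s.2, ?_⟩
    have hx := (φ.clauses[i] s).1.2
    rw [lit_packed_div φ hi s.2, lit_packed_mod φ hi s.2, hab _ (by unfold half; omega),
      dif_pos hx, ← hs]
  obtain ⟨a', ha', ha2', hacc⟩ := exists_accepted (c := c) hlit ha ha2 hfalse
  exact ⟨⟨a', ha'⟩, ⟨b, hb.trans_le (two_pow_le_points k c n)⟩,
    le_dist_sq_of_accepts ha' _ ha2' hb2 hacc⟩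

theorem length_clauses_lt_order (φ : KCNF k n) (c : ℕ) : φ.clauses.length < order k c n := by
  have h1 := length_clauses_le φ
  have h2 := (order_spec k c n).2.1
  have : 1 * (2 * n + 2) ^ k ≤ (6 * c + 1) * (2 * n + 2) ^ k := Nat.mul_le_mul_right _ (by omega)
  omega

/-- Both orders are excluded because the parities of `a` and `b` are not fixed. The excess `6 *
tuples k n` is at most a `c`-th part of the order. -/
theorem mul_dist_sq_le {c : ℕ} (a b : Fin (points k c n))
    (hab : falseClauses k n φ.clauses.length (packed φ) a b ≠ 0)
    (hba : falseClauses k n φ.clauses.length (packed φ) b a ≠ 0) :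
    c * dist ((instanceOf k c n φ.clauses.length (packed φ)).point a)
      ((instanceOf k c n φ.clauses.length (packed φ)).point b) ^ 2 ≤
      (order k c n : ℝ) * (c + 1) := by
  have h := dist_sq_le (c := c) (fun i hi s hs => lit_packed_lt φ hi hs)
    (length_clauses_lt_order φ c) a b hab hba
  have h2 : 6 * (tuples k n : ℝ) * c ≤ order k c n := by exact_mod_cast mul_tuples_le_order k c n
  nlinarith [mul_le_mul_of_nonneg_left h (Nat.cast_nonneg (α := ℝ) c)]

theorem le_diam_sq (c : ℕ) (h : φ.Satisfiable) : 4 * (order k c n : ℝ) ≤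
    (instanceOf k c n φ.clauses.length (packed φ)).diam ^ 2 := by
  obtain ⟨a, b, hab⟩ := exists_le_dist_sq c h
  exact hab.trans (pow_le_pow_left₀ dist_nonneg (dist_point_le_diam _ a b) 2)

/-- A positive answer is always right, as a satisfying assignment has been seen. If the test fails
in both orders, the two points are so close that the approximation excludes the diameter of a
satisfiable formula. The maximum with `0` allows squaring when `α` is negative. -/
theorem checkPair_eq_one_iff {c : ℕ} {α : ℝ} (hα : max α 0 ^ 2 * (c + 1) < 4 * c) {a b : ℕ}
    (h : (instanceOf k c n φ.clauses.length (packed φ)).IsApproxPair α a b) :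
    checkPair k n φ.clauses.length (packed φ) a b = 1 ↔ φ.Satisfiable := by
  unfold checkPair
  split_ifs with h1 h2
  · simpa using satisfiable_of_falseClauses h1
  · simpa using satisfiable_of_falseClauses h2
  · refine iff_of_false (by norm_num) fun hsat => ?_
    obtain ⟨ha, hb, h⟩ := h
    have h3 := le_diam_sq c hsat
    have h4 := mul_dist_sq_le (φ := φ) ⟨a, ha⟩ ⟨b, hb⟩ h1 h2
    set d := dist ((instanceOf k c n φ.clauses.length (packed φ)).point ⟨a, ha⟩)
      ((instanceOf k c n φ.clauses.length (packed φ)).point ⟨b, hb⟩)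
    have hd : 0 ≤ d := dist_nonneg
    have h5 : (instanceOf k c n φ.clauses.length (packed φ)).diam ≤ max α 0 * d :=
      h.trans (mul_le_mul_of_nonneg_right (le_max_left _ _) hd)
    have h6 := pow_le_pow_left₀ Metric.diam_nonneg h5 2
    have hq : (0 : ℝ) < order k c n := by exact_mod_cast (order_spec k c n).1.pos
    rw [mul_pow] at h6
    have h7 : 4 * (order k c n : ℝ) * c ≤ max α 0 ^ 2 * (c * d ^ 2) := by
      have := mul_le_mul_of_nonneg_right (h3.trans h6) (Nat.cast_nonneg (α := ℝ) c)
      linarith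
    have h8 := mul_le_mul_of_nonneg_left h4 (sq_nonneg (max α 0))
    have h9 := mul_lt_mul_of_pos_left hα hq
    linarith

/-- The threshold is the bound for the squared diameter in the unsatisfiable case. A lower bound of
the diameter cannot exceed it then, and in the satisfiable case the approximation factor is too
small for the value to stay below it. -/
theorem checkValue_eq_one_iff {c : ℕ} (hc : 0 < c) {α : ℝ}
    (hα : max α 0 ^ 2 * (c + 1) < 4 * c) {a b : ℕ}
    (h : (instanceOf k c n φ.clauses.length (packed φ)).IsApproxValue α a b) :
    checkValue k c n a b = 1 ↔ φ.Satisfiable := by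
  obtain ⟨hb, hle, hge⟩ := h
  have hq : (0 : ℝ) < order k c n := by exact_mod_cast (order_spec k c n).1.pos
  have hb' : (0 : ℝ) < b := by exact_mod_cast hb
  have hc' : (0 : ℝ) < c := by exact_mod_cast hc
  have hx : (0 : ℝ) ≤ (a : ℝ) / b := by positivity
  have hkey : checkValue k c n a b = 1 ↔
      (order k c n : ℝ) * (c + 1) < ((a : ℝ) / b) ^ 2 * c := by
    have h0 : checkValue k c n a b = 1 ↔
        b ^ 2 * (order k c n * (c + 1)) < a ^ 2 * c := by
      unfold checkValue; split_ifs with h <;> simp [h]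
    rw [h0, div_pow, div_mul_eq_mul_div, lt_div_iff₀ (by positivity), mul_comm _ ((b : ℝ) ^ 2)]
    exact_mod_cast Iff.rfl
  rw [hkey]
  refine ⟨fun h => ?_, fun hsat => ?_⟩
  · by_contra hsat
    have hdiam : (instanceOf k c n φ.clauses.length (packed φ)).diam ≤
        √((order k c n : ℝ) * (c + 1) / c) := by
      refine Metric.diam_le_of_forall_dist_le (Real.sqrt_nonneg _) ?_
      rintro _ ⟨x, rfl⟩ _ ⟨y, rfl⟩
      refine Real.le_sqrt_of_sq_le ?_
      rw [le_div_iff₀ hc', mul_comm]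
      exact mul_dist_sq_le x y (fun h => hsat (satisfiable_of_falseClauses h))
        fun h => hsat (satisfiable_of_falseClauses h)
    have h2 := pow_le_pow_left₀ hx (hle.trans hdiam) 2
    rw [Real.sq_sqrt (by positivity), le_div_iff₀ hc'] at h2
    linarith
  · have h3 := le_diam_sq c hsat
    have h5 : (instanceOf k c n φ.clauses.length (packed φ)).diam ≤ max α 0 * ((a : ℝ) / b) :=
      hge.trans (mul_le_mul_of_nonneg_right (le_max_left _ _) hx)
    have h6 := pow_le_pow_left₀ Metric.diam_nonneg h5 2
    rw [mul_pow] at h6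
    by_contra hlt
    rw [not_lt] at hlt
    have h7 : 4 * (order k c n : ℝ) * c ≤ max α 0 ^ 2 * (((a : ℝ) / b) ^ 2 * c) := by
      have := mul_le_mul_of_nonneg_right (h3.trans h6) hc'.le
      linarith
    have h8 := mul_le_mul_of_nonneg_left hlt (sq_nonneg (max α 0))
    have h9 := mul_lt_mul_of_pos_left hα hq
    linarith

/-! ### The reduction -/

/-- Satisfiability can be decided with an algorithm for the constructed point sets. -/
theorem exists_decidesKSAT (k c : ℕ) (p : Program) (ε C : ℝ) (hε : 0 < ε) (hε1 : ε ≤ 1)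
    (good : ∀ {N dTwo dInf : ℕ}, DiameterInstance N dTwo dInf → ℕ → ℕ → Prop)
    (post : ℕ → ℕ → ℕ → ℕ → ℕ → ℕ)
    (hpost : Comp (fun s : State => s.reg 0 = limit k c (s.reg 1) ∧
        s.reg 2 ≤ (2 * s.reg 1 + 2) ^ k)
      fun s => post (s.reg 1) (s.reg 2) (s.reg 3) (s.reg 4) (s.reg 5))
    (hcorrect : ∀ (n : ℕ) (φ : KCNF k n) (a b : ℕ),
      good (instanceOf k c n φ.clauses.length (packed φ)) a b →
        (post n φ.clauses.length (packed φ) a b = 1 ↔ φ.Satisfiable))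
    (hp : ∀ n m F : ℕ, SucceedsWithin p (instanceOf k c n m F).encode
      (C * (points k c n : ℝ) ^ (2 - ε)) (good (instanceOf k c n m F))) :
    ∃ (P : Program) (C' : ℝ), DecidesKSAT k P fun n => C' * 2 ^ ((1 - ε / 4) * (n : ℝ)) := by
  set V : ℕ → ℕ → ℕ → Prop := fun L n m => L = limit k c n ∧ m ≤ (2 * n + 2) ^ k with hV
  have hn : Comp (fun s : State => V (s.reg 0) (s.reg 1) (s.reg 2)) fun s => s.reg 1 :=
    .reg 1 (by norm_num)
  have hm : Comp (fun s : State => V (s.reg 0) (s.reg 1) (s.reg 2)) fun s => s.reg 2 :=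
    .reg 2 (by norm_num)
  have hv : ∀ s : State, V (s.reg 0) (s.reg 1) (s.reg 2) → limit k c (s.reg 1) ≤ Ctx.lim s :=
    fun s hs => hs.1.ge
  have hmv : ∀ s : State, V (s.reg 0) (s.reg 1) (s.reg 2) →
      s.reg 2 ≤ (2 * s.reg 1 + 2) ^ k := fun s hs => hs.2
  obtain ⟨K, P, hP⟩ := exists_reduction (V := V) (comp_limit (k := k) (c := c)
      (.reg 1 (by norm_num)))
    (comp_pack hn hv hm hmv) (comp_cells hn hv hm)
    (comp_cell hn hv hm hmv (.reg 3 (by norm_num)) (.reg 4 (by norm_num))) hpost p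
  -- The additional power pays for the bound `limit k c n + 2` on the length of the input numbers.
  obtain ⟨C', hC'⟩ := exists_cost_le k c (K + 1) ε C hε hε1
  refine ⟨P, C', fun n φ => ?_⟩
  obtain ⟨t, s, hrun, ht, hgood⟩ := hp n φ.clauses.length (packed φ)
  obtain ⟨t', s', hrun', ht', hs'⟩ := hP φ.encode _ n φ.clauses.length (packed φ)
    (limit k c n + 2) t s rfl rfl rfl ⟨rfl, length_clauses_le φ⟩
    (fun x => (len_le_add_one _).trans (by have := getD_encode_le φ c x; omega))
    (fun x => by
      rw [getD_encode_instanceOf]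
      split_ifs with h
      · rfl
      · exact cell_eq_zero (not_lt.1 h))
    (by rw [length_encode]; unfold cells; omega) hrun
  refine ⟨t', s', hrun', le_trans ?_ (hC' n t ht), by rw [hs']; exact hcorrect n φ _ _ hgood⟩
  have hmk := mul_le_limit k c (length_clauses_le φ)
  have h1 : cells k c n φ.clauses.length + t + 1 ≤
      points k c n * (order k c n * columns k c n) + (limit k c n + 6) + t := by
    unfold cells; omega
  have h2 : t' ≤ (limit k c n + 2) ^ (K + 1) *
      (points k c n * (order k c n * columns k c n) + (limit k c n + 6) + t) := by
    rw [pow_succ]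
    exact ht'.trans (Nat.mul_le_mul_left _ h1)
  calc (t' : ℝ) ≤ ((limit k c n + 2) ^ (K + 1) *
      (points k c n * (order k c n * columns k c n) + (limit k c n + 6) + t) : ℕ) :=
        Nat.cast_le.2 h2
    _ = _ := by push_cast; ring

/-- The constructed points satisfy all the restrictions. Replacing `ε` by `min ε 1` and `C` by `|C|`
only weakens the time bound, since there is at least one point. -/
theorem succeedsWithin_instanceOf {k c : ℕ} {p : Program} {ε C : ℝ}
    {good : ∀ {N dTwo dInf : ℕ}, DiameterInstance N dTwo dInf → ℕ → ℕ → Prop}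
    (hp : ∀ (N dTwo dInf : ℕ), 1 ≤ N → 1 ≤ dTwo → 1 ≤ dInf →
      dTwo * dInf ≤ maxDimension k c N → ∀ X : DiameterInstance N dTwo dInf,
        (∀ a i j, |X.coord a i j| ≤ 1) →
          SucceedsWithin p X.encode (C * (N : ℝ) ^ (2 - ε)) (good X)) (n m F : ℕ) :
    SucceedsWithin p (instanceOf k c n m F).encode
      (|C| * (points k c n : ℝ) ^ (2 - min ε 1)) (good (instanceOf k c n m F)) := by
  have hN : 1 ≤ points k c n := (Nat.one_le_two_pow).trans (two_pow_le_points k c n)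
  obtain ⟨t, s, hrun, ht, hgood⟩ := hp _ _ _ hN (order_spec k c n).1.pos
    (columns_pos k c n) (dimension_le_maxDimension k c n) (instanceOf k c n m F)
    fun a i j => abs_coord_le (code_le_two _ _ _ _ _ _ _ _)
  refine ⟨t, s, hrun, ht.trans ?_, hgood⟩
  have h1 : (1 : ℝ) ≤ points k c n := by exact_mod_cast hN
  exact mul_le_mul (le_abs_self C)
    (Real.rpow_le_rpow_of_exponent_le h1 (by linarith [min_le_left ε 1])) (by positivity)
    (abs_nonneg C)

/-- The ratio `4 / (1 + 1 / c)` of the squared diameters tends to `4`, so it exceeds the square of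
any nonnegative `α < 2` once `c` is large. -/
theorem exists_gap {α : ℝ} (hα : α < 2) : ∃ c : ℕ, 0 < c ∧ max α 0 ^ 2 * (c + 1) < 4 * c := by
  have h0 : 0 ≤ max α 0 := le_max_right _ _
  have h2 : max α 0 < 2 := max_lt hα (by norm_num)
  have h4 : 0 < 4 - max α 0 ^ 2 := by nlinarith
  obtain ⟨c, hc⟩ := exists_nat_gt (max α 0 ^ 2 / (4 - max α 0 ^ 2))
  have hc0 : (0 : ℝ) < c := (div_nonneg (sq_nonneg _) h4.le).trans_lt hc
  rw [div_lt_iff₀ h4] at hc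
  exact ⟨c, by exact_mod_cast hc0, by linarith⟩

end SatToDiameter

/-! ### The theorem -/

open RAM SatToDiameter

theorem mainTheorem6 (hSETH : SETH) (ε δ : ℝ) (hε : 0 < ε) (hδ : 0 < δ) :
    ∃ D : ℕ → ℕ, Subpolynomial D ∧
      (¬ ∃ (p : RAM.Program) (C : ℝ),
        FindsApproxPair p (2 - δ) D fun N => C * (N : ℝ) ^ (2 - ε)) ∧
      (¬ ∃ (p : RAM.Program) (C : ℝ),
        FindsApproxValue p (2 - δ) D fun N => C * (N : ℝ) ^ (2 - ε)) := by
  obtain ⟨c, hc, hgap⟩ := exists_gap (by linarith : 2 - δ < 2)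
  have hε' : 0 < min ε 1 := lt_min hε one_pos
  -- The clause width is fixed here, after `c`. The dimension bound depends on both, but not on the
  -- program to be refuted.
  obtain ⟨k, -, hk⟩ := hSETH (min ε 1 / 4) (by positivity)
  have hreg : ∀ r < 6, Comp (fun s : State => s.reg 0 = limit k c (s.reg 1) ∧
      s.reg 2 ≤ (2 * s.reg 1 + 2) ^ k) fun s => s.reg r := fun r hr => .reg r hr
  refine ⟨maxDimension k c, subpolynomial_maxDimension k c, ?_, ?_⟩
  · rintro ⟨p, C, hp⟩
    exact hk (exists_decidesKSAT k c p (min ε 1) |C| hε' (min_le_right _ _)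
      (fun X => X.IsApproxPair (2 - δ)) (checkPair k)
      (comp_checkPair (hreg 1 (by norm_num)) (fun s hs => hs.1.ge) (hreg 2 (by norm_num))
        (fun s hs => hs.2) (hreg 3 (by norm_num)) (hreg 4 (by norm_num)) (hreg 5 (by norm_num)))
      (fun n φ a b h => checkPair_eq_one_iff hgap h) (succeedsWithin_instanceOf hp))
  · rintro ⟨p, C, hp⟩
    exact hk (exists_decidesKSAT k c p (min ε 1) |C| hε' (min_le_right _ _)
      (fun X => X.IsApproxValue (2 - δ)) (fun n _ _ a b => checkValue k c n a b)
      (comp_checkValue (hreg 1 (by norm_num)) (fun s hs => hs.1.ge)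
        (hreg 4 (by norm_num)) (hreg 5 (by norm_num)))
      (fun n φ a b h => checkValue_eq_one_iff hc hgap h) (succeedsWithin_instanceOf hp))
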